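/- **Theorem 3.** For $\alpha>0$, $x>0$, $\tau>0$ let $$\mathcal W_\alpha(x,\tau)=\frac{\operatorname{Im}\left[J_{\alpha+i\tau}(\sqrt x)\,Y_{\alpha-i\tau}(\sqrt x)\right]}{\sinh(\pi\tau)},\qquad (F_\alpha f)(\tau)=\int_0^\infty \mathcal W_\alpha(x,\tau) f(x)\,dx,\qquad f^*(s)=\int_0^\infty f(x)x^{s-1}dx,$$ where $J_\mu,Y_\mu$ are the Bessel functions of the first and second kind. Let $\alpha>0$ and let $f:(0,\infty)\to\mathbb C$ be locally integrable with $f(x)=O(x^{-a})$ as $x\to0$ and $f(x)=O(x^{-b})$ as $x\to\infty$, where $a<b$, $b>1$, $a<1+\alpha$. Suppose that the integral defining $(F_\alpha f)(\tau)$ converges absolutely for every $\tau>0$ (this is automatic if $a<1$), that for some real $\nu$ with $\max(a-1,0)<\nu<\min(1/4,\alpha,b-1)$ the function $s\mapsto f^*(1+s)$ is in $L_1(\nu-i\infty,\nu+i\infty)$, and that $F_\alpha f\in L_2\left((0,\infty);\ \tau(1+\tau)^2\sinh(\pi\tau)\,d\tau\right)$. Then $f$ coincides almost everywhere on $(0,\infty)$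 with a continuous function; with $f$ replaced by this continuous representative, one has for every $x>0$ $$x f(x)=2\pi^2\lim_{N\to\infty}\int_0^\infty \tau\tanh(\pi\tau)\ \prod_{n=1}^N\left(1-\frac4{n^2}\left(x\frac{d}{dx}\right)^2\right)\left(\alpha^2-\left(x\frac{d}{dx}\right)^2\right)\left[\mathcal W_\alpha(x,\tau)\right]\,(F_\alpha f)(\tau)\,d\tau,$$ the integral being absolutely convergent for every $N\ge 0$. -/

import Mathlib

open Filter Topology MeasureTheory Set Asymptotics

noncomputable section

/-- The Bessel function of the first kind `J_ν(z)`, on the principal branch of `(z/2)^ν`.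
Mathlib's `Complex.Gamma` vanishes at its poles, so `1/Γ` is `0` there, as it should be. -/
def besselJ (ν z : ℂ) : ℂ :=
  (z / 2) ^ ν * ∑' k : ℕ, (-1) ^ k * (z / 2) ^ (2 * k) / (k.factorial * Complex.Gamma (ν + k + 1))

/-- The quotient `(J_ν(z) cos(πν) - J_{-ν}(z)) / sin(πν)`, meaningful for noninteger `ν`. -/
def besselYQuot (ν z : ℂ) : ℂ :=
  (besselJ ν z * Complex.cos (Real.pi * ν) - besselJ (-ν) z) / Complex.sin (Real.pi * ν)

open Classical in
/-- The Bessel function of the second kind `Y_ν(z)`; at integer orders it is the limit of the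
quotient in the order. -/
def besselY (ν z : ℂ) : ℂ :=
  if Complex.sin (Real.pi * ν) = 0 then limUnder (𝓝[≠] ν) (fun μ => besselYQuot μ z)
  else besselYQuot ν z

/-- The Weber type kernel
`𝒲_α(x,τ) = Im [J_{α+iτ}(√x) Y_{α-iτ}(√x)] / sinh(πτ)`, for `x > 0` and `τ ≠ 0`. -/
def weberKernel (α x τ : ℝ) : ℝ :=
  (besselJ (α + τ * Complex.I) (Real.sqrt x) * besselY (α - τ * Complex.I) (Real.sqrt x)).im /
    Real.sinh (Real.pi * τ)

/-- The index transform `(F_α f)(τ) = ∫₀^∞ 𝒲_α(x,τ) f(x) dx`. -/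
def indexTransform (α : ℝ) (f : ℝ → ℂ) (τ : ℝ) : ℂ :=
  ∫ x in Ioi (0 : ℝ), (weberKernel α x τ : ℂ) * f x

/-- The measure `τ (1+τ)² sinh(πτ) dτ` on `(0, ∞)`. -/
def weightMeasure : Measure ℝ :=
  (volume.restrict (Ioi (0 : ℝ))).withDensity
    (fun τ => ENNReal.ofReal (τ * (1 + τ) ^ 2 * Real.sinh (Real.pi * τ)))

/-- The differential operator `x d/dx`. -/
def eulerOp (u : ℝ → ℝ) : ℝ → ℝ := fun x => x * deriv u x

/-- The differential operator `∏_{n=1}^N (1 - (4/n²) (x d/dx)²)`. -/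
def prodOp : ℕ → (ℝ → ℝ) → ℝ → ℝ
  | 0, u => u
  | N + 1, u => fun x =>
      prodOp N u x - 4 / ((N : ℝ) + 1) ^ 2 * eulerOp (eulerOp (prodOp N u)) x

/-- The differential operator `∏_{n=1}^N (1 - (4/n²) (x d/dx)²) (α² - (x d/dx)²)`. -/
def inversionOp (α : ℝ) (N : ℕ) (u : ℝ → ℝ) : ℝ → ℝ :=
  prodOp N (fun x => α ^ 2 * u x - eulerOp (eulerOp u) x)

/-- The integrand (in `τ`) of the `N`-th approximation in the inversion formula at `x`. -/
def inversionIntegrand (α : ℝ) (f : ℝ → ℂ) (N : ℕ) (x τ : ℝ) : ℂ :=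
  ((τ * Real.tanh (Real.pi * τ) * inversionOp α N (fun y => weberKernel α y τ) x : ℝ) : ℂ) *
    indexTransform α f τ

end

/-!
The proof expresses everything through Mellin transforms. Put `s = ν + it`.

*The kernel.* By the power series of products `J_μ(√x) J_l(√x)` and the residue theorem, the kernel
is a Mellin–Barnes integral
`𝒲_α(x, τ) = cosh(πτ) / (2π³) ∫ Γ(s + iτ) Γ(s - iτ) H(s) x^{-s} dt`, with
`H(s) = 4^s Γ(s + α) Γ(1 - 2s) / Γ(1 + α - s)` (`weberKernel_eq_integral`, `kernelMellin`).
Each application of `x d/dx` multiplies the density by `-s`, so that the differential operator of the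
inversion formula multiplies it by `(α² - s²) ∏_{n ≤ N} (1 - 4s²/n²)`
(`inversionOp_eq_verticalTransform`).

*The pairing identity.* The central fact is
`∫₀^∞ τ sinh(πτ) F_α f(τ) Γ(s + iτ) Γ(s - iτ) dτ = ½ H(-s) f*(1 + s)`
(`integral_mul_indexTransform_mul_gammaPair`). The product of two Gamma functions is a sine transform
of a power of `sinh θ` (`integral_sin_mul_sinhPow`), and the kernel is one too:
`τ 𝒲_α(x, τ) = (2/π²) ∫₀^∞ sin(2τθ) coth θ χ(x sinh² θ) dθ` with an explicit inverse Mellin transform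
`χ` (`mul_weberKernel_eq`, `weberProfile`). Hence `τ F_α f(τ)` is the sine transform of
`coth θ ∫ χ(x sinh² θ) f(x) dx`. Sine inversion recovers this function from `F_α f`, and its integral
against `(2 sinh θ)^{-2s}` is the Mellin transform of a Mellin convolution.

*Integrability of `f`.* The sine representation of `τ F_α f(τ)` needs `f` to be integrable. Near
infinity this holds because `b > 1`. Near `0` it follows from the absolute convergence of the transform
for all `τ`: there the kernel behaves like `Re (A(τ) x^{iτ})` up to a positive power of `x`, and by
the Riemann–Lebesgue lemma the average over `τ` of its absolute value is bounded below
(`integrableOn_of_integrableOn_weberKernel_mul`).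

*The limit.* By Fubini, the pairing identity and the collapse
`(α² - s²) H(s) H(-s) = 2πs / sin(2πs)` (`sq_sub_sq_mul_kernelMellin_mul`), the `N`-th approximation
equals `(1/2π) ∫ R_N(s) f*(1 + s) x^{-s} dt` with
`R_N(s) = ∏_{n ≤ N} (1 - 4s²/n²) · 2πs / sin(2πs)` (`integral_inversionIntegrand_eq`). The factors
`R_N` tend to `1`, boundedly on the line because `0 < ν < 1/2` (`norm_sinProd_mul_div_sin_le`). The limit
is therefore the Mellin inversion integral of `x f(x)`, which is continuous in `x` and equals `x f(x)`
almost everywhere (`mellinInv_mellin_ae_eq`).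
-/

/-! ### Exponential bounds for the Gamma function on vertical strips -/

/-- The ratio `|Γ(s)| / Γ(re s)` does not decrease when `s` moves to the right: compare the Beta
integrals `B(s, d)` and `B(re s, d)`. This transfers bounds from one vertical line to all lines to
its left. -/
lemma norm_Gamma_mul_Gamma_re_le {s : ℂ} {d : ℝ} (hs : 0 < s.re) (hd : 0 < d) :
    ‖Complex.Gamma s‖ * Real.Gamma (s.re + d) ≤ ‖Complex.Gamma (s + d)‖ * Real.Gamma s.re := by
  have hd' : 0 < (d : ℂ).re := by simpa using hd
  have h1 := Complex.Gamma_mul_Gamma_eq_betaIntegral hs hd'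
  have h2 := Complex.Gamma_mul_Gamma_eq_betaIntegral (s := (s.re : ℂ)) (t := (d : ℂ))
    (by simpa using hs) hd'
  have hB : ‖s.betaIntegral d‖ ≤ ‖(s.re : ℂ).betaIntegral d‖ := by
    have h3 : (s.re : ℂ).betaIntegral d
        = ((∫ x in (0 : ℝ)..1, x ^ (s.re - 1) * (1 - x) ^ (d - 1) : ℝ) : ℂ) := by
      rw [Complex.betaIntegral, ← intervalIntegral.integral_ofReal]
      refine intervalIntegral.integral_congr fun x hx => ?_
      rw [uIcc_of_le zero_le_one] at hx
      have hx1 : 0 ≤ 1 - x := by linarith [hx.2]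
      simp only [Complex.ofReal_mul]
      rw [Complex.ofReal_cpow hx.1, Complex.ofReal_cpow hx1]
      push_cast; rfl
    have h0 : 0 ≤ ∫ x in (0 : ℝ)..1, x ^ (s.re - 1) * (1 - x) ^ (d - 1) := by
      refine intervalIntegral.integral_nonneg zero_le_one fun x hx => ?_
      have : 0 ≤ 1 - x := by linarith [hx.2]
      exact mul_nonneg (Real.rpow_nonneg hx.1 _) (Real.rpow_nonneg this _)
    rw [h3, Complex.norm_real, Real.norm_of_nonneg h0, Complex.betaIntegral]
    refine (intervalIntegral.norm_integral_le_integral_norm zero_le_one).trans (le_of_eq ?_)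
    refine intervalIntegral.integral_congr_ae ?_
    have : ∀ᵐ x : ℝ, x ≠ 1 := by simp [ae_iff, measure_singleton]
    filter_upwards [this] with x hx1 hx
    rw [uIoc_of_le zero_le_one] at hx
    have hx2 : 0 < 1 - x := by have := lt_of_le_of_ne hx.2 hx1; linarith
    have e1 : (1 - (x : ℂ)) = ((1 - x : ℝ) : ℂ) := by push_cast; rfl
    rw [norm_mul, e1, Complex.norm_cpow_eq_rpow_re_of_pos hx.1,
      Complex.norm_cpow_eq_rpow_re_of_pos hx2]
    simp
  have hG1 : ‖Complex.Gamma (s.re : ℂ)‖ = Real.Gamma s.re := by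
    rw [Complex.Gamma_ofReal, Complex.norm_real, Real.norm_of_nonneg (Real.Gamma_pos_of_pos hs).le]
  have hG2 : ‖Complex.Gamma (d : ℂ)‖ = Real.Gamma d := by
    rw [Complex.Gamma_ofReal, Complex.norm_real, Real.norm_of_nonneg (Real.Gamma_pos_of_pos hd).le]
  have hG3 : ‖Complex.Gamma ((s.re : ℂ) + d)‖ = Real.Gamma (s.re + d) := by
    rw [← Complex.ofReal_add, Complex.Gamma_ofReal, Complex.norm_real,
      Real.norm_of_nonneg (Real.Gamma_pos_of_pos (by linarith)).le]
  have k1 := congrArg norm h1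
  have k2 := congrArg norm h2
  rw [norm_mul, norm_mul, hG2] at k1
  rw [norm_mul, norm_mul, hG1, hG2, hG3] at k2
  have p1 := Real.Gamma_pos_of_pos hd
  have p3 := Real.Gamma_pos_of_pos (show 0 < s.re + d by linarith)
  refine le_of_mul_le_mul_right ?_ p1
  calc ‖Complex.Gamma s‖ * Real.Gamma (s.re + d) * Real.Gamma d
      = Real.Gamma (s.re + d) * (‖Complex.Gamma (s + d)‖ * ‖s.betaIntegral d‖) := by
        rw [← k1]; ring
    _ ≤ Real.Gamma (s.re + d) * (‖Complex.Gamma (s + d)‖ * ‖(s.re : ℂ).betaIntegral d‖) := by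
        gcongr
    _ = ‖Complex.Gamma (s + d)‖ * (Real.Gamma (s.re + d) * ‖(s.re : ℂ).betaIntegral d‖) := by ring
    _ = ‖Complex.Gamma (s + d)‖ * Real.Gamma s.re * Real.Gamma d := by rw [← k2]; ring

lemma norm_Gamma_half_add_mul_I_le (u : ℝ) :
    ‖Complex.Gamma (1 / 2 + u * Complex.I)‖ ≤ 3 * Real.exp (-(Real.pi / 2) * |u|) := by
  have h1 := Complex.Gamma_mul_Gamma_one_sub (1 / 2 + u * Complex.I)
  have h2 : (1 - (1 / 2 + u * Complex.I) : ℂ)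
      = (starRingEnd ℂ) (1 / 2 + u * Complex.I) := by
    simp only [map_add, map_mul, Complex.conj_I, Complex.conj_ofReal, map_div₀, map_one]
    have : (starRingEnd ℂ) 2 = 2 := Complex.conj_ofNat 2
    rw [this]; ring
  have h3 : Complex.sin (Real.pi * (1 / 2 + u * Complex.I)) = (Real.cosh (Real.pi * u) : ℂ) := by
    rw [show (Real.pi * (1 / 2 + u * Complex.I) : ℂ)
      = (Real.pi * u : ℂ) * Complex.I + Real.pi / 2 by ring, Complex.sin_add_pi_div_two,
      Complex.cos_mul_I]
    push_cast; rfl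
  rw [h2, Complex.Gamma_conj, h3, Complex.mul_conj] at h1
  have h4 : Complex.normSq (Complex.Gamma (1 / 2 + u * Complex.I))
      = Real.pi / Real.cosh (Real.pi * u) := by exact_mod_cast h1
  rw [Complex.normSq_eq_norm_sq] at h4
  have h5 : Real.exp (Real.pi * |u|) / 2 ≤ Real.cosh (Real.pi * u) := by
    rw [← Real.cosh_abs, Real.cosh_eq, abs_mul, abs_of_pos Real.pi_pos]
    have := Real.exp_pos (-(Real.pi * |u|))
    linarith
  refine le_of_sq_le_sq ?_ (by positivity)
  rw [h4, mul_pow, ← Real.exp_nat_mul]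
  have e : ((2 : ℕ) : ℝ) * (-(Real.pi / 2) * |u|) = -(Real.pi * |u|) := by push_cast; ring
  rw [e, Real.exp_neg, div_le_iff₀ (Real.cosh_pos _)]
  have hp := Real.pi_lt_four
  have hE := Real.exp_pos (Real.pi * |u|)
  calc Real.pi ≤ 9 * (Real.exp (Real.pi * |u|))⁻¹ * (Real.exp (Real.pi * |u|) / 2) := by
        field_simp; linarith
    _ ≤ 3 ^ 2 * (Real.exp (Real.pi * |u|))⁻¹ * Real.cosh (Real.pi * u) := by
        norm_num; gcongr

/-- Bounds on the lines `re z = n + 1/2`, from the explicit value of `|Γ(1/2 + iu)|` and the functional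
equation. -/
lemma exists_norm_Gamma_half_nat_le (n : ℕ) :
    ∃ C : ℝ, 0 ≤ C ∧ ∀ u : ℝ, ‖Complex.Gamma ((n : ℂ) + 1 / 2 + u * Complex.I)‖
      ≤ C * (1 + |u|) ^ n * Real.exp (-(Real.pi / 2) * |u|) := by
  induction n with
  | zero => exact ⟨3, by norm_num, fun u => by simpa using norm_Gamma_half_add_mul_I_le u⟩
  | succ n ih =>
    obtain ⟨C, hC, h⟩ := ih
    refine ⟨(n + 1) * C, by positivity, fun u => ?_⟩
    have hz : ((n : ℂ) + 1 / 2 + u * Complex.I) ≠ 0 := by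
      intro h0
      have := congrArg Complex.re h0
      simp at this
      linarith [(Nat.cast_nonneg n : (0:ℝ) ≤ n)]
    have e : (((n + 1 : ℕ) : ℂ) + 1 / 2 + u * Complex.I)
        = ((n : ℂ) + 1 / 2 + u * Complex.I) + 1 := by push_cast; ring
    have hn : ‖((n : ℂ) + 1 / 2 + u * Complex.I)‖ ≤ (n + 1) * (1 + |u|) := by
      refine (norm_add_le _ _).trans ?_
      have h1 : ‖(n : ℂ) + 1 / 2‖ = (n : ℝ) + 1 / 2 := by
        rw [show ((n : ℂ) + 1 / 2) = (((n : ℝ) + 1 / 2 : ℝ) : ℂ) by push_cast; ring,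
          Complex.norm_real, Real.norm_of_nonneg (by positivity)]
      rw [h1, norm_mul, Complex.norm_I, Complex.norm_real, Real.norm_eq_abs]
      nlinarith [abs_nonneg u, (Nat.cast_nonneg n : (0:ℝ) ≤ n),
        mul_nonneg (Nat.cast_nonneg n : (0:ℝ) ≤ n) (abs_nonneg u)]
    rw [e, Complex.Gamma_add_one _ hz, norm_mul]
    calc _ ≤ ((n + 1) * (1 + |u|)) * (C * (1 + |u|) ^ n * Real.exp (-(Real.pi / 2) * |u|)) := by
          gcongr; exact h u
      _ = _ := by ring

/-- The exponential rate used for all Gamma estimates; any rate below `π / 2` (and above `π / 4`)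
would serve. -/
noncomputable def gammaRate : ℝ := 3 * Real.pi / 8

/-- Decay on a strip in the right half-plane, by comparison with a line `re z = n + 1/2` to its right. -/
lemma exists_norm_Gamma_le_of_pos {A B : ℝ} (hA : 0 < A) :
    ∃ C : ℝ, 0 ≤ C ∧ ∀ z : ℂ, A ≤ z.re → z.re ≤ B →
      ‖Complex.Gamma z‖ ≤ C * Real.exp (-gammaRate * |z.im|) := by
  obtain ⟨n, hn⟩ := exists_nat_gt B
  obtain ⟨C, hC, h⟩ := exists_norm_Gamma_half_nat_le n
  -- the polynomial factor is absorbed by lowering the rate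
  obtain ⟨C1, hC1⟩ : ∃ C1 : ℝ, ∀ v : ℝ, 0 ≤ v →
      (1 + v) ^ n * Real.exp (-(Real.pi / 8) * v) ≤ C1 := by
    have ht : Tendsto (fun v : ℝ => (1 + v) ^ n * Real.exp (-(Real.pi / 8) * v)) atTop (𝓝 0) := by
      have h1 := (Real.tendsto_pow_mul_exp_neg_atTop_nhds_zero n).comp
        ((tendsto_id.const_mul_atTop (show 0 < Real.pi / 8 by positivity)).comp
          (tendsto_atTop_add_const_left _ (1 : ℝ) (tendsto_id (α := ℝ))))
      have h2 := h1.const_mul ((Real.pi / 8) ^ n)⁻¹ |>.mul_const (Real.exp (Real.pi / 8))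
      simp only [mul_zero, zero_mul] at h2
      refine h2.congr fun v => ?_
      simp only [Function.comp, id]
      rw [mul_pow, show -(Real.pi / 8 * (1 + v)) = -(Real.pi / 8) * v + -(Real.pi / 8) by ring,
        Real.exp_add, Real.exp_neg (Real.pi / 8)]
      field_simp
    obtain ⟨T, hT⟩ := eventually_atTop.1 (ht.eventually (gt_mem_nhds (zero_lt_one)))
    obtain ⟨C2, hC2⟩ := (isCompact_Icc (a := (0 : ℝ)) (b := T)).bddAbove_image
      (f := fun v : ℝ => (1 + v) ^ n * Real.exp (-(Real.pi / 8) * v)) (by fun_prop)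
    refine ⟨max 1 C2, fun v hv => ?_⟩
    rcases le_total T v with h | h
    · exact (hT v h).le.trans (le_max_left _ _)
    · exact (hC2 ⟨v, ⟨hv, h⟩, rfl⟩).trans (le_max_right _ _)
  obtain ⟨C3, hC3⟩ := (isCompact_Icc (a := A) (b := B)).bddAbove_image (f := Real.Gamma)
    (fun x hx => (Real.differentiableAt_Gamma
      (fun m hm => by
        have := hx.1
        have hm0 : (0 : ℝ) ≤ m := Nat.cast_nonneg m
        linarith)).continuousAt.continuousWithinAt)
  have hG : 0 < Real.Gamma (n + 1 / 2) := Real.Gamma_pos_of_pos (by positivity)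
  refine ⟨max 0 (C * C1 * C3 / Real.Gamma (n + 1 / 2)), le_max_left _ _, fun z h1 h2 => ?_⟩
  have hz : 0 < z.re := hA.trans_le h1
  have hd : 0 < (n : ℝ) + 1 / 2 - z.re := by linarith
  have key := norm_Gamma_mul_Gamma_re_le hz hd
  rw [show z.re + ((n : ℝ) + 1 / 2 - z.re) = n + 1 / 2 by ring] at key
  have e : z + (((n : ℝ) + 1 / 2 - z.re : ℝ) : ℂ) = (n : ℂ) + 1 / 2 + z.im * Complex.I := by
    apply Complex.ext <;> simp
  rw [e] at key
  have hgz : Real.Gamma z.re ≤ C3 := hC3 ⟨z.re, ⟨h1, h2⟩, rfl⟩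
  have hgp : 0 < Real.Gamma z.re := Real.Gamma_pos_of_pos hz
  have hv := hC1 |z.im| (abs_nonneg _)
  have hC1' : 0 ≤ C1 := le_trans (by positivity) hv
  have hexp : Real.exp (-(Real.pi / 2) * |z.im|)
      = Real.exp (-(Real.pi / 8) * |z.im|) * Real.exp (-gammaRate * |z.im|) := by
    rw [← Real.exp_add]; congr 1; rw [gammaRate]; ring
  have : ‖Complex.Gamma z‖ ≤ C * C1 * C3 / Real.Gamma (n + 1 / 2)
      * Real.exp (-gammaRate * |z.im|) := by
    rw [div_mul_eq_mul_div, le_div_iff₀ hG]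
    calc _ ≤ _ := key
      _ ≤ (C * (1 + |z.im|) ^ n * Real.exp (-(Real.pi / 2) * |z.im|)) * C3 := by
          gcongr
          exact h z.im
      _ = C * ((1 + |z.im|) ^ n * Real.exp (-(Real.pi / 8) * |z.im|)) * C3
            * Real.exp (-gammaRate * |z.im|) := by rw [hexp]; ring
      _ ≤ C * C1 * C3 * Real.exp (-gammaRate * |z.im|) := by
          have : 0 ≤ C3 := hgp.le.trans hgz
          gcongr
  refine this.trans ?_
  gcongr
  exact le_max_right _ _

/-- Away from the real axis the Gamma function decays exponentially on every vertical strip. -/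
lemma exists_norm_Gamma_le (A B : ℝ) :
    ∃ C : ℝ, 0 ≤ C ∧ ∀ z : ℂ, A ≤ z.re → z.re ≤ B → 1 ≤ |z.im| →
      ‖Complex.Gamma z‖ ≤ C * Real.exp (-gammaRate * |z.im|) := by
  obtain ⟨n, hn⟩ := exists_nat_gt (-A)
  induction n generalizing A B with
  | zero =>
    obtain ⟨C, hC, h⟩ := exists_norm_Gamma_le_of_pos (A := A) (B := B)
      (by simp at hn; exact hn)
    exact ⟨C, hC, fun z h1 h2 _ => h z h1 h2⟩
  | succ n ih =>
    obtain ⟨C, hC, h⟩ := ih (A + 1) (B + 1) (by push_cast at hn; linarith)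
    refine ⟨C, hC, fun z h1 h2 h3 => ?_⟩
    have hz1 : 1 ≤ ‖z‖ := h3.trans (Complex.abs_im_le_norm z)
    have hz : z ≠ 0 := by
      rintro rfl; simp at hz1; linarith
    have := h (z + 1) (by simpa using h1) (by simpa using h2) (by simpa using h3)
    rw [Complex.Gamma_add_one _ hz, norm_mul] at this
    simp only [Complex.add_im, Complex.one_im, add_zero] at this
    refine le_trans ?_ this
    exact le_mul_of_one_le_left (norm_nonneg _) hz1

lemma norm_sin_le_exp (z : ℂ) : ‖Complex.sin z‖ ≤ Real.exp |z.im| := by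
  rw [Complex.sin, norm_div, norm_mul, Complex.norm_I, mul_one]
  have h2 : ‖(2 : ℂ)‖ = 2 := by simp
  rw [h2, div_le_iff₀ two_pos]
  refine (norm_sub_le _ _).trans ?_
  rw [Complex.norm_exp, Complex.norm_exp]
  have e1 : (-z * Complex.I).re = z.im := by simp
  have e2 : (z * Complex.I).re = -z.im := by simp
  rw [e1, e2]
  have := Real.exp_le_exp.2 (le_abs_self z.im)
  have := Real.exp_le_exp.2 (neg_le_abs z.im)
  linarith

/-- Growth of `1 / Γ`, from the decay of `Γ` by the reflection formula. -/
lemma exists_norm_inv_Gamma_le (A B : ℝ) :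
    ∃ C : ℝ, 0 ≤ C ∧ ∀ z : ℂ, A ≤ z.re → z.re ≤ B →
      ‖(Complex.Gamma z)⁻¹‖ ≤ C * Real.exp ((Real.pi - gammaRate) * |z.im|) := by
  obtain ⟨C, hC, h⟩ := exists_norm_Gamma_le (1 - B) (1 - A)
  obtain ⟨C2, hC2⟩ := ((isCompact_Icc (a := A) (b := B)).reProdIm
    (isCompact_Icc (a := (-1 : ℝ)) (b := 1))).bddAbove_image
      (f := fun z => ‖(Complex.Gamma z)⁻¹‖)
      (Complex.differentiable_one_div_Gamma.continuous.norm.continuousOn)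
  have hrate : 0 ≤ Real.pi - gammaRate := by
    have := Real.pi_pos
    rw [gammaRate]; linarith
  refine ⟨max C C2, hC.trans (le_max_left _ _), fun z h1 h2 => ?_⟩
  rcases le_total 1 |z.im| with h3 | h3
  · have hrefl := Complex.Gamma_mul_Gamma_one_sub z
    have hsin : Complex.sin (Real.pi * z) ≠ 0 := by
      intro h0
      obtain ⟨k, hk⟩ := Complex.sin_eq_zero_iff.1 h0
      have hk' : z = k := by
        have hp : (Real.pi : ℂ) ≠ 0 := by exact_mod_cast Real.pi_ne_zero
        exact mul_left_cancel₀ hp (by rw [hk]; ring)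
      rw [hk'] at h3
      simp at h3
      linarith
    have hp : (Real.pi : ℂ) ≠ 0 := by exact_mod_cast Real.pi_ne_zero
    have hG0 : Complex.Gamma z ≠ 0 := by
      intro h0
      rw [h0, zero_mul] at hrefl
      exact div_ne_zero hp hsin hrefl.symm
    have e : (Complex.Gamma z)⁻¹ = Complex.Gamma (1 - z) * Complex.sin (Real.pi * z) / Real.pi := by
      rw [eq_div_iff hsin] at hrefl
      rw [eq_div_iff hp, inv_mul_eq_iff_eq_mul₀ hG0]
      linear_combination -hrefl
    have b1 := h (1 - z) (by simp; linarith) (by simp; linarith) (by simpa using h3)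
    have b2 := norm_sin_le_exp (Real.pi * z)
    have i1 : (1 - z).im = -z.im := by simp
    have i2 : ((Real.pi : ℂ) * z).im = Real.pi * z.im := by simp
    rw [i1, abs_neg] at b1
    rw [i2, abs_mul, abs_of_pos Real.pi_pos] at b2
    rw [e, norm_div, norm_mul, Complex.norm_real, Real.norm_of_nonneg Real.pi_pos.le]
    have hpi : 1 ≤ Real.pi := by linarith [Real.pi_gt_three]
    calc _ ≤ ‖Complex.Gamma (1 - z)‖ * ‖Complex.sin (Real.pi * z)‖ :=
          div_le_self (by positivity) hpi
      _ ≤ (C * Real.exp (-gammaRate * |z.im|)) * Real.exp (Real.pi * |z.im|) := by gcongr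
      _ = C * Real.exp ((Real.pi - gammaRate) * |z.im|) := by
          rw [mul_assoc, ← Real.exp_add]; congr 2; ring
      _ ≤ _ := by gcongr; exact le_max_left _ _
  · have hb : ‖(Complex.Gamma z)⁻¹‖ ≤ C2 :=
      hC2 ⟨z, Complex.mem_reProdIm.2 ⟨⟨h1, h2⟩, abs_le.1 h3⟩, rfl⟩
    calc _ ≤ max C C2 := hb.trans (le_max_right _ _)
      _ ≤ _ := le_mul_of_one_le_right (hC.trans (le_max_left _ _))
        (Real.one_le_exp (by positivity))

/-! ### Integrals over vertical lines: moving the contour -/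

lemma integrable_exp_neg_mul_abs {c : ℝ} (hc : 0 < c) :
    Integrable (fun t : ℝ => Real.exp (-c * |t|)) := by
  rw [← integrableOn_univ, ← Iic_union_Ioi (a := (0 : ℝ))]
  refine IntegrableOn.union ?_ ?_
  · refine (integrableOn_exp_mul_Iic hc 0).congr_fun (fun t ht => ?_) measurableSet_Iic
    simp only [abs_of_nonpos (mem_Iic.1 ht)]
    ring_nf
  · refine (integrableOn_exp_mul_Ioi (neg_lt_zero.2 hc) 0).congr_fun (fun t ht => ?_)
      measurableSet_Ioi
    simp only [abs_of_pos (mem_Ioi.1 ht)]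

lemma integrable_of_exp_bound {h : ℝ → ℂ} (hh : Continuous h) {C c T : ℝ} (hc : 0 < c)
    (hb : ∀ t, T ≤ |t| → ‖h t‖ ≤ C * Real.exp (-c * |t|)) : Integrable h := by
  refine hh.locallyIntegrable.integrable_of_isBigO_cocompact
    (g := fun t : ℝ => Real.exp (-c * |t|)) ?_
    ((integrable_exp_neg_mul_abs hc).integrableAtFilter _)
  refine IsBigO.of_bound C ?_
  have : ∀ᶠ t : ℝ in cocompact ℝ, T ≤ |t| :=
    (tendsto_norm_cocompact_atTop (E := ℝ)).eventually_ge_atTop T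
  filter_upwards [this] with t ht
  simpa [Real.norm_of_nonneg (Real.exp_pos _).le] using hb t ht

lemma continuous_comp_vertical {g : ℂ → ℂ} {a b σ : ℝ}
    (hc : ContinuousOn g {z | a ≤ z.re ∧ z.re ≤ b}) (h1 : a ≤ σ) (h2 : σ ≤ b) :
    Continuous (fun t : ℝ => g (σ + t * Complex.I)) := by
  rw [← continuousOn_univ]
  exact hc.comp (by fun_prop) (fun t _ => by simp [h1, h2])

lemma integrable_vertical {g : ℂ → ℂ} {a b σ C c T : ℝ} (hc : 0 < c)
    (hg : ContinuousOn g {z | a ≤ z.re ∧ z.re ≤ b})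
    (hb : ∀ z : ℂ, a ≤ z.re → z.re ≤ b → T ≤ |z.im| → ‖g z‖ ≤ C * Real.exp (-c * |z.im|))
    (h1 : a ≤ σ) (h2 : σ ≤ b) : Integrable (fun t : ℝ => g (σ + t * Complex.I)) := by
  refine integrable_of_exp_bound (continuous_comp_vertical hg h1 h2) hc (C := C) (T := T)
    fun t ht => ?_
  simpa using hb (σ + t * Complex.I) (by simpa using h1) (by simpa using h2) (by simpa using ht)

/-- Cauchy's theorem on a vertical strip, for exponentially decaying functions. -/
lemma integral_vertical_eq {g : ℂ → ℂ} {a b C c T : ℝ} (hab : a ≤ b) (hc : 0 < c)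
    (hg : ContinuousOn g {z | a ≤ z.re ∧ z.re ≤ b}) {s : Set ℂ} (hs : s.Countable)
    (hd : ∀ z : ℂ, a < z.re → z.re < b → z ∉ s → DifferentiableAt ℂ g z)
    (hb : ∀ z : ℂ, a ≤ z.re → z.re ≤ b → T ≤ |z.im| → ‖g z‖ ≤ C * Real.exp (-c * |z.im|)) :
    ∫ t : ℝ, g (a + t * Complex.I) = ∫ t : ℝ, g (b + t * Complex.I) := by
  have ia := integrable_vertical hc hg hb le_rfl hab
  have ib := integrable_vertical hc hg hb hab le_rfl
  have rect : ∀ R : ℝ, 0 ≤ R →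
      (∫ x : ℝ in a..b, g (x + (-R : ℝ) * Complex.I)) - (∫ x : ℝ in a..b, g (x + R * Complex.I)) +
      Complex.I • (∫ y : ℝ in (-R)..R, g (b + y * Complex.I)) -
      Complex.I • (∫ y : ℝ in (-R)..R, g (a + y * Complex.I)) = 0 := by
    intro R hR
    have := Complex.integral_boundary_rect_eq_zero_of_differentiable_on_off_countable g
      (a + (-R : ℝ) * Complex.I) (b + R * Complex.I) s hs ?_ ?_
    · simpa using this
    · refine hg.mono fun z hz => ?_
      rw [Complex.mem_reProdIm] at hz
      simp only [Complex.add_re, Complex.ofReal_re, Complex.mul_re, Complex.I_re, mul_zero,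
        Complex.ofReal_im, Complex.I_im, mul_one, sub_self, add_zero, uIcc_of_le hab] at hz
      exact hz.1
    · intro z hz
      have hz1 := hz.1
      rw [Complex.mem_reProdIm] at hz1
      simp only [Complex.add_re, Complex.ofReal_re, Complex.mul_re, Complex.I_re, mul_zero,
        Complex.ofReal_im, Complex.I_im, mul_one, sub_self, add_zero, min_eq_left hab,
        max_eq_right hab] at hz1
      exact hd z hz1.1.1 hz1.1.2 hz.2
  have hexp : Tendsto (fun R : ℝ => C * Real.exp (-c * R) * |b - a|) atTop (𝓝 0) := by
    have h1 : Tendsto (fun R : ℝ => Real.exp (-c * R)) atTop (𝓝 0) :=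
      Real.tendsto_exp_atBot.comp (tendsto_id.const_mul_atTop_of_neg (neg_lt_zero.2 hc))
    simpa using (h1.const_mul C).mul_const |b - a|
  have hor : ∀ e : ℝ, |e| = 1 →
      Tendsto (fun R : ℝ => ∫ x : ℝ in a..b, g (x + (e * R : ℝ) * Complex.I)) atTop (𝓝 0) := by
    intro e he
    refine squeeze_zero_norm' ?_ hexp
    filter_upwards [eventually_ge_atTop T, eventually_ge_atTop 0] with R hR hR0
    refine intervalIntegral.norm_integral_le_of_norm_le_const fun x hx => ?_
    rw [uIoc_of_le hab] at hx
    have hn : |e * R| = R := by rw [abs_mul, he, one_mul, abs_of_nonneg hR0]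
    have := hb (x + (e * R : ℝ) * Complex.I) (by simpa using hx.1.le) (by simpa using hx.2)
      (by simpa [hn] using hR)
    simpa [hn] using this
  have h1 := hor (-1) (by simp)
  have h2 := hor 1 (by simp)
  have h3 := intervalIntegral_tendsto_integral ib tendsto_neg_atTop_atBot tendsto_id
  have h4 := intervalIntegral_tendsto_integral ia tendsto_neg_atTop_atBot tendsto_id
  have hlim := ((h1.sub h2).add (h3.const_smul Complex.I)).sub (h4.const_smul Complex.I)
  have hz : Tendsto (fun _ : ℝ => (0 : ℂ)) atTop (𝓝 0) := tendsto_const_nhds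
  have heq := tendsto_nhds_unique (hlim.congr' (f₂ := fun _ => (0 : ℂ)) (by
    filter_upwards [eventually_ge_atTop 0] with R hR
    simpa using rect R hR)) hz
  have hI : Complex.I * ((∫ t : ℝ, g (b + t * Complex.I)) - ∫ t : ℝ, g (a + t * Complex.I)) = 0 := by
    rw [mul_sub]; simpa using heq
  exact (sub_eq_zero.1 ((mul_eq_zero.1 hI).resolve_left Complex.I_ne_zero)).symm

lemma sinh_abs_im_le_norm_sin (z : ℂ) : Real.sinh |z.im| ≤ ‖Complex.sin z‖ := by
  rw [Complex.sin, norm_div, norm_mul, Complex.norm_I, mul_one, Real.sinh_eq]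
  have h2 : ‖(2 : ℂ)‖ = 2 := by simp
  rw [h2]
  gcongr
  have e1 : ‖Complex.exp (-z * Complex.I)‖ = Real.exp z.im := by
    rw [Complex.norm_exp]; simp
  have e2 : ‖Complex.exp (z * Complex.I)‖ = Real.exp (-z.im) := by
    rw [Complex.norm_exp]; simp
  rcases abs_cases z.im with ⟨h, _⟩ | ⟨h, _⟩
  · rw [h, ← e1, ← e2]; exact norm_sub_norm_le _ _
  · rw [h, neg_neg, ← e1, ← e2, norm_sub_rev]; exact norm_sub_norm_le _ _

lemma exp_div_four_le_norm_sin {z : ℂ} (hz : 1 ≤ |z.im|) :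
    Real.exp |z.im| / 4 ≤ ‖Complex.sin z‖ := by
  refine le_trans ?_ (sinh_abs_im_le_norm_sin z)
  rw [Real.sinh_eq, Real.exp_neg]
  have h1 : 2 ≤ Real.exp |z.im| := by linarith [Real.add_one_le_exp |z.im|]
  have h2 : (Real.exp |z.im|)⁻¹ ≤ Real.exp |z.im| / 2 := by
    rw [inv_le_iff_one_le_mul₀ (by linarith)]; nlinarith
  linarith

lemma sin_pi_mul_ne_zero_of_forall_ne_intCast {z : ℂ} (h : ∀ k : ℤ, z ≠ k) : Complex.sin (Real.pi * z) ≠ 0 := by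
  intro h0
  obtain ⟨k, hk⟩ := Complex.sin_eq_zero_iff.1 h0
  have hp : (Real.pi : ℂ) ≠ 0 := by exact_mod_cast Real.pi_ne_zero
  exact h k (mul_left_cancel₀ hp (by rw [hk]; ring))

lemma ne_intCast_of_abs_re_lt_one {z : ℂ} (h1 : -1 < z.re) (h2 : z.re < 1) (h0 : z ≠ 0) (k : ℤ) :
    z ≠ k := by
  rintro rfl
  simp only [Complex.intCast_re] at h1 h2
  have a : -1 < k := by exact_mod_cast h1
  have b : k < 1 := by exact_mod_cast h2
  exact h0 (by simp [show k = 0 by omega])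

lemma norm_pi_div_sin_le {z : ℂ} (hz : 1 ≤ |z.im|) :
    ‖Real.pi / Complex.sin (Real.pi * z)‖ ≤ 4 * Real.pi * Real.exp (-Real.pi * |z.im|) := by
  have e : |((Real.pi : ℂ) * z).im| = Real.pi * |z.im| := by
    simp [abs_mul, abs_of_pos Real.pi_pos]
  have h1 : 1 ≤ |((Real.pi : ℂ) * z).im| := by
    rw [e]; nlinarith [Real.pi_gt_three]
  have h2 := exp_div_four_le_norm_sin h1
  rw [e] at h2
  rw [norm_div, Complex.norm_real, Real.norm_of_nonneg Real.pi_pos.le, neg_mul, Real.exp_neg,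
    div_le_iff₀ (lt_of_lt_of_le (by positivity) h2)]
  calc Real.pi = 4 * Real.pi * (Real.exp (Real.pi * |z.im|))⁻¹ * (Real.exp (Real.pi * |z.im|) / 4) := by
        field_simp
    _ ≤ _ := by gcongr

lemma differentiableAt_pi_div_sin {z : ℂ} (h : ∀ k : ℤ, z ≠ k) :
    DifferentiableAt ℂ (fun z => Real.pi / Complex.sin (Real.pi * z)) z :=
  (differentiableAt_const _).div (by fun_prop) (sin_pi_mul_ne_zero_of_forall_ne_intCast h)

/-- The primitive of `π / cosh (πt)` is the Gudermannian `arctan (sinh (πt))`. -/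
lemma integral_pi_div_cosh : ∫ t : ℝ, Real.pi / Real.cosh (Real.pi * t) = Real.pi := by
  have hd : ∀ t : ℝ, HasDerivAt (fun t => Real.arctan (Real.sinh (Real.pi * t)))
      (Real.pi / Real.cosh (Real.pi * t)) t := by
    intro t
    have h1 : HasDerivAt (fun t : ℝ => Real.pi * t) Real.pi t := by
      simpa using (hasDerivAt_id t).const_mul Real.pi
    have h2 := (Real.hasDerivAt_arctan _).comp t ((Real.hasDerivAt_sinh _).comp t h1)
    refine h2.congr_deriv ?_
    simp only [Function.comp_apply]
    have := Real.cosh_sq (Real.pi * t)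
    have hp := Real.cosh_pos (Real.pi * t)
    rw [show 1 + Real.sinh (Real.pi * t) ^ 2 = Real.cosh (Real.pi * t) ^ 2 by rw [this]; ring]
    field_simp
  have hsinh : Tendsto Real.sinh atTop atTop :=
    Real.sinhOrderIso.tendsto_atTop
  have hsinh' : Tendsto Real.sinh atBot atBot :=
    Real.sinhOrderIso.tendsto_atBot
  have ht : Tendsto (fun t => Real.arctan (Real.sinh (Real.pi * t))) atTop (𝓝 (Real.pi / 2)) :=
    (tendsto_nhds_of_tendsto_nhdsWithin Real.tendsto_arctan_atTop).comp
      (hsinh.comp (tendsto_id.const_mul_atTop Real.pi_pos))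
  have hb : Tendsto (fun t => Real.arctan (Real.sinh (Real.pi * t))) atBot (𝓝 (-(Real.pi / 2))) :=
    (tendsto_nhds_of_tendsto_nhdsWithin Real.tendsto_arctan_atBot).comp
      (hsinh'.comp (tendsto_id.const_mul_atBot Real.pi_pos))
  have hi : Integrable (fun t => Real.pi / Real.cosh (Real.pi * t)) := by
    refine ((integrable_exp_neg_mul_abs Real.pi_pos).const_mul (2 * Real.pi)).mono'
      (by
        refine Continuous.aestronglyMeasurable ?_
        refine continuous_const.div (by fun_prop) fun t => (Real.cosh_pos _).ne') ?_
    refine Eventually.of_forall fun t => ?_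
    have hp := Real.cosh_pos (Real.pi * t)
    rw [Real.norm_of_nonneg (by positivity), div_le_iff₀ hp, neg_mul, Real.exp_neg]
    have h5 : Real.exp (Real.pi * |t|) / 2 ≤ Real.cosh (Real.pi * t) := by
      rw [← Real.cosh_abs, Real.cosh_eq, abs_mul, abs_of_pos Real.pi_pos]
      have := Real.exp_pos (-(Real.pi * |t|))
      linarith
    calc Real.pi = 2 * Real.pi * (Real.exp (Real.pi * |t|))⁻¹ * (Real.exp (Real.pi * |t|) / 2) := by
          field_simp
      _ ≤ _ := by gcongr
  rw [integral_of_hasDerivAt_of_tendsto hd hi hb ht]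
  ring

/-- The contour is moved to `re z = 1/2`, where `sin (πz)` becomes `cosh (πt)`. -/
lemma integral_pi_div_sin_of_pos {σ : ℝ} (h0 : 0 < σ) (h1 : σ < 1) :
    ∫ t : ℝ, Real.pi / Complex.sin (Real.pi * (σ + t * Complex.I)) = Real.pi := by
  set K : ℂ → ℂ := fun z => Real.pi / Complex.sin (Real.pi * z) with hK
  have hdiff : ∀ a b : ℝ, 0 < a → b < 1 → ∀ z : ℂ, a ≤ z.re → z.re ≤ b → DifferentiableAt ℂ K z := by
    intro a b ha hb z h1 h2
    refine differentiableAt_pi_div_sin (ne_intCast_of_abs_re_lt_one (by linarith) (by linarith) ?_)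
    rintro rfl
    simp at h1; linarith
  have half : ∫ t : ℝ, K ((1 / 2 : ℝ) + t * Complex.I) = Real.pi := by
    have : ∀ t : ℝ, K ((1 / 2 : ℝ) + t * Complex.I)
        = ((Real.pi / Real.cosh (Real.pi * t) : ℝ) : ℂ) := by
      intro t
      simp only [hK]
      rw [show (Real.pi * (((1 / 2 : ℝ) : ℂ) + t * Complex.I) : ℂ)
        = (Real.pi * t : ℂ) * Complex.I + Real.pi / 2 by push_cast; ring,
        Complex.sin_add_pi_div_two, Complex.cos_mul_I]
      push_cast; rfl
    simp_rw [this]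
    rw [integral_complex_ofReal, integral_pi_div_cosh]
  rcases le_total σ (1 / 2) with h | h
  · have := integral_vertical_eq (g := K) (C := 4 * Real.pi) (T := 1) h Real.pi_pos
      (fun z hz => (hdiff σ (1 / 2) h0 (by norm_num) z hz.1 hz.2).continuousAt.continuousWithinAt)
      (countable_empty) (fun z h1 h2 _ => hdiff σ (1 / 2) h0 (by norm_num) z h1.le h2.le)
      (fun z _ _ hz => norm_pi_div_sin_le hz)
    exact this.trans half
  · have := integral_vertical_eq (g := K) (C := 4 * Real.pi) (T := 1) h Real.pi_pos
      (fun z hz => (hdiff (1 / 2) σ (by norm_num) h1 z hz.1 hz.2).continuousAt.continuousWithinAt)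
      (countable_empty) (fun z h2 h3 _ => hdiff (1 / 2) σ (by norm_num) h1 z h2.le h3.le)
      (fun z _ _ hz => norm_pi_div_sin_le hz)
    exact this.symm.trans half

lemma integral_pi_div_sin_of_neg {σ : ℝ} (h0 : -1 < σ) (h1 : σ < 0) :
    ∫ t : ℝ, Real.pi / Complex.sin (Real.pi * (σ + t * Complex.I)) = -Real.pi := by
  refine Eq.trans ?_
    (congrArg Neg.neg (integral_pi_div_sin_of_pos (σ := -σ) (by linarith) (by linarith)))
  rw [← integral_neg, ← integral_neg_eq_self]
  refine integral_congr_ae (Eventually.of_forall fun t => ?_)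
  simp only
  rw [show (Real.pi * ((σ : ℂ) + ((-t : ℝ) : ℂ) * Complex.I) : ℂ)
    = -(Real.pi * (((-σ : ℝ) : ℂ) + t * Complex.I)) by push_cast; ring, Complex.sin_neg, div_neg]

/-- The function `π / sin (π (z - p))` has a simple pole with residue `1` at `p`. -/
lemma tendsto_mul_pi_div_sin (p : ℂ) :
    Tendsto (fun z : ℂ => (z - p) * (Real.pi / Complex.sin (Real.pi * (z - p)))) (𝓝[≠] p) (𝓝 1) := by
  have hp : (Real.pi : ℂ) ≠ 0 := by exact_mod_cast Real.pi_ne_zero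
  have hd : HasDerivAt (fun z : ℂ => Complex.sin (Real.pi * (z - p))) Real.pi p := by
    have h1 : HasDerivAt (fun z : ℂ => Real.pi * (z - p)) (Real.pi : ℂ) p := by
      simpa using ((hasDerivAt_id p).sub_const p).const_mul (Real.pi : ℂ)
    simpa [Function.comp_def] using! (Complex.hasDerivAt_sin _).comp p h1
  have hs := (hasDerivAt_iff_tendsto_slope.1 hd).inv₀ hp |>.const_mul (Real.pi : ℂ)
  rw [mul_inv_cancel₀ hp] at hs
  refine hs.congr fun z => ?_
  simp only [slope, vsub_eq_sub, sub_self, mul_zero, Complex.sin_zero, sub_zero, smul_eq_mul,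
    mul_inv, inv_inv]
  rw [div_eq_mul_inv]; ring

lemma exists_exp_bound_sum_pi_div_sin (P : Finset ℂ) (r : ℂ → ℂ) {c : ℝ} (hc : c ≤ Real.pi) :
    ∃ C T : ℝ, ∀ z : ℂ, T ≤ |z.im| →
      ‖∑ p ∈ P, r p * (Real.pi / Complex.sin (Real.pi * (z - p)))‖ ≤ C * Real.exp (-c * |z.im|) := by
  refine ⟨∑ p ∈ P, ‖r p‖ * (4 * Real.pi * Real.exp (c * |p.im|)), 1 + ∑ p ∈ P, |p.im|,
    fun z hz => ?_⟩
  refine (norm_sum_le _ _).trans ?_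
  rw [Finset.sum_mul]
  refine Finset.sum_le_sum fun p hp => ?_
  rw [norm_mul, mul_assoc]
  gcongr
  have h1 : |p.im| ≤ ∑ p ∈ P, |p.im| :=
    Finset.single_le_sum (f := fun p : ℂ => |p.im|) (fun _ _ => abs_nonneg _) hp
  have h2 : |z.im| - |p.im| ≤ |(z - p).im| := by
    rw [Complex.sub_im]; exact abs_sub_abs_le_abs_sub _ _
  have h3 : 1 ≤ |(z - p).im| := by linarith
  refine (norm_pi_div_sin_le h3).trans ?_
  rw [mul_assoc (4 * Real.pi), ← Real.exp_add]
  gcongr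
  rcases le_total 0 c with hc0 | hc0
  · nlinarith
  · nlinarith [abs_nonneg (z.im), abs_nonneg p.im, abs_nonneg (z - p).im, Real.pi_pos,
      (by rw [Complex.sub_im]; exact abs_sub _ _ : |(z - p).im| ≤ |z.im| + |p.im|)]

/-- The residue theorem on a vertical strip of width at most `1`, for simple poles and
exponentially decaying functions. Each pole is removed by subtracting a multiple of
`π / sin (π (z - p))`, whose integrals over vertical lines are explicit. -/
lemma integral_vertical_sub_eq_sum_residues {g : ℂ → ℂ} (P : Finset ℂ) (r : ℂ → ℂ)
    {a b C c T : ℝ} (hab : a ≤ b) (hba : b ≤ a + 1) (hc : 0 < c) (hcπ : c ≤ Real.pi)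
    (hP : ∀ p ∈ P, a < p.re ∧ p.re < b)
    (hd : ∀ z : ℂ, a ≤ z.re → z.re ≤ b → z ∉ P → DifferentiableAt ℂ g z)
    (hr : ∀ p ∈ P, Tendsto (fun z => (z - p) * g z) (𝓝[≠] p) (𝓝 (r p)))
    (hb : ∀ z : ℂ, a ≤ z.re → z.re ≤ b → T ≤ |z.im| → ‖g z‖ ≤ C * Real.exp (-c * |z.im|)) :
    (∫ t : ℝ, g (b + t * Complex.I)) - ∫ t : ℝ, g (a + t * Complex.I)
      = 2 * Real.pi * ∑ p ∈ P, r p := by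
  classical
  set K : ℂ → ℂ := fun z => Real.pi / Complex.sin (Real.pi * z) with hK
  set h : ℂ → ℂ := fun z => g z - ∑ p ∈ P, r p * K (z - p) with hh
  set h' : ℂ → ℂ := fun z => if z ∈ P then limUnder (𝓝[≠] z) h else h z with hh'
  have hKd : ∀ p ∈ P, ∀ z : ℂ, a ≤ z.re → z.re ≤ b → z ≠ p →
      DifferentiableAt ℂ (fun z => K (z - p)) z := by
    intro p hp z h1 h2 h3
    have := hP p hp
    refine DifferentiableAt.comp (g := K) (f := fun z => z - p) z
      (differentiableAt_pi_div_sin (ne_intCast_of_abs_re_lt_one ?_ ?_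
        (sub_ne_zero.2 h3))) (by fun_prop)
    · simp; linarith
    · simp; linarith
  have hhd : ∀ z : ℂ, a ≤ z.re → z.re ≤ b → z ∉ P → DifferentiableAt ℂ h z := by
    intro z h1 h2 h3
    refine (hd z h1 h2 h3).sub (DifferentiableAt.fun_sum fun p hp => ?_)
    exact (hKd p hp z h1 h2 (fun e => h3 (e ▸ hp))).const_mul _
  have hev : ∀ z : ℂ, z ∉ P → ∀ᶠ w in 𝓝 z, w ∉ P := fun z hz =>
    P.finite_toSet.isClosed.isOpen_compl.mem_nhds hz
  have hevp : ∀ p ∈ P, ∀ᶠ w in 𝓝[≠] p, w ∉ P := by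
    intro p hp
    have h1 : ∀ᶠ w in 𝓝 p, w ∉ P.erase p :=
      (P.erase p).finite_toSet.isClosed.isOpen_compl.mem_nhds (by simp)
    rw [eventually_nhdsWithin_iff]
    filter_upwards [h1] with w hw hwp hwP
    exact hw (Finset.mem_erase.2 ⟨hwp, hwP⟩)
  have hcontP : ∀ p ∈ P, ContinuousAt h' p := by
    intro p hp
    have hs : ∀ᶠ z in 𝓝 p, a < z.re ∧ z.re < b :=
      ((isOpen_lt continuous_const Complex.continuous_re).inter
        (isOpen_lt Complex.continuous_re continuous_const)).mem_nhds (hP p hp)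
    have hd1 : ∀ᶠ z in 𝓝[≠] p, DifferentiableAt ℂ h z := by
      filter_upwards [hevp p hp, nhdsWithin_le_nhds hs] with z h1 h2
      exact hhd z h2.1.le h2.2.le h1
    have hlim : Tendsto (fun z => (z - p) * h z) (𝓝[≠] p) (𝓝 0) := by
      have e : ∀ z, (z - p) * h z = (z - p) * g z - (r p * ((z - p) * K (z - p))
          + (z - p) * ∑ q ∈ P.erase p, r q * K (z - q)) := by
        intro z
        simp only [hh]
        rw [← Finset.add_sum_erase P _ hp]; ring
      simp_rw [e]
      have t1 := (tendsto_mul_pi_div_sin p).const_mul (r p)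
      have t2 : ContinuousAt (fun z => (z - p) * ∑ q ∈ P.erase p, r q * K (z - q)) p := by
        refine (by fun_prop : ContinuousAt (fun z => z - p) p).mul ?_
        refine tendsto_finsetSum _ fun q hq => ?_
        have hq' := Finset.mem_erase.1 hq
        exact ((hKd q hq'.2 p (hP p hp).1.le (hP p hp).2.le (Ne.symm hq'.1)).continuousAt).const_mul _
      have t2' := t2.tendsto.mono_left (nhdsWithin_le_nhds (s := {p}ᶜ))
      simpa using (hr p hp).sub (t1.add t2')
    have ho : (fun z => h z - h p) =o[𝓝[≠] p] fun z => (z - p)⁻¹ := by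
      rw [isLittleO_iff_tendsto']
      · have t3 : Tendsto (fun z => (z - p) * h z - (z - p) * h p) (𝓝[≠] p) (𝓝 (0 - 0)) := by
          refine hlim.sub ?_
          have : ContinuousAt (fun z => (z - p) * h p) p := by fun_prop
          simpa using this.tendsto.mono_left (nhdsWithin_le_nhds (s := {p}ᶜ))
        rw [sub_zero] at t3
        refine t3.congr fun z => ?_
        rw [div_inv_eq_mul]; ring
      · filter_upwards [self_mem_nhdsWithin] with z hz h0
        exact absurd (inv_eq_zero.1 h0) (sub_ne_zero.2 hz)
    have := Complex.tendsto_limUnder_of_differentiable_on_punctured_nhds_of_isLittleO hd1 ho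
    rw [continuousAt_iff_punctured_nhds]
    have e1 : h' p = limUnder (𝓝[≠] p) h := by simp only [hh', if_pos hp]
    rw [e1]
    refine this.congr' ?_
    filter_upwards [hevp p hp] with z hz
    simp only [hh', if_neg hz]
  have hd' : ∀ z : ℂ, a ≤ z.re → z.re ≤ b → z ∉ P → DifferentiableAt ℂ h' z := by
    intro z h1 h2 h3
    refine (hhd z h1 h2 h3).congr_of_eventuallyEq ?_
    filter_upwards [hev z h3] with w hw
    simp only [hh', if_neg hw]
  have hcont : ContinuousOn h' {z | a ≤ z.re ∧ z.re ≤ b} := by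
    intro z hz
    by_cases hzP : z ∈ P
    · exact (hcontP z hzP).continuousWithinAt
    · exact (hd' z hz.1 hz.2 hzP).continuousAt.continuousWithinAt
  obtain ⟨C1, T1, hC1⟩ := exists_exp_bound_sum_pi_div_sin P r hcπ
  have hbound : ∀ z : ℂ, a ≤ z.re → z.re ≤ b →
      max (max T T1) (1 + ∑ p ∈ P, |p.im|) ≤ |z.im| →
      ‖h' z‖ ≤ (C + C1) * Real.exp (-c * |z.im|) := by
    intro z h1 h2 h3
    have hzP : z ∉ P := by
      intro hzP
      have : |z.im| ≤ ∑ p ∈ P, |p.im| :=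
        Finset.single_le_sum (f := fun p : ℂ => |p.im|) (fun _ _ => abs_nonneg _) hzP
      linarith [(le_max_right _ _).trans h3]
    simp only [hh', if_neg hzP, hh]
    refine (norm_sub_le _ _).trans ?_
    rw [add_mul]
    exact add_le_add (hb z h1 h2 (((le_max_left _ _).trans (le_max_left _ _)).trans h3))
      (hC1 z (((le_max_right _ _).trans (le_max_left _ _)).trans h3))
  have hshift := integral_vertical_eq hab hc hcont P.countable_toSet
    (fun z h1 h2 h3 => hd' z h1.le h2.le h3) hbound
  -- on the two boundary lines there are no poles, and `h' = h`
  have hline : ∀ σ : ℝ, a ≤ σ → σ ≤ b → (σ = a ∨ σ = b) →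
      ∫ t : ℝ, h' (σ + t * Complex.I) = (∫ t : ℝ, g (σ + t * Complex.I))
        - ∑ p ∈ P, r p * ∫ t : ℝ, K (σ + t * Complex.I - p) := by
    intro σ h1 h2 h3
    have hnot : ∀ t : ℝ, (σ + t * Complex.I : ℂ) ∉ P := by
      intro t ht
      have := hP _ ht
      simp at this
      rcases h3 with h3 | h3 <;> linarith
    have e : ∀ t : ℝ, h' (σ + t * Complex.I) = g (σ + t * Complex.I)
        - ∑ p ∈ P, r p * K (σ + t * Complex.I - p) := by
      intro t; simp only [hh', if_neg (hnot t), hh]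
    simp_rw [e]
    have hKi : ∀ p ∈ P, Integrable (fun t : ℝ => K (σ + t * Complex.I - p)) := by
      intro p hp
      refine integrable_of_exp_bound (C := 4 * Real.pi * Real.exp (Real.pi * |p.im|))
        (T := 1 + |p.im|) ?_ Real.pi_pos fun t ht => ?_
      · rw [continuous_iff_continuousAt]
        intro t
        have := (hKd p hp (σ + t * Complex.I) (by simpa using h1) (by simpa using h2)
          (fun e => hnot t (e ▸ hp))).continuousAt
        exact ContinuousAt.comp (f := fun t : ℝ => (σ + t * Complex.I : ℂ)) this (by fun_prop)
      · have i1 : (σ + t * Complex.I - p : ℂ).im = t - p.im := by simp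
        have h5 : |t| - |p.im| ≤ |t - p.im| := abs_sub_abs_le_abs_sub _ _
        have := norm_pi_div_sin_le (z := σ + t * Complex.I - p) (by rw [i1]; linarith)
        refine this.trans ?_
        rw [i1, mul_assoc (4 * Real.pi), ← Real.exp_add]
        gcongr
        nlinarith [Real.pi_pos]
    have hgi : Integrable (fun t : ℝ => g (σ + t * Complex.I)) := by
      refine integrable_of_exp_bound (C := C) (T := T) ?_ hc fun t ht => ?_
      · rw [continuous_iff_continuousAt]
        intro t
        have := (hd (σ + t * Complex.I) (by simpa using h1) (by simpa using h2)
          (hnot t)).continuousAt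
        exact ContinuousAt.comp (f := fun t : ℝ => (σ + t * Complex.I : ℂ)) this (by fun_prop)
      · simpa using hb (σ + t * Complex.I) (by simpa using h1) (by simpa using h2) (by simpa using ht)
    rw [integral_sub hgi (integrable_finsetSum _ fun p hp => (hKi p hp).const_mul _),
      integral_finsetSum _ fun p hp => (hKi p hp).const_mul _]
    congr 1
    exact Finset.sum_congr rfl fun p hp => integral_const_mul _ _
  have hKline : ∀ σ : ℝ, ∀ p : ℂ, ∫ t : ℝ, K (σ + t * Complex.I - p)
      = ∫ t : ℝ, K ((σ - p.re : ℝ) + t * Complex.I) := by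
    intro σ p
    rw [← integral_add_right_eq_self _ p.im]
    refine integral_congr_ae (Eventually.of_forall fun t => ?_)
    simp only
    congr 1
    apply Complex.ext <;> simp
  rw [hline a le_rfl hab (Or.inl rfl), hline b hab le_rfl (Or.inr rfl)] at hshift
  have eb : ∀ p ∈ P, ∫ t : ℝ, K (b + t * Complex.I - p) = Real.pi := by
    intro p hp
    have := hP p hp
    rw [hKline]
    exact integral_pi_div_sin_of_pos (by linarith) (by linarith)
  have ea : ∀ p ∈ P, ∫ t : ℝ, K (a + t * Complex.I - p) = -Real.pi := by
    intro p hp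
    have := hP p hp
    rw [hKline]
    exact integral_pi_div_sin_of_neg (by linarith) (by linarith)
  rw [Finset.sum_congr rfl fun p hp => by rw [ea p hp],
    Finset.sum_congr (s₁ := P) (s₂ := P) (f := fun p => r p * ∫ t : ℝ, K (b + t * Complex.I - p)) rfl
      fun p hp => by rw [eb p hp], ← Finset.sum_mul, ← Finset.sum_mul] at hshift
  linear_combination hshift.symm

/-! ### Products of Bessel functions as power series -/

lemma descPochhammer_smeval_eq_prod (a : ℂ) (n : ℕ) :
    (descPochhammer ℤ n).smeval a = ∏ j ∈ Finset.range n, (a - j) := by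
  rw [← Polynomial.aeval_eq_smeval, Polynomial.aeval_def, Polynomial.eval₂_eq_eval_map,
    descPochhammer_map, descPochhammer_eval_eq_prod_range]

lemma Gamma_add_natCast_add_one_eq_prod (a : ℂ) (ha : ∀ m : ℕ, a + m + 1 ≠ 0) (n : ℕ) :
    Complex.Gamma (a + n + 1)
      = (∏ j ∈ Finset.range n, (a + n - j)) * Complex.Gamma (a + 1) := by
  induction n with
  | zero => simp
  | succ n ih =>
    have e : a + ((n + 1 : ℕ) : ℂ) + 1 = (a + n + 1) + 1 := by push_cast; ring
    rw [e, Complex.Gamma_add_one _ (ha n), ih, Finset.prod_range_succ', ← mul_assoc]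
    congr 1
    rw [mul_comm]
    congr 1
    · refine Finset.prod_congr rfl fun j _ => ?_
      push_cast; ring
    · push_cast; ring

/-- The Chu–Vandermonde identity, written with Gamma functions. -/
lemma sum_antidiagonal_inv_Gamma {μ l : ℂ} (hμ : ∀ m : ℕ, μ + m + 1 ≠ 0)
    (hl : ∀ m : ℕ, l + m + 1 ≠ 0) (hμl : ∀ m : ℕ, μ + l + m + 1 ≠ 0) (k : ℕ) :
    ∑ p ∈ Finset.HasAntidiagonal.antidiagonal k, (p.1.factorial * Complex.Gamma (μ + p.1 + 1))⁻¹
        * (p.2.factorial * Complex.Gamma (l + p.2 + 1))⁻¹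
      = Complex.Gamma (μ + l + 2 * k + 1) / (k.factorial * Complex.Gamma (μ + k + 1)
        * Complex.Gamma (l + k + 1) * Complex.Gamma (μ + l + k + 1)) := by
  have key := Ring.add_choose_eq (r := l + k) (s := μ + k) k (Commute.all _ _)
  simp only [Ring.choose_eq_smul, descPochhammer_smeval_eq_prod, smul_eq_mul] at key
  have nz : ∀ a : ℂ, (∀ m : ℕ, a + m + 1 ≠ 0) → ∀ n : ℕ, Complex.Gamma (a + n + 1) ≠ 0 := by
    intro a ha n
    refine Complex.Gamma_ne_zero fun m h => ?_
    refine ha (n + m) ?_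
    push_cast
    linear_combination h
  have hsplit : ∀ a : ℂ, (∀ m : ℕ, a + m + 1 ≠ 0) → ∀ i j : ℕ, i + j = k →
      (∏ x ∈ Finset.range i, (a + k - x)) = Complex.Gamma (a + k + 1) / Complex.Gamma (a + j + 1) := by
    intro a ha i j hij
    have := Gamma_add_natCast_add_one_eq_prod (a + j) (fun m => by
      have := ha (j + m); push_cast at this; rwa [← add_assoc] at this) i
    have e : a + j + i = a + k := by rw [← hij]; push_cast; ring
    rw [e] at this
    rw [eq_div_iff (nz a ha j), this]
  have hL : (∏ x ∈ Finset.range k, (l + k + (μ + k) - x))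
      = Complex.Gamma (μ + l + 2 * k + 1) / Complex.Gamma (μ + l + k + 1) := by
    have := Gamma_add_natCast_add_one_eq_prod (μ + l + k) (fun m => by
      have := hμl (k + m); push_cast at this; rwa [← add_assoc] at this) k
    rw [eq_div_iff (nz _ hμl k), show μ + l + 2 * (k : ℂ) = μ + l + k + k by ring, this]
    congr 1
    exact Finset.prod_congr rfl fun x _ => by ring
  rw [hL] at key
  have hterm : ∀ p ∈ Finset.HasAntidiagonal.antidiagonal k,
      ((p.1.factorial : ℂ))⁻¹ * (∏ x ∈ Finset.range p.1, (l + k - x))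
        * (((p.2.factorial : ℂ))⁻¹ * ∏ x ∈ Finset.range p.2, (μ + k - x))
      = Complex.Gamma (μ + k + 1) * Complex.Gamma (l + k + 1)
        * ((p.1.factorial * Complex.Gamma (μ + p.1 + 1))⁻¹
        * (p.2.factorial * Complex.Gamma (l + p.2 + 1))⁻¹) := by
    intro p hp
    have hp' := Finset.HasAntidiagonal.mem_antidiagonal.1 hp
    rw [hsplit l hl p.1 p.2 hp', hsplit μ hμ p.2 p.1 (by omega)]
    rw [mul_inv, mul_inv]; ring
  rw [Finset.sum_congr rfl hterm, ← Finset.mul_sum] at key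
  have n1 := nz μ hμ k
  have n2 := nz l hl k
  rw [← mul_right_inj' (mul_ne_zero n1 n2), ← key]
  field_simp

/-- The entire function `∑ (-1)^k y^k / (k! Γ(ν+k+1))`, so that
`J_ν(z) = (z/2)^ν besselSeries ν ((z/2)²)`. -/
noncomputable def besselSeries (ν y : ℂ) : ℂ :=
  ∑' k : ℕ, (-1) ^ k * y ^ k / (k.factorial * Complex.Gamma (ν + k + 1))

lemma besselJ_eq (ν z : ℂ) : besselJ ν z = (z / 2) ^ ν * besselSeries ν ((z / 2) ^ 2) := by
  simp only [besselJ, besselSeries, pow_mul]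

lemma summable_norm_besselSeries (ν y : ℂ) :
    Summable fun k : ℕ => ‖(-1) ^ k * y ^ k / (k.factorial * Complex.Gamma (ν + k + 1))‖ := by
  set t : ℕ → ℂ := fun k => (-1) ^ k * y ^ k / (k.factorial * Complex.Gamma (ν + k + 1)) with ht
  have hrec : ∀ k : ℕ, (k + 1) * (ν + k + 1) * t (k + 1) = -y * t k := by
    intro k
    have h := Complex.one_div_Gamma_eq_self_mul_one_div_Gamma_add_one (ν + k + 1)
    have hk : ((k : ℂ) + 1) ≠ 0 := Nat.cast_add_one_ne_zero k
    simp only [ht, div_eq_mul_inv, mul_inv, h, Nat.factorial_succ, pow_succ]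
    push_cast
    rw [show ν + ((k : ℂ) + 1) + 1 = ν + k + 1 + 1 by ring]
    field_simp
  refine summable_of_ratio_norm_eventually_le (r := 1 / 2) (by norm_num) ?_
  obtain ⟨n0, hn0⟩ := exists_nat_gt (‖ν‖ + 2 * ‖y‖)
  filter_upwards [eventually_ge_atTop n0] with k hk
  have hk' : (n0 : ℝ) ≤ k := by exact_mod_cast hk
  have h1 : 1 ≤ ‖ν + k + 1‖ := by
    have : ‖((k : ℂ) + 1)‖ - ‖-ν‖ ≤ ‖(k : ℂ) + 1 - -ν‖ := norm_sub_norm_le _ _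
    have e : ‖((k : ℂ) + 1)‖ = (k : ℝ) + 1 := by
      rw [show ((k : ℂ) + 1) = (((k : ℝ) + 1 : ℝ) : ℂ) by push_cast; ring, Complex.norm_real,
        Real.norm_of_nonneg (by positivity)]
    rw [e, norm_neg, show (k : ℂ) + 1 - -ν = ν + k + 1 by ring] at this
    linarith [norm_nonneg y]
  have h2 : 2 * ‖y‖ ≤ k + 1 := by linarith [norm_nonneg ν]
  have h3 := congrArg norm (hrec k)
  rw [norm_mul, norm_mul, norm_mul, norm_neg] at h3
  have e : ‖((k : ℂ) + 1)‖ = (k : ℝ) + 1 := by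
    rw [show ((k : ℂ) + 1) = (((k : ℝ) + 1 : ℝ) : ℂ) by push_cast; ring, Complex.norm_real,
      Real.norm_of_nonneg (by positivity)]
  rw [e] at h3
  have hk0 : (0 : ℝ) < k + 1 := by positivity
  have h4 : ((k : ℝ) + 1) * ‖t (k + 1)‖ ≤ ‖y‖ * ‖t k‖ := by
    rw [← h3]
    have : ((k : ℝ) + 1) * 1 * ‖t (k + 1)‖ ≤ ((k : ℝ) + 1) * ‖ν + k + 1‖ * ‖t (k + 1)‖ := by gcongr
    linarith
  rw [norm_norm, norm_norm]
  refine le_of_mul_le_mul_left (h4.trans ?_) hk0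
  nlinarith [norm_nonneg (t k)]

/-- The coefficients of the power series of `J_μ J_l`. -/
noncomputable def besselProdCoeff (μ l : ℂ) (k : ℕ) : ℂ :=
  (-1) ^ k * Complex.Gamma (μ + l + 2 * k + 1) / (k.factorial * Complex.Gamma (μ + k + 1)
        * Complex.Gamma (l + k + 1) * Complex.Gamma (μ + l + k + 1))

lemma hasSum_besselSeries_mul {μ l : ℂ} (hμ : ∀ m : ℕ, μ + m + 1 ≠ 0)
    (hl : ∀ m : ℕ, l + m + 1 ≠ 0) (hμl : ∀ m : ℕ, μ + l + m + 1 ≠ 0) (y : ℂ) :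
    HasSum (fun k => besselProdCoeff μ l k * y ^ k) (besselSeries μ y * besselSeries l y) := by
  have s1 := summable_norm_besselSeries μ y
  have s2 := summable_norm_besselSeries l y
  have hs := (summable_norm_sum_mul_antidiagonal_of_summable_norm s1 s2).of_norm
  have ht := tsum_mul_tsum_eq_tsum_sum_antidiagonal_of_summable_norm s1 s2
  rw [besselSeries, besselSeries, ht]
  refine hs.hasSum.congr_fun fun k => ?_
  rw [besselProdCoeff, mul_div_assoc, ← sum_antidiagonal_inv_Gamma hμ hl hμl, Finset.mul_sum,
    Finset.sum_mul]
  refine Finset.sum_congr rfl fun p hp => ?_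
  rw [← Finset.HasAntidiagonal.mem_antidiagonal.1 hp, pow_add, pow_add]
  simp only [div_eq_mul_inv]
  ring

lemma besselJ_sqrt_mul_eq (ν l : ℂ) {x : ℝ} (hx : 0 < x) :
    besselJ ν (Real.sqrt x) * besselJ l (Real.sqrt x)
      = ((x / 4 : ℝ) : ℂ) ^ ((ν + l) / 2)
        * (besselSeries ν (x / 4 : ℝ) * besselSeries l (x / 4 : ℝ)) := by
  have hy : 0 < x / 4 := by positivity
  have hy0 : ((x / 4 : ℝ) : ℂ) ≠ 0 := by exact_mod_cast hy.ne'
  have hsq : ((Real.sqrt x : ℂ) / 2) ^ 2 = ((x / 4 : ℝ) : ℂ) := by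
    rw [div_pow, ← Complex.ofReal_pow, Real.sq_sqrt hx.le]; push_cast; ring
  have hs : 0 < Real.sqrt x / 2 := by positivity
  have hpow : ∀ ν : ℂ, ((Real.sqrt x : ℂ) / 2) ^ ν = ((x / 4 : ℝ) : ℂ) ^ (ν / 2) := by
    intro ν
    have e1 : ((Real.sqrt x : ℂ) / 2) = ((Real.sqrt x / 2 : ℝ) : ℂ) := by push_cast; rfl
    have e2 : ((x / 4 : ℝ) : ℂ) = ((Real.sqrt x / 2 : ℝ) : ℂ) * ((Real.sqrt x / 2 : ℝ) : ℂ) := by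
      rw [← hsq]; push_cast; ring
    rw [e2, Complex.mul_cpow_ofReal_nonneg hs.le hs.le, ← Complex.cpow_add _ _ (by
      exact_mod_cast hs.ne'), e1]
    congr 1; ring
  rw [besselJ_eq, besselJ_eq, hsq, hpow, hpow, add_div, Complex.cpow_add _ _ hy0]
  ring

/-- The power series of `J_μ(√x) J_l(√x)`. -/
lemma hasSum_besselJ_mul {μ l : ℂ} (hμ : ∀ m : ℕ, μ + m + 1 ≠ 0)
    (hl : ∀ m : ℕ, l + m + 1 ≠ 0) (hμl : ∀ m : ℕ, μ + l + m + 1 ≠ 0) {x : ℝ} (hx : 0 < x) :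
    HasSum (fun k : ℕ => besselProdCoeff μ l k * ((x / 4 : ℝ) : ℂ) ^ ((μ + l) / 2 + k))
      (besselJ μ (Real.sqrt x) * besselJ l (Real.sqrt x)) := by
  have hy0 : ((x / 4 : ℝ) : ℂ) ≠ 0 := by
    have : x / 4 ≠ 0 := by positivity
    exact_mod_cast this
  rw [besselJ_sqrt_mul_eq μ l hx]
  refine ((hasSum_besselSeries_mul hμ hl hμl ((x / 4 : ℝ) : ℂ)).mul_left
    (((x / 4 : ℝ) : ℂ) ^ ((μ + l) / 2))).congr_fun fun k => ?_
  rw [Complex.cpow_add _ _ hy0, Complex.cpow_natCast]; ring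

lemma conj_besselJ (ν : ℂ) {r : ℝ} (hr : 0 < r) :
    (starRingEnd ℂ) (besselJ ν r) = besselJ ((starRingEnd ℂ) ν) r := by
  have h2 : ((r : ℂ) / 2) = ((r / 2 : ℝ) : ℂ) := by push_cast; ring
  have harg : ((r : ℂ) / 2).arg ≠ Real.pi := by
    rw [h2, Complex.arg_ofReal_of_nonneg (by positivity)]
    exact Real.pi_ne_zero.symm
  rw [besselJ, besselJ, map_mul, Complex.cpow_conj _ _ harg, Complex.conj_tsum]
  have h3 : (starRingEnd ℂ) ((r : ℂ) / 2) = (r : ℂ) / 2 := by rw [h2, Complex.conj_ofReal]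
  rw [h3]
  congr 1
  refine tsum_congr fun k => ?_
  rw [map_div₀, map_mul, map_mul, ← Complex.Gamma_conj, map_pow, map_pow, h3]
  simp

/-- The kernel as a combination of products of Bessel functions of the first kind only. -/
lemma weberKernel_eq {α x τ : ℝ} (hx : 0 < x) (hτ : 0 < τ) :
    (weberKernel α x τ : ℂ) =
      Complex.cosh (Real.pi * τ) *
        (besselJ (α + τ * Complex.I) (Real.sqrt x) * besselJ (α - τ * Complex.I) (Real.sqrt x))
        / (Complex.sin (Real.pi * (α + τ * Complex.I)) * Complex.sin (Real.pi * (α - τ * Complex.I)))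
      - (besselJ (α + τ * Complex.I) (Real.sqrt x) * besselJ (-α + τ * Complex.I) (Real.sqrt x)
          / Complex.sin (Real.pi * (α - τ * Complex.I))
        - besselJ (α - τ * Complex.I) (Real.sqrt x) * besselJ (-α - τ * Complex.I) (Real.sqrt x)
          / Complex.sin (Real.pi * (α + τ * Complex.I)))
        / (2 * Complex.I * Complex.sinh (Real.pi * τ)) := by
  have hs : 0 < Real.sqrt x := Real.sqrt_pos.2 hx
  have hsin : Complex.sin (Real.pi * (α - τ * Complex.I)) ≠ 0 := by
    refine sin_pi_mul_ne_zero_of_forall_ne_intCast fun k h => ?_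
    have := congrArg Complex.im h
    simp at this
    exact hτ.ne' this
  have hsin' : Complex.sin (Real.pi * (α + τ * Complex.I)) ≠ 0 := by
    refine sin_pi_mul_ne_zero_of_forall_ne_intCast fun k h => ?_
    have := congrArg Complex.im h
    simp at this
    exact hτ.ne' this
  have cμ : (starRingEnd ℂ) (α + τ * Complex.I : ℂ) = α - τ * Complex.I := by
    simp [sub_eq_add_neg]
  have cμ' : (starRingEnd ℂ) (α - τ * Complex.I : ℂ) = α + τ * Complex.I := by
    simp
  have cB : (starRingEnd ℂ) (-α + τ * Complex.I : ℂ) = -α - τ * Complex.I := by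
    simp [sub_eq_add_neg]
  have csin : (starRingEnd ℂ) (Complex.sin (Real.pi * (α - τ * Complex.I)))
      = Complex.sin (Real.pi * (α + τ * Complex.I)) := by
    rw [← Complex.sin_conj, map_mul, cμ', Complex.conj_ofReal]
  have ccos : (starRingEnd ℂ) (Complex.cos (Real.pi * (α - τ * Complex.I)))
      = Complex.cos (Real.pi * (α + τ * Complex.I)) := by
    rw [← Complex.cos_conj, map_mul, cμ', Complex.conj_ofReal]
  have hsinh : Complex.sinh (Real.pi * τ) ≠ 0 := by
    have : 0 < Real.sinh (Real.pi * τ) := Real.sinh_pos_iff.2 (by positivity)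
    have h := this.ne'
    rw [← Complex.ofReal_mul, ← Complex.ofReal_sinh]
    exact_mod_cast h
  have trig : Complex.cos (Real.pi * (α - τ * Complex.I)) * Complex.sin (Real.pi * (α + τ * Complex.I))
      - Complex.cos (Real.pi * (α + τ * Complex.I)) * Complex.sin (Real.pi * (α - τ * Complex.I))
      = 2 * Complex.I * Complex.sinh (Real.pi * τ) * Complex.cosh (Real.pi * τ) := by
    have h1 : Complex.sin ((Real.pi * (α + τ * Complex.I)) - (Real.pi * (α - τ * Complex.I)))
      = 2 * Complex.I * Complex.sinh (Real.pi * τ) * Complex.cosh (Real.pi * τ) := by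
      rw [show ((Real.pi * (α + τ * Complex.I)) - (Real.pi * (α - τ * Complex.I)) : ℂ)
        = 2 * ((Real.pi * τ) * Complex.I) by ring, Complex.sin_two_mul, Complex.sin_mul_I,
        Complex.cos_mul_I]
      ring
    rw [← h1, Complex.sin_sub]; ring
  rw [weberKernel, Complex.ofReal_div, Complex.im_eq_sub_conj, map_mul, besselY, if_neg hsin,
    besselYQuot, map_div₀, map_sub, map_mul, csin, ccos, conj_besselJ _ hs, conj_besselJ _ hs,
    conj_besselJ _ hs, cμ, cμ', map_neg, cμ', neg_sub, Complex.ofReal_sinh, Complex.ofReal_mul]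
  rw [show (τ * Complex.I - α : ℂ) = -α + τ * Complex.I by ring,
    show (-(α + τ * Complex.I) : ℂ) = -α - τ * Complex.I by ring]
  set A := besselJ (α + τ * Complex.I) (Real.sqrt x)
  set A' := besselJ (α - τ * Complex.I) (Real.sqrt x)
  set B := besselJ (-α + τ * Complex.I) (Real.sqrt x)
  set B' := besselJ (-α - τ * Complex.I) (Real.sqrt x)
  set s := Complex.sin (Real.pi * (α + τ * Complex.I))
  set s' := Complex.sin (Real.pi * (α - τ * Complex.I))
  set c := Complex.cos (Real.pi * (α + τ * Complex.I))
  set c' := Complex.cos (Real.pi * (α - τ * Complex.I))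
  have hI := Complex.I_ne_zero
  field_simp
  linear_combination A * A' * trig

/-! ### The Mellin–Barnes integral of the kernel -/

/-- Together with `mbDen`, the integrand `mbNum / mbDen` of the Mellin–Barnes integral of the
kernel: by the reflection formula the poles of the Gamma factors become zeros of `mbDen`. -/
noncomputable def mbNum (α τ x : ℝ) (z : ℂ) : ℂ :=
  Real.pi ^ 3 * Complex.Gamma (1 - 2 * z) * ((x / 4 : ℝ) : ℂ) ^ (-z) *
    (Complex.Gamma (1 - z - τ * Complex.I))⁻¹ * (Complex.Gamma (1 - z + τ * Complex.I))⁻¹ *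
    (Complex.Gamma (1 - z - α))⁻¹ * (Complex.Gamma (1 - z + α))⁻¹

/-- The product of sines in the denominator of the Mellin–Barnes integrand. -/
noncomputable def mbDen (α τ : ℝ) (z : ℂ) : ℂ :=
  Complex.sin (Real.pi * (z + τ * Complex.I)) * Complex.sin (Real.pi * (z - τ * Complex.I)) *
    Complex.sin (Real.pi * (z + α))

lemma differentiableAt_mbNum {α τ x : ℝ} (hx : 0 < x) {z : ℂ} (hz : z.re < 1 / 2) :
    DifferentiableAt ℂ (mbNum α τ x) z := by
  have hy : ((x / 4 : ℝ) : ℂ) ≠ 0 := by exact_mod_cast (by positivity : x / 4 ≠ 0)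
  have hinv : ∀ f : ℂ → ℂ, DifferentiableAt ℂ f z →
      DifferentiableAt ℂ (fun z => (Complex.Gamma (f z))⁻¹) z := fun f hf =>
    DifferentiableAt.comp (g := fun s => (Complex.Gamma s)⁻¹) z
      (Complex.differentiable_one_div_Gamma _) hf
  have hG : DifferentiableAt ℂ (fun z => Complex.Gamma (1 - 2 * z)) z := by
    refine DifferentiableAt.comp (g := Complex.Gamma) z
      (Complex.differentiableAt_Gamma _ fun m h => ?_) (by fun_prop)
    have := congrArg Complex.re h
    simp at this
    linarith [(Nat.cast_nonneg m : (0 : ℝ) ≤ m)]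
  have hp : DifferentiableAt ℂ (fun z => ((x / 4 : ℝ) : ℂ) ^ (-z)) z :=
    (by fun_prop : DifferentiableAt ℂ (fun z : ℂ => -z) z).const_cpow (Or.inl hy)
  unfold mbNum
  exact ((((((differentiableAt_const _).mul hG).mul hp).mul (hinv _ (by fun_prop))).mul
    (hinv _ (by fun_prop))).mul (hinv _ (by fun_prop))).mul (hinv _ (by fun_prop))

lemma exists_rpow_bound {y : ℝ} (hy : 0 < y) (a b : ℝ) :
    ∃ C : ℝ, 0 ≤ C ∧ ∀ z : ℂ, a ≤ z.re → z.re ≤ b → ‖(y : ℂ) ^ (-z)‖ ≤ C := by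
  refine ⟨y ^ (-a) + y ^ (-b), by positivity, fun z h1 h2 => ?_⟩
  rw [Complex.norm_cpow_eq_rpow_re_of_pos hy, Complex.neg_re]
  rcases le_total 1 y with h | h
  · have := Real.rpow_le_rpow_of_exponent_le h (neg_le_neg h1)
    have := Real.rpow_nonneg hy.le (-b)
    linarith
  · have := Real.rpow_le_rpow_of_exponent_ge hy h (neg_le_neg h2)
    have := Real.rpow_nonneg hy.le (-a)
    linarith

lemma exists_norm_mbNum_le {x : ℝ} (α τ : ℝ) (hx : 0 < x) {a b : ℝ} (hb : b < 1 / 2) :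
    ∃ C : ℝ, 0 ≤ C ∧ ∀ z : ℂ, a ≤ z.re → z.re ≤ b →
      ‖mbNum α τ x z‖ ≤ C * Real.exp (2 * Real.pi * |z.im|) := by
  obtain ⟨C1, h1, b1⟩ := exists_norm_Gamma_le_of_pos (A := 1 - 2 * b) (B := 1 - 2 * a) (by linarith)
  obtain ⟨C2, h2, b2⟩ := exists_rpow_bound (y := x / 4) (by positivity) a b
  obtain ⟨C3, h3, b3⟩ := exists_norm_inv_Gamma_le (1 - b) (1 - a)
  obtain ⟨C4, h4, b4⟩ := exists_norm_inv_Gamma_le (1 - b - α) (1 - a - α)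
  obtain ⟨C5, h5, b5⟩ := exists_norm_inv_Gamma_le (1 - b + α) (1 - a + α)
  set q := Real.pi - gammaRate with hq
  have hq0 : 0 ≤ q := by rw [hq, gammaRate]; linarith [Real.pi_pos]
  refine ⟨Real.pi ^ 3 * C1 * C2 * (C3 * Real.exp (q * |τ|)) * (C3 * Real.exp (q * |τ|)) * C4 * C5,
    by positivity, fun z ha hb => ?_⟩
  have hr1 : ‖Complex.Gamma (1 - 2 * z)‖ ≤ C1 * Real.exp (-gammaRate * (2 * |z.im|)) := by
    have := b1 (1 - 2 * z) (by simp; linarith) (by simp; linarith)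
    simpa [abs_mul] using this
  have hexp : ∀ v : ℝ, |v| ≤ |z.im| + |τ| →
      Real.exp (q * |v|) ≤ Real.exp (q * |τ|) * Real.exp (q * |z.im|) := by
    intro v hv
    rw [← Real.exp_add, ← mul_add]
    gcongr
    linarith
  have hr3 : ‖(Complex.Gamma (1 - z - τ * Complex.I))⁻¹‖
      ≤ (C3 * Real.exp (q * |τ|)) * Real.exp (q * |z.im|) := by
    have := b3 (1 - z - τ * Complex.I) (by simp; linarith) (by simp; linarith)
    refine this.trans ?_
    rw [mul_assoc]
    gcongr
    refine hexp _ ?_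
    have : (1 - z - τ * Complex.I).im = -(z.im + τ) := by simp; ring
    rw [this, abs_neg]; exact abs_add_le _ _
  have hr3' : ‖(Complex.Gamma (1 - z + τ * Complex.I))⁻¹‖
      ≤ (C3 * Real.exp (q * |τ|)) * Real.exp (q * |z.im|) := by
    have := b3 (1 - z + τ * Complex.I) (by simp; linarith) (by simp; linarith)
    refine this.trans ?_
    rw [mul_assoc]
    gcongr
    refine hexp _ ?_
    have : (1 - z + τ * Complex.I).im = -(z.im - τ) := by simp; ring
    rw [this, abs_neg]; exact abs_sub _ _
  have hr4 : ‖(Complex.Gamma (1 - z - α))⁻¹‖ ≤ C4 * Real.exp (q * |z.im|) := by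
    have := b4 (1 - z - α) (by simp; linarith) (by simp; linarith)
    simpa using this
  have hr5 : ‖(Complex.Gamma (1 - z + α))⁻¹‖ ≤ C5 * Real.exp (q * |z.im|) := by
    have := b5 (1 - z + α) (by simp; linarith) (by simp; linarith)
    simpa using this
  have hr2 := b2 z ha hb
  have hpi : ‖(Real.pi : ℂ) ^ 3‖ = Real.pi ^ 3 := by
    rw [norm_pow, Complex.norm_real, Real.norm_of_nonneg Real.pi_pos.le]
  simp only [mbNum, norm_mul, hpi]
  calc _ ≤ Real.pi ^ 3 * (C1 * Real.exp (-gammaRate * (2 * |z.im|))) * C2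
        * ((C3 * Real.exp (q * |τ|)) * Real.exp (q * |z.im|))
        * ((C3 * Real.exp (q * |τ|)) * Real.exp (q * |z.im|))
        * (C4 * Real.exp (q * |z.im|)) * (C5 * Real.exp (q * |z.im|)) := by gcongr
    _ = (Real.pi ^ 3 * C1 * C2 * (C3 * Real.exp (q * |τ|)) * (C3 * Real.exp (q * |τ|)) * C4 * C5)
        * Real.exp (-gammaRate * (2 * |z.im|) + q * |z.im| + q * |z.im| + q * |z.im| + q * |z.im|) := by
        simp only [Real.exp_add]; ring
    _ ≤ _ := by
        gcongr
        rw [hq, gammaRate]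
        nlinarith [Real.pi_pos, abs_nonneg z.im, mul_nonneg Real.pi_pos.le (abs_nonneg z.im)]

lemma exists_le_norm_mbDen (α τ : ℝ) :
    ∃ c : ℝ, 0 < c ∧ ∀ z : ℂ, 1 + |τ| ≤ |z.im| →
      c * Real.exp (3 * Real.pi * |z.im|) ≤ ‖mbDen α τ z‖ := by
  refine ⟨(Real.exp (-Real.pi * |τ|) / 4) * (Real.exp (-Real.pi * |τ|) / 4) * (1 / 4), by positivity,
    fun z hz => ?_⟩
  have key : ∀ w : ℂ, |z.im| - |τ| ≤ |w.im| →
      Real.exp (-Real.pi * |τ|) / 4 * Real.exp (Real.pi * |z.im|)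
        ≤ ‖Complex.sin (Real.pi * w)‖ := by
    intro w hw
    have e : |((Real.pi : ℂ) * w).im| = Real.pi * |w.im| := by
      simp [abs_mul, abs_of_pos Real.pi_pos]
    have h1 : 1 ≤ |((Real.pi : ℂ) * w).im| := by
      rw [e]; nlinarith [Real.pi_gt_three]
    refine le_trans ?_ (exp_div_four_le_norm_sin h1)
    rw [e, div_mul_eq_mul_div, ← Real.exp_add]
    gcongr
    nlinarith [Real.pi_pos]
  have k1 := key (z + τ * Complex.I) (by
    have : (z + τ * Complex.I).im = z.im - -τ := by simp
    rw [this, ← abs_neg τ]; exact abs_sub_abs_le_abs_sub _ _)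
  have k2 := key (z - τ * Complex.I) (by
    have : (z - τ * Complex.I).im = z.im - τ := by simp
    rw [this]; exact abs_sub_abs_le_abs_sub _ _)
  have k3 : 1 / 4 * Real.exp (Real.pi * |z.im|) ≤ ‖Complex.sin (Real.pi * (z + α))‖ := by
    have e : |((Real.pi : ℂ) * (z + α)).im| = Real.pi * |z.im| := by
      simp [abs_mul, abs_of_pos Real.pi_pos]
    have h1 : 1 ≤ |((Real.pi : ℂ) * (z + α)).im| := by
      rw [e]; nlinarith [Real.pi_gt_three, abs_nonneg τ]
    have := exp_div_four_le_norm_sin h1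
    rw [e] at this
    linarith
  simp only [mbDen, norm_mul]
  calc _ = (Real.exp (-Real.pi * |τ|) / 4 * Real.exp (Real.pi * |z.im|))
        * (Real.exp (-Real.pi * |τ|) / 4 * Real.exp (Real.pi * |z.im|))
        * (1 / 4 * Real.exp (Real.pi * |z.im|)) := by
        rw [show 3 * Real.pi * |z.im| = Real.pi * |z.im| + Real.pi * |z.im| + Real.pi * |z.im| by ring,
          Real.exp_add, Real.exp_add]; ring
    _ ≤ _ := by gcongr

lemma mbDen_ne_zero {α τ σ : ℝ} (h0 : 0 < σ) (h1 : σ < 1) (hσ : ∀ k : ℤ, σ + α ≠ k) {z : ℂ}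
    (hz : z.re = σ) : mbDen α τ z ≠ 0 := by
  have hk : ∀ k : ℤ, σ ≠ k := by
    rintro k rfl
    have a : 0 < k := by exact_mod_cast h0
    have b : k < 1 := by exact_mod_cast h1
    omega
  refine mul_ne_zero (mul_ne_zero ?_ ?_) ?_ <;>
    refine sin_pi_mul_ne_zero_of_forall_ne_intCast fun k h => ?_ <;>
    have := congrArg Complex.re h
  · simp [hz] at this; exact hk k this
  · simp [hz] at this; exact hk k this
  · simp [hz] at this; exact hσ k this

lemma mbDen_sub_natCast (α τ : ℝ) (z : ℂ) (n : ℕ) :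
    mbDen α τ (z - n) = (-1) ^ n * mbDen α τ z := by
  have e : ∀ w : ℂ, Complex.sin (Real.pi * (w - n)) = (-1) ^ n * Complex.sin (Real.pi * w) := by
    intro w
    rw [show (Real.pi * (w - n) : ℂ) = Real.pi * w - n * Real.pi by ring, Complex.sin_antiperiodic.sub_nat_mul_eq]
  simp only [mbDen]
  rw [show z - n + τ * Complex.I = (z + τ * Complex.I) - n by ring,
    show z - n - τ * Complex.I = (z - τ * Complex.I) - n by ring,
    show z - n + α = (z + α) - n by ring, e, e, e]
  have : ((-1 : ℂ) ^ n) * (-1) ^ n = 1 := by rw [← mul_pow]; simp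
  linear_combination (Complex.sin (Real.pi * (z + τ * Complex.I)) * Complex.sin (Real.pi * (z - τ * Complex.I)) *
    Complex.sin (Real.pi * (z + α)) * (-1) ^ n) * this

/-- Residue theorem for `E / mbDen` on the strip `σ - 1 < re z < σ`; the three poles are `± iτ` and
`-α + d` with `d = ⌊σ + α⌋`. -/
lemma integral_div_mbDen_sub {E : ℂ → ℂ} {α τ σ C : ℝ} {d : ℕ} (hτ : 0 < τ) (h0 : 0 < σ) (h1 : σ < 1)
    (hd1 : (d : ℝ) < σ + α) (hd2 : σ + α < d + 1)
    (hE : ∀ z : ℂ, σ - 1 ≤ z.re → z.re ≤ σ → DifferentiableAt ℂ E z) (hC : 0 ≤ C)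
    (hb : ∀ z : ℂ, σ - 1 ≤ z.re → z.re ≤ σ → ‖E z‖ ≤ C * Real.exp (2 * Real.pi * |z.im|)) :
    (∫ t : ℝ, E (σ + t * Complex.I) / mbDen α τ (σ + t * Complex.I))
      - ∫ t : ℝ, E ((σ - 1 : ℝ) + t * Complex.I) / mbDen α τ ((σ - 1 : ℝ) + t * Complex.I)
    = 2 * (E (τ * Complex.I) / (Complex.sin (Real.pi * (2 * τ * Complex.I))
          * Complex.sin (Real.pi * (α + τ * Complex.I)))
        - E (-τ * Complex.I) / (Complex.sin (Real.pi * (2 * τ * Complex.I))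
          * Complex.sin (Real.pi * (α - τ * Complex.I)))
        + (-1) ^ d * E (-α + d) / (Complex.sin (Real.pi * (α + τ * Complex.I))
          * Complex.sin (Real.pi * (α - τ * Complex.I)))) := by
  classical
  have hπ : (Real.pi : ℂ) ≠ 0 := by exact_mod_cast Real.pi_ne_zero
  set p1 : ℂ := τ * Complex.I with hp1
  set p2 : ℂ := -τ * Complex.I with hp2
  set p3 : ℂ := -α + d with hp3
  have p1re : p1.re = 0 := by simp [hp1]
  have p1im : p1.im = τ := by simp [hp1]
  have p2re : p2.re = 0 := by simp [hp2]
  have p2im : p2.im = -τ := by simp [hp2]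
  have p3re : p3.re = -α + d := by simp [hp3]
  have p3im : p3.im = 0 := by simp [hp3]
  have n12 : p1 ≠ p2 := fun h => by have := congrArg Complex.im h; rw [p1im, p2im] at this; linarith
  have n13 : p1 ≠ p3 := fun h => by have := congrArg Complex.im h; rw [p1im, p3im] at this; linarith
  have n23 : p2 ≠ p3 := fun h => by have := congrArg Complex.im h; rw [p2im, p3im] at this; linarith
  set s1 := Complex.sin (Real.pi * (2 * τ * Complex.I)) with hs1
  set sp := Complex.sin (Real.pi * (α + τ * Complex.I)) with hsp
  set sm := Complex.sin (Real.pi * (α - τ * Complex.I)) with hsm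
  have im_ne : ∀ w : ℂ, w.im ≠ 0 → Complex.sin (Real.pi * w) ≠ 0 := fun w hw =>
    sin_pi_mul_ne_zero_of_forall_ne_intCast fun k h => hw (by rw [h]; simp)
  have s1n : s1 ≠ 0 := im_ne _ (by simp [hτ.ne'])
  have spn : sp ≠ 0 := im_ne _ (by simp [hτ.ne'])
  have smn : sm ≠ 0 := im_ne _ (by simp [hτ.ne'])
  set r : ℂ → ℂ := fun p => if p = p1 then E p1 / (Real.pi * (s1 * sp)) else
    if p = p2 then -(E p2 / (Real.pi * (s1 * sm))) else (-1) ^ d * E p3 / (Real.pi * (sp * sm)) with hr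
  obtain ⟨c, hc, hden⟩ := exists_le_norm_mbDen α τ
  have inv_sin : ∀ p q : ℂ, ∀ n : ℕ, p + q = n →
      Tendsto (fun z : ℂ => (z - p) / Complex.sin (Real.pi * (z + q))) (𝓝[≠] p)
        (𝓝 ((-1) ^ n / Real.pi)) := by
    intro p q n hpq
    have h := (tendsto_mul_pi_div_sin p).const_mul ((-1) ^ n / (Real.pi : ℂ))
    rw [mul_one] at h
    refine h.congr fun z => ?_
    have e : (Real.pi * (z + q) : ℂ) = Real.pi * (z - p) + n * Real.pi := by
      rw [← hpq]; ring
    rw [e, Complex.sin_antiperiodic.add_nat_mul_eq]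
    have hsq : ((-1 : ℂ) ^ n)⁻¹ = (-1) ^ n := by rw [← inv_pow]; norm_num
    rw [div_eq_mul_inv _ ((-1) ^ n * _), mul_inv, hsq]
    field_simp
  have key := integral_vertical_sub_eq_sum_residues (g := fun z => E z / mbDen α τ z) {p1, p2, p3} r
    (a := σ - 1) (b := σ) (C := C / c) (c := Real.pi) (T := 1 + |τ|) (by linarith) (by linarith)
    Real.pi_pos le_rfl ?_ ?_ ?_ ?_
  · rw [key, Finset.sum_insert (by simp [n12, n13]), Finset.sum_insert (by simp [n23]),
      Finset.sum_singleton]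
    have r1 : r p1 = E p1 / (Real.pi * (s1 * sp)) := by simp [hr]
    have r2 : r p2 = -(E p2 / (Real.pi * (s1 * sm))) := by simp [hr, n12.symm]
    have r3 : r p3 = (-1) ^ d * E p3 / (Real.pi * (sp * sm)) := by simp [hr, n13.symm, n23.symm]
    rw [r1, r2, r3]
    field_simp
    ring
  · intro p hp
    simp only [Finset.mem_insert, Finset.mem_singleton] at hp
    rcases hp with rfl | rfl | rfl
    · rw [p1re]; constructor <;> linarith
    · rw [p2re]; constructor <;> linarith
    · rw [p3re]; constructor <;> linarith
  · intro z ha hb hz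
    simp only [Finset.mem_insert, Finset.mem_singleton, not_or] at hz
    refine (hE z ha hb).div (by unfold mbDen; fun_prop) ?_
    refine mul_ne_zero (mul_ne_zero ?_ ?_) ?_
    · refine sin_pi_mul_ne_zero_of_forall_ne_intCast fun k h => ?_
      have h' : z = k - τ * Complex.I := by rw [← h]; ring
      have hre : z.re = k := by rw [h']; simp
      rw [hre] at ha hb
      have k1 : (-1 : ℝ) < k := by linarith
      have k2 : (k : ℝ) < 1 := by linarith
      have k1' : -1 < k := by exact_mod_cast k1
      have k2' : k < 1 := by exact_mod_cast k2
      have k0 : k = 0 := by omega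
      exact hz.2.1 (by rw [h', k0, hp2]; push_cast; ring)
    · refine sin_pi_mul_ne_zero_of_forall_ne_intCast fun k h => ?_
      have h' : z = k + τ * Complex.I := by rw [← h]; ring
      have hre : z.re = k := by rw [h']; simp
      rw [hre] at ha hb
      have k1 : (-1 : ℝ) < k := by linarith
      have k2 : (k : ℝ) < 1 := by linarith
      have k1' : -1 < k := by exact_mod_cast k1
      have k2' : k < 1 := by exact_mod_cast k2
      have k0 : k = 0 := by omega
      exact hz.1 (by rw [h', k0, hp1]; push_cast; ring)
    · refine sin_pi_mul_ne_zero_of_forall_ne_intCast fun k h => ?_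
      have h' : z = k - α := by rw [← h]; ring
      have hre : z.re = k - α := by rw [h']; simp
      rw [hre] at ha hb
      have k1 : (d : ℝ) - 1 < k := by linarith
      have k2 : (k : ℝ) < d + 1 := by linarith
      have k1' : (d : ℤ) - 1 < k := by exact_mod_cast k1
      have k2' : k < (d : ℤ) + 1 := by exact_mod_cast k2
      have k0 : k = d := by omega
      exact hz.2.2 (by rw [h', k0, hp3]; push_cast; ring)
  · intro p hp
    simp only [Finset.mem_insert, Finset.mem_singleton] at hp
    have cE : ∀ p : ℂ, σ - 1 ≤ p.re → p.re ≤ σ → Tendsto E (𝓝[≠] p) (𝓝 (E p)) := fun p ha hb =>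
      (hE p ha hb).continuousAt.tendsto.mono_left nhdsWithin_le_nhds
    have cS : ∀ p q : ℂ, Tendsto (fun z : ℂ => Complex.sin (Real.pi * (z + q))) (𝓝[≠] p)
        (𝓝 (Complex.sin (Real.pi * (p + q)))) := fun p q =>
      ((by fun_prop : ContinuousAt (fun z : ℂ => Complex.sin (Real.pi * (z + q))) p).tendsto).mono_left
        nhdsWithin_le_nhds
    rcases hp with rfl | rfl | rfl
    · have r1 : r p1 = E p1 / (Real.pi * (s1 * sp)) := by simp [hr]
      have t := (((cE p1 (by rw [p1re]; linarith) (by rw [p1re]; linarith)).mul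
        (inv_sin p1 (-τ * Complex.I) 0 (by simp [hp1]))).div (cS p1 (τ * Complex.I)) (by
          refine im_ne _ ?_; simp [p1im]; linarith)).div (cS p1 α) (by
          refine im_ne _ ?_; simp [p1im]; linarith)
      rw [r1]
      convert t using 2
      · simp only [mbDen, Pi.div_apply]
        rw [show ∀ z : ℂ, z - τ * Complex.I = z + -τ * Complex.I by intro z; ring]
        simp only [div_eq_mul_inv, mul_inv]; ring
      · rw [hs1, hsp, show p1 + τ * Complex.I = 2 * τ * Complex.I by rw [hp1]; ring,
          show p1 + (α : ℂ) = α + τ * Complex.I by rw [hp1]; ring]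
        field_simp
    · have r2 : r p2 = -(E p2 / (Real.pi * (s1 * sm))) := by simp [hr, n12.symm]
      have t := (((cE p2 (by rw [p2re]; linarith) (by rw [p2re]; linarith)).mul
        (inv_sin p2 (τ * Complex.I) 0 (by simp [hp2]))).div (cS p2 (-τ * Complex.I)) (by
          refine im_ne _ ?_; simp [p2im]; linarith)).div (cS p2 α) (by
          refine im_ne _ ?_; simp [p2im]; linarith)
      rw [r2]
      convert t using 2
      · simp only [mbDen, Pi.div_apply]
        rw [show ∀ z : ℂ, z - τ * Complex.I = z + -τ * Complex.I by intro z; ring]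
        simp only [div_eq_mul_inv, mul_inv]; ring
      · rw [show (Real.pi * (p2 + -τ * Complex.I) : ℂ) = -(Real.pi * (2 * τ * Complex.I)) by
            rw [hp2]; ring, Complex.sin_neg, ← hs1, hsm,
          show p2 + (α : ℂ) = α - τ * Complex.I by rw [hp2]; ring]
        field_simp
    · have r3 : r p3 = (-1) ^ d * E p3 / (Real.pi * (sp * sm)) := by simp [hr, n13.symm, n23.symm]
      have t := (((cE p3 (by rw [p3re]; linarith) (by rw [p3re]; linarith)).mul
        (inv_sin p3 α d (by rw [hp3]; ring))).div (cS p3 (τ * Complex.I)) (by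
          refine im_ne _ ?_; simp [p3im]; linarith)).div (cS p3 (-τ * Complex.I)) (by
          refine im_ne _ ?_; simp [p3im]; linarith)
      rw [r3]
      convert t using 2
      · simp only [mbDen, Pi.div_apply]
        rw [show ∀ z : ℂ, z - τ * Complex.I = z + -τ * Complex.I by intro z; ring]
        simp only [div_eq_mul_inv, mul_inv]; ring
      · rw [show (Real.pi * (p3 + τ * Complex.I) : ℂ)
            = -(Real.pi * (α - τ * Complex.I)) + d * Real.pi by rw [hp3]; ring,
          show (Real.pi * (p3 + -τ * Complex.I) : ℂ)
            = -(Real.pi * (α + τ * Complex.I)) + d * Real.pi by rw [hp3]; ring,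
          Complex.sin_antiperiodic.add_nat_mul_eq, Complex.sin_antiperiodic.add_nat_mul_eq,
          Complex.sin_neg, Complex.sin_neg, ← hsp, ← hsm]
        have hsq : ((-1 : ℂ) ^ d) * (-1) ^ d = 1 := by rw [← mul_pow]; simp
        have hn : ((-1 : ℂ) ^ d) ≠ 0 := pow_ne_zero _ (by norm_num)
        field_simp
        linear_combination E p3 * hsq
  · intro z ha hb' hz
    have h3 := hden z hz
    rw [norm_div, div_le_iff₀ (lt_of_lt_of_le (by positivity) h3)]
    calc ‖E z‖ ≤ C * Real.exp (2 * Real.pi * |z.im|) := hb z ha hb'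
      _ = C / c * Real.exp (-Real.pi * |z.im|) * (c * Real.exp (3 * Real.pi * |z.im|)) := by
          rw [show 2 * Real.pi * |z.im| = -Real.pi * |z.im| + 3 * Real.pi * |z.im| by ring,
            Real.exp_add]
          field_simp
      _ ≤ _ := by gcongr

lemma mbNum_neg (α τ x : ℝ) (z : ℂ) : mbNum α (-τ) x z = mbNum α τ x z := by
  simp only [mbNum, Complex.ofReal_neg, neg_mul, sub_neg_eq_add, ← sub_eq_add_neg]
  ring

lemma mbNum_sub_one {α τ x : ℝ} (hx : 0 < x) (z : ℂ)
    (h1 : 1 - 2 * z ≠ 0) (h2 : 2 - 2 * z ≠ 0) :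
    (1 - z - τ * Complex.I) * (1 - z + τ * Complex.I) * (1 - z - α) * (1 - z + α)
        * mbNum α τ x (z - 1)
      = (x / 4) * (1 - 2 * z) * (2 - 2 * z) * mbNum α τ x z := by
  have hy : ((x / 4 : ℝ) : ℂ) ≠ 0 := by exact_mod_cast (by positivity : x / 4 ≠ 0)
  have hg : Complex.Gamma (1 - 2 * (z - 1)) = (2 - 2 * z) * ((1 - 2 * z) * Complex.Gamma (1 - 2 * z)) := by
    rw [← Complex.Gamma_add_one _ h1, show (1 - 2 * z + 1 : ℂ) = 2 - 2 * z by ring,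
      ← Complex.Gamma_add_one _ h2]
    congr 1; ring
  have hi : ∀ w : ℂ, (Complex.Gamma (1 - z + w))⁻¹
      = (1 - z + w) * (Complex.Gamma (1 - (z - 1) + w))⁻¹ := by
    intro w
    rw [Complex.one_div_Gamma_eq_self_mul_one_div_Gamma_add_one]
    congr 3; ring
  have hp : ((x / 4 : ℝ) : ℂ) ^ (-(z - 1)) = ((x / 4 : ℝ) : ℂ) * ((x / 4 : ℝ) : ℂ) ^ (-z) := by
    rw [show -(z - 1) = 1 + -z by ring, Complex.cpow_add _ _ hy, Complex.cpow_one]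
  simp only [mbNum, hg, hp, sub_eq_add_neg (1 - z), sub_eq_add_neg (1 - (z - 1))]
  rw [hi (-(τ * Complex.I)), hi (τ * Complex.I), hi (-α), hi α]
  push_cast
  ring

/-- Far to the left the Mellin–Barnes integrand decays geometrically. -/
lemma norm_mbNum_sub_one_le {α τ x : ℝ} (hx : 0 < x) {z : ℂ} (hz : z.re < 1 / 2)
    (h1 : 1 ≤ (1 - z).re) (h2 : 2 * |τ| ≤ (1 - z).re) (h3 : 2 * |α| ≤ (1 - z).re)
    (h4 : 48 * x ≤ (1 - z).re) : ‖mbNum α τ x (z - 1)‖ ≤ 1 / 2 * ‖mbNum α τ x z‖ := by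
  have hrec := mbNum_sub_one (α := α) (τ := τ) hx z
    (fun h => by have := congrArg Complex.re h; simp at this; linarith)
    (fun h => by have := congrArg Complex.re h; simp at this; linarith)
  set w := 1 - z with hw
  have hwn : w.re ≤ ‖w‖ := Complex.re_le_norm w
  have hlow : ∀ q : ℂ, 2 * ‖q‖ ≤ w.re → ‖w‖ / 2 ≤ ‖w + q‖ := by
    intro q hq
    have : ‖w‖ - ‖-q‖ ≤ ‖w - -q‖ := norm_sub_norm_le _ _
    rw [norm_neg, sub_neg_eq_add] at this
    linarith
  have nτ : ‖(τ * Complex.I : ℂ)‖ = |τ| := by simp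
  have nα : ‖(α : ℂ)‖ = |α| := by simp
  have l1 := hlow (τ * Complex.I) (by rw [nτ]; exact h2)
  have l2 := hlow (-(τ * Complex.I)) (by rw [norm_neg, nτ]; exact h2)
  have l3 := hlow α (by rw [nα]; exact h3)
  have l4 := hlow (-α) (by rw [norm_neg, nα]; exact h3)
  have u1 : ‖1 - 2 * z‖ ≤ 3 * ‖w‖ := by
    rw [show 1 - 2 * z = 2 * w - 1 by rw [hw]; ring]
    refine (norm_sub_le _ _).trans ?_
    rw [norm_mul]
    simp
    linarith
  have u2 : ‖2 - 2 * z‖ = 2 * ‖w‖ := by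
    rw [show 2 - 2 * z = 2 * w by rw [hw]; ring, norm_mul]; simp
  have hn := congrArg norm hrec
  simp only [norm_mul, sub_eq_add_neg w] at hn
  have hx4 : ‖(x / 4 : ℂ)‖ = x / 4 := by
    rw [show (x / 4 : ℂ) = ((x / 4 : ℝ) : ℂ) by push_cast; ring, Complex.norm_real,
      Real.norm_of_nonneg (by positivity)]
  rw [hx4, u2] at hn
  have hw1 : 1 ≤ ‖w‖ := h1.trans hwn
  set A := ‖mbNum α τ x (z - 1)‖
  set B := ‖mbNum α τ x z‖
  have hA : 0 ≤ A := norm_nonneg _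
  have hB : 0 ≤ B := norm_nonneg _
  have e1 : (‖w‖ / 2) * (‖w‖ / 2) * (‖w‖ / 2) * (‖w‖ / 2) * A ≤ x / 4 * (3 * ‖w‖) * (2 * ‖w‖) * B := by
    calc _ ≤ ‖w + -(τ * Complex.I)‖ * ‖w + τ * Complex.I‖ * ‖w + -α‖ * ‖w + α‖ * A := by gcongr
      _ = _ := hn
      _ ≤ _ := by gcongr
  have hpos : 0 < ‖w‖ ^ 4 := by positivity
  have e2 : ‖w‖ ^ 4 * A ≤ 24 * x * ‖w‖ ^ 2 * B := by nlinarith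
  have e3 : 24 * x * ‖w‖ ^ 2 * B ≤ ‖w‖ ^ 4 * (1 / 2 * B) := by
    have : 48 * x ≤ ‖w‖ ^ 2 := by nlinarith
    have h7 : 48 * x * (‖w‖ ^ 2 * B) ≤ ‖w‖ ^ 2 * (‖w‖ ^ 2 * B) := by gcongr
    nlinarith
  exact le_of_mul_le_mul_left (e2.trans e3) hpos

/-- Since `mbDen` is periodic up to sign, this is the vanishing of the Mellin–Barnes integral when the
contour moves to `-∞` in unit steps. -/
lemma tendsto_integral_mbNum_sub_nat {α τ x σ : ℝ} (hx : 0 < x) (h0 : 0 < σ) (h1 : σ < 1 / 2)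
    (hσ : ∀ k : ℤ, σ + α ≠ k) :
    Tendsto (fun n : ℕ => ∫ t : ℝ, mbNum α τ x (σ + t * Complex.I - n) / mbDen α τ (σ + t * Complex.I))
      atTop (𝓝 0) := by
  obtain ⟨n0, hn0⟩ := exists_nat_gt (1 + 2 * |τ| + 2 * |α| + 48 * x)
  have geo : ∀ n : ℕ, ∀ t : ℝ, ‖mbNum α τ x (σ + t * Complex.I - (n0 + n : ℕ))‖
      ≤ (1 / 2) ^ n * ‖mbNum α τ x (σ + t * Complex.I - n0)‖ := by
    intro n t
    induction n with
    | zero => simp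
    | succ n ih =>
      have hre : (1 - (σ + t * Complex.I - (n0 + n : ℕ)) : ℂ).re = 1 - σ + n0 + n := by
        simp; ring
      have hnn : (0 : ℝ) ≤ n := Nat.cast_nonneg n
      have a1 := abs_nonneg τ
      have a2 := abs_nonneg α
      have := norm_mbNum_sub_one_le (α := α) (τ := τ) hx (z := σ + t * Complex.I - (n0 + n : ℕ))
        (by
          have : (σ + t * Complex.I - (n0 + n : ℕ) : ℂ).re = σ - n0 - n := by simp; ring
          rw [this]; linarith)
        (by rw [hre]; linarith) (by rw [hre]; linarith) (by rw [hre]; linarith)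
        (by rw [hre]; linarith)
      rw [show (σ + t * Complex.I - (n0 + (n + 1) : ℕ) : ℂ)
        = σ + t * Complex.I - (n0 + n : ℕ) - 1 by push_cast; ring]
      refine this.trans ?_
      rw [pow_succ]
      linarith
  rw [← tendsto_add_atTop_iff_nat n0]
  obtain ⟨C, hC, hb⟩ := exists_norm_mbNum_le α τ hx (a := σ - n0) (b := σ - n0) (by
    have : (0 : ℝ) ≤ n0 := Nat.cast_nonneg n0
    linarith)
  obtain ⟨c, hc, hden⟩ := exists_le_norm_mbDen α τ
  have hint : Integrable (fun t : ℝ =>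
      mbNum α τ x (σ + t * Complex.I - n0) / mbDen α τ (σ + t * Complex.I)) := by
    refine integrable_of_exp_bound (C := C / c) (T := 1 + |τ|) ?_ Real.pi_pos fun t ht => ?_
    · rw [continuous_iff_continuousAt]
      intro t
      refine ContinuousAt.div ?_ ?_ (mbDen_ne_zero h0 (by linarith) hσ (by simp))
      · refine ContinuousAt.comp (g := mbNum α τ x) (f := fun t : ℝ => (σ + t * Complex.I - n0 : ℂ))
          (differentiableAt_mbNum hx ?_).continuousAt (by fun_prop)
        have : (0 : ℝ) ≤ n0 := Nat.cast_nonneg n0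
        simp; linarith
      · unfold mbDen; fun_prop
    · have h3 := hden (σ + t * Complex.I) (by simpa using ht)
      have h4 := hb (σ + t * Complex.I - n0) (by simp) (by simp)
      simp only [Complex.add_im, Complex.sub_im, Complex.ofReal_im, Complex.mul_im, Complex.I_im,
        Complex.ofReal_re, Complex.I_re, mul_one, mul_zero, add_zero, zero_add, Complex.natCast_im,
        sub_zero] at h3 h4
      rw [norm_div, div_le_iff₀ (lt_of_lt_of_le (by positivity) h3)]
      calc _ ≤ _ := h4
        _ = C / c * Real.exp (-Real.pi * |t|) * (c * Real.exp (3 * Real.pi * |t|)) := by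
            rw [show 2 * Real.pi * |t| = -Real.pi * |t| + 3 * Real.pi * |t| by ring,
              Real.exp_add]
            field_simp
        _ ≤ _ := by gcongr
  have hlim : Tendsto (fun n : ℕ => (1 / 2 : ℝ) ^ n *
      ∫ t : ℝ, ‖mbNum α τ x (σ + t * Complex.I - n0) / mbDen α τ (σ + t * Complex.I)‖)
      atTop (𝓝 0) := by
    simpa using (tendsto_pow_atTop_nhds_zero_of_lt_one (r := (1 / 2 : ℝ)) (by norm_num)
      (by norm_num)).mul_const (∫ t : ℝ, ‖mbNum α τ x (σ + t * Complex.I - n0)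
        / mbDen α τ (σ + t * Complex.I)‖)
  refine squeeze_zero_norm (fun n => ?_) hlim
  rw [← integral_const_mul]
  refine norm_integral_le_of_norm_le (hint.norm.const_mul _) (Eventually.of_forall fun t => ?_)
  rw [norm_div, norm_div, ← mul_div_assoc, add_comm n n0]
  gcongr
  exact geo n t

/-- The residues at `iτ - k` add up to a product of Bessel functions; those at `-iτ - k` are covered by
`mbNum_neg`. -/
lemma hasSum_mbNum_eq_besselJ_mul {α τ x : ℝ} (hx : 0 < x) (hτ : τ ≠ 0) :
    HasSum (fun k : ℕ => (-1) ^ k * mbNum α τ x (τ * Complex.I - k))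
      (Real.pi ^ 3 * (besselJ (α - τ * Complex.I) (Real.sqrt x)
        * besselJ (-α - τ * Complex.I) (Real.sqrt x))) := by
  have ne : ∀ w : ℂ, w.im ≠ 0 → ∀ m : ℕ, w + m + 1 ≠ 0 := fun w hw m h => hw (by
    have := congrArg Complex.im h; simpa using this)
  have h := (hasSum_besselJ_mul (μ := α - τ * Complex.I) (l := -α - τ * Complex.I)
    (ne _ (by simpa using hτ)) (ne _ (by simpa using hτ))
    (ne _ (by simp; intro h; apply hτ; linarith)) hx).mul_left ((Real.pi : ℂ) ^ 3)
  refine h.congr_fun fun k => ?_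
  have hsq : ((-1 : ℂ) ^ k) * (-1) ^ k = 1 := by rw [← mul_pow]; simp
  simp only [mbNum, besselProdCoeff]
  rw [show (1 - 2 * (τ * Complex.I - k) : ℂ)
      = α - τ * Complex.I + (-α - τ * Complex.I) + 2 * k + 1 by ring,
    show (-(τ * Complex.I - k) : ℂ) = (α - τ * Complex.I + (-α - τ * Complex.I)) / 2 + k by ring,
    show (1 - (τ * Complex.I - k) - τ * Complex.I : ℂ)
      = α - τ * Complex.I + (-α - τ * Complex.I) + k + 1 by ring,
    show (1 - (τ * Complex.I - k) + τ * Complex.I : ℂ) = k + 1 by ring,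
    show (1 - (τ * Complex.I - k) - α : ℂ) = -α - τ * Complex.I + k + 1 by ring,
    show (1 - (τ * Complex.I - k) + α : ℂ) = α - τ * Complex.I + k + 1 by ring,
    Complex.Gamma_nat_eq_factorial]
  simp only [div_eq_mul_inv, mul_inv]
  ring

/-- The residues at `-α - k` add up to a product of Bessel functions. The points `-α + d - k` with
`k < d` contribute nothing, since `1 / Γ(1 - z - α)` vanishes there. -/
lemma hasSum_mbNum_eq_besselJ_mul_self {α τ x : ℝ} (hα : 0 < α) (hx : 0 < x) (hτ : τ ≠ 0) (d : ℕ) :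
    HasSum (fun k : ℕ => (-1) ^ k * ((-1) ^ d * mbNum α τ x (-α + d - k)))
      (Real.pi ^ 3 * (besselJ (α + τ * Complex.I) (Real.sqrt x)
        * besselJ (α - τ * Complex.I) (Real.sqrt x))) := by
  have ne : ∀ w : ℂ, w.im ≠ 0 → ∀ m : ℕ, w + m + 1 ≠ 0 := fun w hw m h => hw (by
    have := congrArg Complex.im h; simpa using this)
  have h := (hasSum_besselJ_mul (μ := α + τ * Complex.I) (l := α - τ * Complex.I)
    (ne _ (by simpa using hτ)) (ne _ (by simpa using hτ))
    (fun m h => by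
      have := congrArg Complex.re h
      simp at this
      linarith [(Nat.cast_nonneg m : (0 : ℝ) ≤ m)]) hx).mul_left ((Real.pi : ℂ) ^ 3)
  -- the terms with `k < d` vanish, because `1 / Γ` vanishes at the nonpositive integers
  have hz : ∑ k ∈ Finset.range d, (-1) ^ k * ((-1) ^ d * mbNum α τ x (-α + d - k)) = 0 := by
    refine Finset.sum_eq_zero fun k hk => ?_
    have hk' : k < d := Finset.mem_range.1 hk
    obtain ⟨m, rfl⟩ := Nat.exists_eq_add_of_lt hk'
    have : Complex.Gamma (1 - (-α + (k + m + 1 : ℕ) - k) - α) = 0 := by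
      rw [show (1 - (-α + (k + m + 1 : ℕ) - k) - α : ℂ) = -(m : ℕ) by push_cast; ring]
      exact Complex.Gamma_neg_nat_eq_zero m
    rw [mbNum, this]; simp
  rw [← hasSum_nat_add_iff' d, hz, sub_zero]
  refine h.congr_fun fun k => ?_
  have hsq : ((-1 : ℂ) ^ d) * (-1) ^ d = 1 := by rw [← mul_pow]; simp
  simp only [mbNum, besselProdCoeff]
  push_cast
  rw [show (-α + d - (k + d) : ℂ) = -α - k by ring,
    show (1 - 2 * (-α - k) : ℂ)
      = α + τ * Complex.I + (α - τ * Complex.I) + 2 * k + 1 by ring,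
    show (-(-α - k) : ℂ) = (α + τ * Complex.I + (α - τ * Complex.I)) / 2 + k by ring,
    show (1 - (-α - k) - τ * Complex.I : ℂ) = α - τ * Complex.I + k + 1 by ring,
    show (1 - (-α - k) + τ * Complex.I : ℂ) = α + τ * Complex.I + k + 1 by ring,
    show (1 - (-α - k) - α : ℂ) = k + 1 by ring,
    show (1 - (-α - k) + α : ℂ) = α + τ * Complex.I + (α - τ * Complex.I) + k + 1 by ring,
    Complex.Gamma_nat_eq_factorial, pow_add]
  simp only [div_eq_mul_inv, mul_inv]
  linear_combination (Real.pi ^ 3 * (-1) ^ k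
    * Complex.Gamma (α + τ * Complex.I + (α - τ * Complex.I) + 2 * k + 1)
    * ((x : ℂ) * (4 : ℂ)⁻¹) ^ ((α + τ * Complex.I + (α - τ * Complex.I)) * (2 : ℂ)⁻¹ + k)
    * (k.factorial : ℂ)⁻¹ * (Complex.Gamma (α + τ * Complex.I + k + 1))⁻¹
    * (Complex.Gamma (α - τ * Complex.I + k + 1))⁻¹
    * (Complex.Gamma (α + τ * Complex.I + (α - τ * Complex.I) + k + 1))⁻¹) * hsq

/-- A telescoping sum. -/
lemma eq_of_hasSum_of_sub_eq {L u : ℕ → ℂ} {S : ℂ} (hu : HasSum u S)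
    (hL : Tendsto L atTop (𝓝 0)) (h : ∀ k, L k - L (k + 1) = u k) : L 0 = S := by
  have h1 := hu.tendsto_sum_nat
  simp_rw [← h, Finset.sum_range_sub'] at h1
  simpa using tendsto_nhds_unique (tendsto_const_nhds.sub hL) h1

/-- The contour moves to the left over all poles. The condition `hσ` keeps the lines `re z = σ - n` off
the poles of `1 / mbDen`. -/
lemma integral_mbNum_div_mbDen {α τ x σ : ℝ} (hα : 0 < α) (hx : 0 < x) (hτ : 0 < τ) (h0 : 0 < σ)
    (h1 : σ < 1 / 2) (hσ : ∀ k : ℤ, σ + α ≠ k) :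
    Complex.cosh (Real.pi * τ) / (2 * Real.pi ^ 3)
      * ∫ t : ℝ, mbNum α τ x (σ + t * Complex.I) / mbDen α τ (σ + t * Complex.I)
    = weberKernel α x τ := by
  obtain ⟨d, hd⟩ : ∃ d : ℕ, ⌊σ + α⌋ = d :=
    Int.eq_ofNat_of_zero_le (Int.floor_nonneg.2 (by linarith))
  have hd1 : (d : ℝ) < σ + α := by
    have h := Int.floor_le (σ + α)
    have h' := hσ ⌊σ + α⌋
    rw [hd] at h h'
    exact lt_of_le_of_ne (by exact_mod_cast h) (fun e => h' (by rw [← e]; simp))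
  have hd2 : σ + α < d + 1 := by
    have h := Int.lt_floor_add_one (σ + α)
    rw [hd] at h
    exact_mod_cast h
  set s1 := Complex.sin (Real.pi * (2 * τ * Complex.I)) with hs1
  set sp := Complex.sin (Real.pi * (α + τ * Complex.I)) with hsp
  set sm := Complex.sin (Real.pi * (α - τ * Complex.I)) with hsm
  set L : ℕ → ℂ := fun n => (-1) ^ n *
    ∫ t : ℝ, mbNum α τ x (σ + t * Complex.I - n) / mbDen α τ (σ + t * Complex.I) with hL
  have hL0 : Tendsto L atTop (𝓝 0) := by
    refine squeeze_zero_norm (fun n => ?_)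
      (tendsto_zero_iff_norm_tendsto_zero.1 (tendsto_integral_mbNum_sub_nat (α := α) (τ := τ) hx h0 h1 hσ))
    simp [hL]
  have hstep : ∀ k : ℕ, L k - L (k + 1) = 2 * (((-1) ^ k * mbNum α τ x (τ * Complex.I - k)) / (s1 * sp)
      - ((-1) ^ k * mbNum α τ x (((-τ : ℝ) : ℂ) * Complex.I - k)) / (s1 * sm)
      + ((-1) ^ k * ((-1) ^ d * mbNum α τ x (-α + d - k))) / (sp * sm)) := by
    intro k
    have hk : (0 : ℝ) ≤ k := Nat.cast_nonneg k
    obtain ⟨C, hC, hb⟩ := exists_norm_mbNum_le α τ hx (a := σ - 1 - k) (b := σ - k) (by linarith)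
    have := integral_div_mbDen_sub (E := fun z => (-1) ^ k * mbNum α τ x (z - k)) (α := α) (τ := τ)
      (σ := σ) (C := C) (d := d) hτ h0 (by linarith) hd1 hd2
      (fun z h2 h3 => by
        refine DifferentiableAt.const_mul ?_ _
        exact DifferentiableAt.comp (g := mbNum α τ x) z
          (differentiableAt_mbNum hx (by simp; linarith)) (by fun_prop)) hC
      (fun z h2 h3 => by
        have := hb (z - k) (by simpa using h2) (by simpa using h3)
        simpa using this)
    have e1 : ∫ t : ℝ, (-1) ^ k * mbNum α τ x (σ + t * Complex.I - k) / mbDen α τ (σ + t * Complex.I)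
        = L k := by
      simp only [hL, ← integral_const_mul, mul_div_assoc]
    have e2 : ∫ t : ℝ, (-1) ^ k * mbNum α τ x (((σ - 1 : ℝ) : ℂ) + t * Complex.I - k)
          / mbDen α τ (((σ - 1 : ℝ) : ℂ) + t * Complex.I) = L (k + 1) := by
      simp only [hL, ← integral_const_mul]
      refine integral_congr_ae (Eventually.of_forall fun t => ?_)
      have hden : mbDen α τ (((σ - 1 : ℝ) : ℂ) + t * Complex.I)
          = -mbDen α τ (σ + t * Complex.I) := by
        have := mbDen_sub_natCast α τ (σ + t * Complex.I) 1
        rw [show (((σ - 1 : ℝ) : ℂ) + t * Complex.I) = σ + t * Complex.I - (1 : ℕ) by push_cast; ring,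
          this]
        ring
      simp only [hden]
      rw [show (((σ - 1 : ℝ) : ℂ) + t * Complex.I - k) = σ + t * Complex.I - (k + 1 : ℕ) by
        push_cast; ring, pow_succ, div_neg]
      ring
    rw [e1, e2] at this
    rw [this]
    push_cast
    ring
  have hL00 : L 0 = ∫ t : ℝ, mbNum α τ x (σ + t * Complex.I) / mbDen α τ (σ + t * Complex.I) := by
    simp [hL]
  clear_value L
  have hA := hasSum_mbNum_eq_besselJ_mul (α := α) hx hτ.ne'
  have hB := hasSum_mbNum_eq_besselJ_mul (α := α) (τ := -τ) hx (neg_ne_zero.2 hτ.ne')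
  simp only [mbNum_neg] at hB
  have hD := hasSum_mbNum_eq_besselJ_mul_self (τ := τ) hα hx hτ.ne' d
  have hsum := (((hA.div_const (s1 * sp)).sub (hB.div_const (s1 * sm))).add
    (hD.div_const (sp * sm))).mul_left 2
  have hfin := eq_of_hasSum_of_sub_eq hsum hL0 hstep
  rw [hL00] at hfin
  rw [hfin, weberKernel_eq hx hτ]
  have im_ne : ∀ w : ℂ, w.im ≠ 0 → Complex.sin (Real.pi * w) ≠ 0 := fun w hw =>
    sin_pi_mul_ne_zero_of_forall_ne_intCast fun k h => hw (by rw [h]; simp)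
  have s1n : s1 ≠ 0 := im_ne _ (by simp [hτ.ne'])
  have spn : sp ≠ 0 := im_ne _ (by simp [hτ.ne'])
  have smn : sm ≠ 0 := im_ne _ (by simp [hτ.ne'])
  have hs1' : s1 = 2 * Complex.I * Complex.sinh (Real.pi * τ) * Complex.cosh (Real.pi * τ) := by
    rw [hs1, show (Real.pi * (2 * τ * Complex.I) : ℂ)
        = 2 * ((Real.pi * τ) * Complex.I) by ring, Complex.sin_two_mul, Complex.sin_mul_I,
        Complex.cos_mul_I]
    ring
  have hπ : (Real.pi : ℂ) ≠ 0 := by exact_mod_cast Real.pi_ne_zero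
  rw [hs1'] at s1n ⊢
  have n1 := right_ne_zero_of_mul s1n
  have n2 := right_ne_zero_of_mul (left_ne_zero_of_mul s1n)
  have hI := Complex.I_ne_zero
  simp only [Complex.ofReal_neg, neg_mul, sub_neg_eq_add]
  rw [← hsp, ← hsm]
  clear_value sp sm
  clear hfin hsum hA hB hD hstep hL0 hL00 im_ne
  generalize besselJ (α + τ * Complex.I) (Real.sqrt x) = A
  generalize besselJ (α - τ * Complex.I) (Real.sqrt x) = B
  generalize besselJ (-α + τ * Complex.I) (Real.sqrt x) = A'
  generalize besselJ (-α - τ * Complex.I) (Real.sqrt x) = B'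
  generalize Complex.sinh (Real.pi * τ) = S at n2 ⊢
  generalize Complex.cosh (Real.pi * τ) = C at n1 ⊢
  field_simp
  ring

/-- The Mellin transform of the factor of the kernel that does not depend on `τ`: the Mellin
transform of `weberKernel α · τ` is `cosh (π τ) / π² · Γ(s + iτ) Γ(s - iτ) · kernelMellin α s`. -/
noncomputable def kernelMellin (α : ℝ) (s : ℂ) : ℂ :=
  Complex.Gamma (s + α) * Complex.Gamma (1 - 2 * s) * 4 ^ s / Complex.Gamma (1 + α - s)

/-- By the reflection formula the sines in `mbDen` turn reciprocal Gamma factors into Gamma factors. -/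
lemma mbNum_div_mbDen {α τ x : ℝ} (hx : 0 < x) {z : ℂ} (h : mbDen α τ z ≠ 0) :
    mbNum α τ x z / mbDen α τ z = Complex.Gamma (z + τ * Complex.I) * Complex.Gamma (z - τ * Complex.I)
      * kernelMellin α z * (x : ℂ) ^ (-z) := by
  have hπ : (Real.pi : ℂ) ≠ 0 := by exact_mod_cast Real.pi_ne_zero
  have refl : ∀ w : ℂ, Complex.sin (Real.pi * w) ≠ 0 →
      Complex.Gamma w = Real.pi / Complex.sin (Real.pi * w) * (Complex.Gamma (1 - w))⁻¹ := by
    intro w hw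
    have h1 := Complex.Gamma_mul_Gamma_one_sub w
    have h2 : Complex.Gamma (1 - w) ≠ 0 := by
      intro h0
      rw [h0, mul_zero] at h1
      exact div_ne_zero hπ hw h1.symm
    rw [← h1, mul_inv_cancel_right₀ h2]
  have hsm := right_ne_zero_of_mul (left_ne_zero_of_mul h)
  have hsp := left_ne_zero_of_mul (left_ne_zero_of_mul h)
  have hsa := right_ne_zero_of_mul h
  have hpow : ((x / 4 : ℝ) : ℂ) ^ (-z) = 4 ^ z * (x : ℂ) ^ (-z) := by
    have h4 : ((4 : ℝ) : ℂ) = 4 := by norm_num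
    rw [show x / 4 = x * (4 : ℝ)⁻¹ by ring, Complex.ofReal_mul,
      Complex.mul_cpow_ofReal_nonneg hx.le (by norm_num), mul_comm, Complex.ofReal_inv, h4,
      Complex.inv_cpow _ _ (by rw [← h4, Complex.arg_ofReal_of_nonneg (by norm_num)];
                               exact Real.pi_ne_zero.symm), Complex.cpow_neg, inv_inv]
  rw [refl _ hsm, refl _ hsp, kernelMellin, refl _ hsa, mbNum, mbDen, hpow]
  rw [show (1 - (z + τ * Complex.I) : ℂ) = 1 - z - τ * Complex.I by ring,
    show (1 - (z - τ * Complex.I) : ℂ) = 1 - z + τ * Complex.I by ring,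
    show (1 - (z + α) : ℂ) = 1 - z - α by ring,
    show (1 + α - z : ℂ) = 1 - z + α by ring]
  simp only [div_eq_mul_inv, mul_inv]
  ring

/-! ### Analyticity and decay of the Mellin–Barnes density -/

lemma differentiableAt_Gamma_of_re_pos {z : ℂ} (hz : 0 < z.re) : DifferentiableAt ℂ Complex.Gamma z :=
  Complex.differentiableAt_Gamma _ fun m h => by
    have := congrArg Complex.re h
    simp at this
    linarith [(Nat.cast_nonneg m : (0 : ℝ) ≤ m)]

lemma differentiableAt_inv_Gamma_comp {f : ℂ → ℂ} {z : ℂ} (hf : DifferentiableAt ℂ f z) :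
    DifferentiableAt ℂ (fun z => (Complex.Gamma (f z))⁻¹) z :=
  DifferentiableAt.comp (g := fun s => (Complex.Gamma s)⁻¹) z
    (Complex.differentiable_one_div_Gamma _) hf

lemma differentiableAt_Gamma_comp {f : ℂ → ℂ} {z : ℂ} (hf : DifferentiableAt ℂ f z)
    (hz : 0 < (f z).re) : DifferentiableAt ℂ (fun z => Complex.Gamma (f z)) z :=
  DifferentiableAt.comp (g := Complex.Gamma) z (differentiableAt_Gamma_of_re_pos hz) hf

lemma differentiableAt_kernelMellin {α : ℝ} {z : ℂ} (h1 : -α < z.re) (h2 : z.re < 1 / 2) :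
    DifferentiableAt ℂ (kernelMellin α) z := by
  unfold kernelMellin
  simp only [div_eq_mul_inv]
  refine (((differentiableAt_Gamma_comp (by fun_prop) (by simp; linarith)).mul
    (differentiableAt_Gamma_comp (by fun_prop) (by simp; linarith))).mul ?_).mul
    (differentiableAt_inv_Gamma_comp (by fun_prop))
  exact differentiableAt_id.const_cpow (Or.inl (by norm_num))

lemma exists_norm_kernelMellin_le {α a b : ℝ} (ha : -α < a) (hb : b < 1 / 2) :
    ∃ C : ℝ, 0 ≤ C ∧ ∀ z : ℂ, a ≤ z.re → z.re ≤ b →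
      ‖kernelMellin α z‖ ≤ C * Real.exp (-(Real.pi / 2) * |z.im|) := by
  obtain ⟨C1, h1, b1⟩ := exists_norm_Gamma_le_of_pos (A := a + α) (B := b + α) (by linarith)
  obtain ⟨C2, h2, b2⟩ := exists_norm_Gamma_le_of_pos (A := 1 - 2 * b) (B := 1 - 2 * a) (by linarith)
  obtain ⟨C3, h3, b3⟩ := exists_rpow_bound (y := 4) (by norm_num) (-b) (-a)
  obtain ⟨C4, h4, b4⟩ := exists_norm_inv_Gamma_le (1 + α - b) (1 + α - a)
  refine ⟨C1 * C2 * C3 * C4, by positivity, fun z hza hzb => ?_⟩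
  have r1 := b1 (z + α) (by simpa using hza) (by simpa using hzb)
  have r2 := b2 (1 - 2 * z) (by simp; linarith) (by simp; linarith)
  have r3 := b3 (-z) (by simpa using hzb) (by simpa using hza)
  have r4 := b4 (1 + α - z) (by simp; linarith) (by simp; linarith)
  have i2 : |(1 - 2 * z).im| = 2 * |z.im| := by simp [abs_mul]
  have i4 : |(1 + α - z).im| = |z.im| := by simp
  have i1 : (z + α).im = z.im := by simp
  rw [i1] at r1
  rw [i2] at r2
  rw [i4] at r4
  rw [neg_neg, Complex.ofReal_ofNat] at r3
  rw [kernelMellin, div_eq_mul_inv, norm_mul, norm_mul, norm_mul]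
  calc _ ≤ (C1 * Real.exp (-gammaRate * |z.im|)) * (C2 * Real.exp (-gammaRate * (2 * |z.im|))) * C3
        * (C4 * Real.exp ((Real.pi - gammaRate) * |z.im|)) := by gcongr
    _ = C1 * C2 * C3 * C4 * Real.exp (-gammaRate * |z.im| + -gammaRate * (2 * |z.im|)
        + (Real.pi - gammaRate) * |z.im|) := by
        simp only [Real.exp_add]; ring
    _ = _ := by
        congr 2
        rw [gammaRate]; ring

/-- `Γ(z + iτ) Γ(z - iτ)`. -/
noncomputable def gammaPair (τ : ℝ) (z : ℂ) : ℂ :=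
  Complex.Gamma (z + τ * Complex.I) * Complex.Gamma (z - τ * Complex.I)

lemma differentiableAt_gammaPair (τ : ℝ) {z : ℂ} (hz : 0 < z.re) :
    DifferentiableAt ℂ (gammaPair τ) z := by
  unfold gammaPair
  exact (differentiableAt_Gamma_comp (by fun_prop) (by simpa using hz)).mul
    (differentiableAt_Gamma_comp (by fun_prop) (by simpa using hz))

lemma exists_norm_gammaPair_le {a b : ℝ} (ha : 0 < a) :
    ∃ C : ℝ, 0 ≤ C ∧ ∀ (τ : ℝ) (z : ℂ), a ≤ z.re → z.re ≤ b →
      ‖gammaPair τ z‖ ≤ C * Real.exp (-(3 * Real.pi / 4) * |τ|) := by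
  obtain ⟨C1, h1, b1⟩ := exists_norm_Gamma_le_of_pos (A := a) (B := b) ha
  refine ⟨C1 * C1, by positivity, fun τ z hza hzb => ?_⟩
  have r1 := b1 (z + τ * Complex.I) (by simpa using hza) (by simpa using hzb)
  have r2 := b1 (z - τ * Complex.I) (by simpa using hza) (by simpa using hzb)
  have i1 : (z + τ * Complex.I).im = z.im + τ := by simp
  have i2 : (z - τ * Complex.I).im = z.im - τ := by simp
  rw [i1] at r1
  rw [i2] at r2
  have htri : 2 * |τ| ≤ |z.im + τ| + |z.im - τ| := by
    have := abs_sub (z.im + τ) (z.im - τ)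
    rw [show z.im + τ - (z.im - τ) = 2 * τ by ring, abs_mul] at this
    simpa using this
  rw [gammaPair, norm_mul]
  calc _ ≤ (C1 * Real.exp (-gammaRate * |z.im + τ|)) * (C1 * Real.exp (-gammaRate * |z.im - τ|)) := by
        gcongr
    _ = C1 * C1 * Real.exp (-gammaRate * |z.im + τ| + -gammaRate * |z.im - τ|) := by
        rw [Real.exp_add]; ring
    _ ≤ _ := by
        gcongr
        rw [gammaRate]
        nlinarith [Real.pi_pos]

/-- The Mellin–Barnes representation of the kernel. -/
lemma weberKernel_eq_integral {α x τ σ : ℝ} (hα : 0 < α) (hx : 0 < x) (hτ : 0 < τ) (h0 : 0 < σ)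
    (h1 : σ < 1 / 2) :
    (weberKernel α x τ : ℂ) = Complex.cosh (Real.pi * τ) / (2 * Real.pi ^ 3)
      * ∫ t : ℝ, gammaPair τ (σ + t * Complex.I) * kernelMellin α (σ + t * Complex.I)
        * (x : ℂ) ^ (-(σ + t * Complex.I : ℂ)) := by
  set g : ℂ → ℂ := fun z => gammaPair τ z * kernelMellin α z * (x : ℂ) ^ (-z) with hg
  -- a line on which the integrand has no poles further to the left
  obtain ⟨σ0, h00, h01, hσ0⟩ : ∃ σ0 : ℝ, 0 < σ0 ∧ σ0 < 1 / 2 ∧ ∀ k : ℤ, σ0 + α ≠ k := by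
    by_contra! h
    obtain ⟨k1, hk1⟩ := h (1 / 8) (by norm_num) (by norm_num)
    obtain ⟨k2, hk2⟩ := h (1 / 4) (by norm_num) (by norm_num)
    have : (k2 : ℝ) - k1 = 1 / 8 := by rw [← hk1, ← hk2]; ring
    have h3 : (((k2 - k1 : ℤ)) : ℝ) = 1 / 8 := by push_cast; exact this
    have h4 : 0 < k2 - k1 := by
      have : (0 : ℝ) < ((k2 - k1 : ℤ) : ℝ) := by rw [h3]; norm_num
      exact_mod_cast this
    have h5 : k2 - k1 < 1 := by
      have : ((k2 - k1 : ℤ) : ℝ) < 1 := by rw [h3]; norm_num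
      exact_mod_cast this
    omega
  have hshift : ∀ p q : ℝ, 0 < p → p ≤ q → q < 1 / 2 →
      ∫ t : ℝ, g (p + t * Complex.I) = ∫ t : ℝ, g (q + t * Complex.I) := by
    intro p q hp hpq hq
    obtain ⟨C1, c1, b1⟩ := exists_norm_kernelMellin_le (α := α) (a := p) (b := q) (by linarith) hq
    obtain ⟨C2, c2, b2⟩ := exists_norm_gammaPair_le (a := p) (b := q) hp
    obtain ⟨C3, c3, b3⟩ := exists_rpow_bound hx p q
    have hd : ∀ z : ℂ, p ≤ z.re → z.re ≤ q → DifferentiableAt ℂ g z := by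
      intro z hz1 hz2
      refine ((differentiableAt_gammaPair τ (by linarith)).mul
        (differentiableAt_kernelMellin (by linarith) (by linarith))).mul ?_
      exact (by fun_prop : DifferentiableAt ℂ (fun z : ℂ => -z) z).const_cpow
        (Or.inl (by exact_mod_cast hx.ne'))
    refine integral_vertical_eq (C := C2 * C1 * C3) (c := Real.pi / 2) (T := 0) hpq (by positivity)
      (fun z hz => (hd z hz.1 hz.2).continuousAt.continuousWithinAt) countable_empty
      (fun z hz1 hz2 _ => hd z hz1.le hz2.le) fun z hz1 hz2 _ => ?_
    have e2 : ‖gammaPair τ z‖ ≤ C2 := by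
      refine (b2 τ z hz1 hz2).trans (mul_le_of_le_one_right c2 (Real.exp_le_one_iff.2 ?_))
      nlinarith [Real.pi_pos, abs_nonneg τ]
    simp only [hg, norm_mul]
    calc _ ≤ C2 * (C1 * Real.exp (-(Real.pi / 2) * |z.im|)) * C3 := by
          gcongr
          · exact b1 z hz1 hz2
          · exact b3 z hz1 hz2
      _ = _ := by ring
  have key := integral_mbNum_div_mbDen hα hx hτ h00 h01 hσ0
  have e1 : ∫ t : ℝ, mbNum α τ x (σ0 + t * Complex.I) / mbDen α τ (σ0 + t * Complex.I)
      = ∫ t : ℝ, g (σ0 + t * Complex.I) := by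
    refine integral_congr_ae (Eventually.of_forall fun t => ?_)
    exact mbNum_div_mbDen hx (mbDen_ne_zero h00 (by linarith) hσ0 (by simp))
  rw [e1] at key
  rw [← key]
  congr 1
  rcases le_total σ0 σ with h | h
  · exact hshift σ0 σ h00 h h1
  · exact (hshift σ σ0 h0 h h01).symm

/-! ### Trigonometric integrals of powers of the hyperbolic sine -/

lemma image_exp_neg_two_mul : (fun θ : ℝ => Real.exp (-2 * θ)) '' Ioi 0 = Ioo 0 1 := by
  ext u
  constructor
  · rintro ⟨θ, hθ, rfl⟩
    have : 0 < θ := hθ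
    exact ⟨Real.exp_pos _, Real.exp_lt_one_iff.2 (by linarith)⟩
  · rintro ⟨h0, h1⟩
    refine ⟨-Real.log u / 2, ?_, ?_⟩
    · have := Real.log_neg h0 h1
      simp only [mem_Ioi]; linarith
    · simp only
      rw [show -2 * (-Real.log u / 2) = Real.log u by ring, Real.exp_log h0]

/-- The power `(2 sinh θ)^{-2w}`, for `θ > 0`. -/
noncomputable def sinhPow (θ : ℝ) (w : ℂ) : ℂ := ((2 * Real.sinh θ : ℝ) : ℂ) ^ (-2 * w)

lemma norm_sinhPow {θ : ℝ} (hθ : 0 < θ) (w : ℂ) :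
    ‖sinhPow θ w‖ = (2 * Real.sinh θ) ^ (-2 * w.re) := by
  have : 0 < 2 * Real.sinh θ := by have := Real.sinh_pos_iff.2 hθ; linarith
  rw [sinhPow, Complex.norm_cpow_eq_rpow_re_of_pos this]
  simp

lemma beta_integrand_eq {θ : ℝ} (hθ : 0 < θ) (w : ℂ) (τ : ℝ) :
    |(-2 * Real.exp (-2 * θ))| • (((Real.exp (-2 * θ) : ℝ) : ℂ) ^ (w - τ * Complex.I - 1)
        * (1 - ((Real.exp (-2 * θ) : ℝ) : ℂ)) ^ ((1 - 2 * w) - 1))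
      = 2 * (Complex.exp (2 * τ * θ * Complex.I) * sinhPow θ w) := by
  have hE : 0 < Real.exp (-2 * θ) := Real.exp_pos _
  have h1 : 0 < 1 - Real.exp (-2 * θ) := by
    have := Real.exp_lt_one_iff.2 (show -2 * θ < 0 by linarith); linarith
  have hs : 2 * Real.sinh θ = Real.exp θ * (1 - Real.exp (-2 * θ)) := by
    rw [Real.sinh_eq, mul_sub, ← Real.exp_add]; ring_nf
  have hn : ∀ y : ℝ, ((Real.exp y : ℝ) : ℂ) ≠ 0 := fun y => by exact_mod_cast (Real.exp_pos y).ne'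
  have he : ∀ y : ℝ, ∀ s : ℂ, ((Real.exp y : ℝ) : ℂ) ^ s = Complex.exp (y * s) := by
    intro y s
    rw [Complex.cpow_def_of_ne_zero (hn y), ← Complex.ofReal_log (Real.exp_pos y).le, Real.log_exp]
  rw [sinhPow, hs, Complex.ofReal_mul,
    Complex.mul_cpow_ofReal_nonneg (Real.exp_pos θ).le h1.le, he, he,
    show (1 - 2 * w - 1 : ℂ) = -2 * w by ring, abs_mul, abs_of_pos hE, Complex.real_smul]
  have : |(-2 : ℝ)| = 2 := by norm_num
  rw [this, Complex.ofReal_mul, Complex.ofReal_exp]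
  push_cast
  have e : Complex.exp (-2 * θ) * Complex.exp (-2 * θ * (w - τ * Complex.I - 1))
      = Complex.exp (2 * τ * θ * Complex.I) * Complex.exp (θ * (-2 * w)) := by
    rw [← Complex.exp_add, ← Complex.exp_add]; congr 1; ring
  linear_combination (2 * (1 - Complex.exp (-2 * θ)) ^ (-2 * w)) * e

lemma hasDerivAt_exp_neg_two_mul (θ : ℝ) :
    HasDerivAt (fun θ : ℝ => Real.exp (-2 * θ)) (-2 * Real.exp (-2 * θ)) θ := by
  have h1 : HasDerivAt (fun θ : ℝ => -2 * θ) (-2) θ := by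
    simpa using (hasDerivAt_id θ).const_mul (-2 : ℝ)
  exact h1.exp.congr_deriv (by ring)

lemma injOn_exp_neg_two_mul : InjOn (fun θ : ℝ => Real.exp (-2 * θ)) (Ioi 0) := by
  intro a _ b _ h
  have := Real.exp_injective h
  linarith

lemma integrableOn_exp_mul_sinhPow {w : ℂ} (h0 : 0 < w.re) (h1 : w.re < 1 / 2) (τ : ℝ) :
    IntegrableOn (fun θ : ℝ => Complex.exp (2 * τ * θ * Complex.I) * sinhPow θ w) (Ioi 0) := by
  have hb := Complex.betaIntegral_convergent (u := w - τ * Complex.I) (v := 1 - 2 * w)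
    (by simpa using h0) (by simp; linarith)
  rw [intervalIntegrable_iff_integrableOn_Ioo_of_le zero_le_one, ← image_exp_neg_two_mul,
    integrableOn_image_iff_integrableOn_abs_deriv_smul measurableSet_Ioi
      (fun θ _ => (hasDerivAt_exp_neg_two_mul θ).hasDerivWithinAt) injOn_exp_neg_two_mul] at hb
  have hb2 := (hb.congr_fun (fun θ hθ => beta_integrand_eq hθ w τ) measurableSet_Ioi).const_mul
    (1 / 2 : ℂ)
  refine IntegrableOn.congr_fun hb2 (fun θ _ => ?_) measurableSet_Ioi
  ring

/-- The substitution `v = e^{-2θ}` gives a Beta integral. -/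
lemma integral_exp_mul_sinhPow {w : ℂ} (h0 : 0 < w.re) (h1 : w.re < 1 / 2) (τ : ℝ) :
    ∫ θ in Ioi (0 : ℝ), Complex.exp (2 * τ * θ * Complex.I) * sinhPow θ w
      = Complex.Gamma (1 - 2 * w) * gammaPair τ w * Complex.sin (Real.pi * (w + τ * Complex.I))
        / (2 * Real.pi) := by
  have hπ : (Real.pi : ℂ) ≠ 0 := by exact_mod_cast Real.pi_ne_zero
  have hu : 0 < (w - τ * Complex.I).re := by simpa using h0
  have hv : 0 < (1 - 2 * w).re := by simp; linarith
  have hbeta := Complex.Gamma_mul_Gamma_eq_betaIntegral hu hv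
  have hval : (w - τ * Complex.I).betaIntegral (1 - 2 * w)
      = 2 * ∫ θ in Ioi (0 : ℝ), Complex.exp (2 * τ * θ * Complex.I) * sinhPow θ w := by
    rw [Complex.betaIntegral, intervalIntegral.integral_of_le zero_le_one,
      integral_Ioc_eq_integral_Ioo, ← image_exp_neg_two_mul,
      integral_image_eq_integral_abs_deriv_smul measurableSet_Ioi
      (fun θ _ => (hasDerivAt_exp_neg_two_mul θ).hasDerivWithinAt) injOn_exp_neg_two_mul,
      ← integral_const_mul]
    exact setIntegral_congr_fun measurableSet_Ioi fun θ hθ => beta_integrand_eq hθ w τ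
  have hrefl := Complex.Gamma_mul_Gamma_one_sub (w + τ * Complex.I)
  have hsum : w - τ * Complex.I + (1 - 2 * w) = 1 - (w + τ * Complex.I) := by ring
  rw [hsum] at hbeta
  have hsin : Complex.sin (Real.pi * (w + τ * Complex.I)) ≠ 0 := by
    refine sin_pi_mul_ne_zero_of_forall_ne_intCast (ne_intCast_of_abs_re_lt_one ?_ ?_ ?_)
    · simp; linarith
    · simp; linarith
    · intro h; have := congrArg Complex.re h; simp at this; linarith
  rw [eq_div_iff hsin] at hrefl
  rw [hval] at hbeta
  rw [eq_div_iff (by simp), gammaPair]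
  linear_combination (-Complex.sin (Real.pi * (w + τ * Complex.I))
      * Complex.Gamma (w + τ * Complex.I)) * hbeta
    - 2 * (∫ θ in Ioi (0 : ℝ), Complex.exp (2 * τ * θ * Complex.I) * sinhPow θ w) * hrefl

lemma gammaPair_neg (τ : ℝ) (w : ℂ) : gammaPair (-τ) w = gammaPair τ w := by
  simp only [gammaPair, Complex.ofReal_neg, neg_mul, sub_neg_eq_add, ← sub_eq_add_neg]
  ring

lemma integral_cos_mul_sinhPow {w : ℂ} (h0 : 0 < w.re) (h1 : w.re < 1 / 2) (τ : ℝ) :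
    ∫ θ in Ioi (0 : ℝ), Complex.cos (2 * τ * θ) * sinhPow θ w
      = Complex.Gamma (1 - 2 * w) * gammaPair τ w * Complex.sin (Real.pi * w)
        * Complex.cosh (Real.pi * τ) / (2 * Real.pi) := by
  have e : ∀ θ : ℝ, Complex.cos (2 * τ * θ) * sinhPow θ w
      = (1 / 2 : ℂ) * (Complex.exp (2 * τ * θ * Complex.I) * sinhPow θ w
        + Complex.exp (2 * (-τ : ℝ) * θ * Complex.I) * sinhPow θ w) := by
    intro θ
    rw [Complex.cos]
    push_cast
    rw [show -(2 * (τ : ℂ) * θ) * Complex.I = 2 * -(τ : ℂ) * θ * Complex.I by ring]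
    ring
  simp_rw [e]
  rw [integral_const_mul, integral_add (integrableOn_exp_mul_sinhPow h0 h1 τ)
    (integrableOn_exp_mul_sinhPow h0 h1 (-τ)), integral_exp_mul_sinhPow h0 h1,
    integral_exp_mul_sinhPow h0 h1, gammaPair_neg]
  have t1 : Complex.sin (Real.pi * (w + τ * Complex.I)) + Complex.sin (Real.pi * (w + (-τ : ℝ) * Complex.I))
      = 2 * Complex.sin (Real.pi * w) * Complex.cosh (Real.pi * τ) := by
    rw [show (Real.pi * (w + τ * Complex.I) : ℂ) = Real.pi * w + (Real.pi * τ) * Complex.I by ring,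
      show (Real.pi * (w + (-τ : ℝ) * Complex.I) : ℂ) = Real.pi * w - (Real.pi * τ) * Complex.I by
        push_cast; ring, Complex.sin_add, Complex.sin_sub, Complex.cos_mul_I]
    ring
  linear_combination (Complex.Gamma (1 - 2 * w) * gammaPair τ w / (4 * Real.pi)) * t1

lemma integral_sin_mul_sinhPow {w : ℂ} (h0 : 0 < w.re) (h1 : w.re < 1 / 2) (τ : ℝ) :
    ∫ θ in Ioi (0 : ℝ), Complex.sin (2 * τ * θ) * sinhPow θ w
      = Complex.Gamma (1 - 2 * w) * gammaPair τ w * Complex.cos (Real.pi * w)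
        * Complex.sinh (Real.pi * τ) / (2 * Real.pi) := by
  have e : ∀ θ : ℝ, Complex.sin (2 * τ * θ) * sinhPow θ w
      = (Complex.I / 2 : ℂ) * (Complex.exp (2 * (-τ : ℝ) * θ * Complex.I) * sinhPow θ w
        - Complex.exp (2 * τ * θ * Complex.I) * sinhPow θ w) := by
    intro θ
    rw [Complex.sin]
    push_cast
    rw [show -(2 * (τ : ℂ) * θ) * Complex.I = 2 * -(τ : ℂ) * θ * Complex.I by ring]
    ring
  simp_rw [e]
  rw [integral_const_mul, integral_sub (integrableOn_exp_mul_sinhPow h0 h1 (-τ))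
    (integrableOn_exp_mul_sinhPow h0 h1 τ), integral_exp_mul_sinhPow h0 h1,
    integral_exp_mul_sinhPow h0 h1, gammaPair_neg]
  have t1 : Complex.sin (Real.pi * (w + (-τ : ℝ) * Complex.I)) - Complex.sin (Real.pi * (w + τ * Complex.I))
      = -2 * Complex.cos (Real.pi * w) * (Complex.sinh (Real.pi * τ) * Complex.I) := by
    rw [show (Real.pi * (w + τ * Complex.I) : ℂ) = Real.pi * w + (Real.pi * τ) * Complex.I by ring,
      show (Real.pi * (w + (-τ : ℝ) * Complex.I) : ℂ) = Real.pi * w - (Real.pi * τ) * Complex.I by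
        push_cast; ring, Complex.sin_add, Complex.sin_sub, Complex.sin_mul_I]
    ring
  linear_combination (Complex.Gamma (1 - 2 * w) * gammaPair τ w * Complex.I / (4 * Real.pi)) * t1
    - (Complex.Gamma (1 - 2 * w) * gammaPair τ w * Complex.cos (Real.pi * w)
        * Complex.sinh (Real.pi * τ) / (2 * Real.pi)) * Complex.I_mul_I

lemma integrableOn_sinhPow {w : ℂ} (h0 : 0 < w.re) (h1 : w.re < 1 / 2) :
    IntegrableOn (fun θ : ℝ => sinhPow θ w) (Ioi 0) := by
  simpa using integrableOn_exp_mul_sinhPow h0 h1 0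

lemma coth_le {θ : ℝ} (hθ : 0 < θ) : θ * (Real.cosh θ / Real.sinh θ) ≤ 1 + θ := by
  have hs := Real.sinh_pos_iff.2 hθ
  rw [← mul_div_assoc, div_le_iff₀ hs]
  have h1 : Real.cosh θ - Real.sinh θ = Real.exp (-θ) := Real.cosh_sub_sinh θ
  have h2 : Real.exp (-θ) ≤ 1 := Real.exp_le_one_iff.2 (by linarith)
  have h3 : θ ≤ Real.sinh θ := Real.self_le_sinh_iff.2 hθ.le
  nlinarith

lemma abs_sin_mul_coth_le {θ : ℝ} (hθ : 0 < θ) (τ : ℝ) :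
    |Real.sin (2 * τ * θ)| * (Real.cosh θ / Real.sinh θ) ≤ 2 * |τ| + 1 := by
  have hs := Real.sinh_pos_iff.2 hθ
  have hc := Real.cosh_pos θ
  have h1 : |Real.sin (2 * τ * θ)| ≤ 2 * |τ| * θ := by
    refine Real.abs_sin_le_abs.trans ?_
    rw [abs_mul, abs_mul, abs_of_pos hθ]; norm_num
  have h2 := Real.abs_sin_le_one (2 * τ * θ)
  have h3 := coth_le hθ
  set k := Real.cosh θ / Real.sinh θ with hk
  have hk0 : 0 < k := by positivity
  -- `θ coth θ ≤ 1 + θ`, so `coth θ ≤ 1 + 1/θ`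
  have h4 : |Real.sin (2 * τ * θ)| * (θ * k) ≤ |Real.sin (2 * τ * θ)| * (1 + θ) := by gcongr
  have h5 : |Real.sin (2 * τ * θ)| * (1 + θ) ≤ 2 * |τ| * θ + θ := by nlinarith
  have h6 : θ * (|Real.sin (2 * τ * θ)| * k) ≤ θ * (2 * |τ| + 1) := by linarith
  exact le_of_mul_le_mul_left h6 hθ

lemma hasDerivAt_sinhPow {θ : ℝ} (hθ : 0 < θ) (w : ℂ) :
    HasDerivAt (fun θ : ℝ => sinhPow θ w)
      (-2 * w * ((Real.cosh θ / Real.sinh θ : ℝ) : ℂ) * sinhPow θ w) θ := by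
  have hs := Real.sinh_pos_iff.2 hθ
  have h1 : HasDerivAt (fun θ : ℝ => ((2 * Real.sinh θ : ℝ) : ℂ)) ((2 * Real.cosh θ : ℝ) : ℂ) θ :=
    ((Real.hasDerivAt_sinh θ).const_mul 2).ofReal_comp
  have hsl : ((2 * Real.sinh θ : ℝ) : ℂ) ∈ Complex.slitPlane := by
    rw [Complex.ofReal_mem_slitPlane]; linarith
  have h2 := HasDerivAt.scomp (h := fun θ : ℝ => ((2 * Real.sinh θ : ℝ) : ℂ)) θ
    ((hasDerivAt_id (((2 * Real.sinh θ : ℝ) : ℂ))).cpow_const (c := -2 * w) hsl) h1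
  refine h2.congr_deriv ?_
  simp only [id, smul_eq_mul, mul_one]
  have hn : ((2 * Real.sinh θ : ℝ) : ℂ) ≠ 0 := by
    have : 2 * Real.sinh θ ≠ 0 := by linarith
    exact_mod_cast this
  rw [sinhPow, Complex.cpow_sub _ _ hn, Complex.cpow_one]
  have hsn : (Real.sinh θ : ℂ) ≠ 0 := by exact_mod_cast hs.ne'
  push_cast at hsn ⊢
  field_simp

lemma continuousOn_sinhPow (w : ℂ) : ContinuousOn (fun θ : ℝ => sinhPow θ w) (Ioi 0) :=
  fun _ hθ => (hasDerivAt_sinhPow hθ w).continuousAt.continuousWithinAt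

lemma continuousOn_coth : ContinuousOn (fun θ : ℝ => Real.cosh θ / Real.sinh θ) (Ioi 0) :=
  Real.continuous_cosh.continuousOn.div Real.continuous_sinh.continuousOn
    fun _ hθ => (Real.sinh_pos_iff.2 hθ).ne'

lemma integrableOn_sin_mul_coth_mul_sinhPow {w : ℂ} (h0 : 0 < w.re) (h1 : w.re < 1 / 2) (τ : ℝ) :
    IntegrableOn (fun θ : ℝ => ((Real.sin (2 * τ * θ) * (Real.cosh θ / Real.sinh θ) : ℝ) : ℂ)
      * sinhPow θ w) (Ioi 0) := by
  refine Integrable.mono' (((integrableOn_sinhPow h0 h1).norm).const_mul (2 * |τ| + 1)) ?_ ?_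
  · refine ContinuousOn.aestronglyMeasurable ?_ measurableSet_Ioi
    refine ContinuousOn.mul ?_ (continuousOn_sinhPow w)
    exact Complex.continuous_ofReal.comp_continuousOn
      ((by fun_prop : Continuous fun θ : ℝ => Real.sin (2 * τ * θ)).continuousOn.mul continuousOn_coth)
  · refine (ae_restrict_iff' measurableSet_Ioi).2 (Eventually.of_forall fun θ hθ => ?_)
    have hs := Real.sinh_pos_iff.2 (mem_Ioi.1 hθ)
    have hc := Real.cosh_pos θ
    rw [norm_mul, Complex.norm_real, Real.norm_eq_abs, abs_mul,
      abs_of_pos (show 0 < Real.cosh θ / Real.sinh θ by positivity)]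
    gcongr
    exact abs_sin_mul_coth_le hθ τ

/-- Integration by parts: up to the factor `-2w`, `coth θ · sinhPow θ w` is the derivative of
`sinhPow θ w`. -/
lemma integral_sin_mul_coth_mul_sinhPow {w : ℂ} (h0 : 0 < w.re) (h1 : w.re < 1 / 2) (τ : ℝ) :
    2 * w * ∫ θ in Ioi (0 : ℝ), ((Real.sin (2 * τ * θ) * (Real.cosh θ / Real.sinh θ) : ℝ) : ℂ)
      * sinhPow θ w
    = 2 * τ * (Complex.Gamma (1 - 2 * w) * gammaPair τ w * Complex.sin (Real.pi * w)
        * Complex.cosh (Real.pi * τ) / (2 * Real.pi)) := by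
  rw [← integral_cos_mul_sinhPow h0 h1 τ]
  set F : ℝ → ℂ := fun θ => Complex.sin (2 * τ * θ) * sinhPow θ w with hF
  have hcosI : IntegrableOn (fun θ : ℝ => Complex.cos (2 * τ * θ) * sinhPow θ w) (Ioi 0) := by
    refine Integrable.mono' (integrableOn_sinhPow h0 h1).norm ?_ ?_
    · exact ((by fun_prop : Continuous fun θ : ℝ => Complex.cos (2 * τ * θ)).continuousOn.mul
        (continuousOn_sinhPow w)).aestronglyMeasurable measurableSet_Ioi
    · refine Eventually.of_forall fun θ => ?_
      rw [norm_mul]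
      refine mul_le_of_le_one_left (norm_nonneg _) ?_
      rw [show (2 * τ * θ : ℂ) = ((2 * τ * θ : ℝ) : ℂ) by push_cast; ring, ← Complex.ofReal_cos,
        Complex.norm_real]
      exact Real.abs_cos_le_one _
  have hsinI := integrableOn_sin_mul_coth_mul_sinhPow h0 h1 τ
  have hd : ∀ θ ∈ Ioi (0 : ℝ), HasDerivAt F (2 * τ * (Complex.cos (2 * τ * θ) * sinhPow θ w)
      - 2 * w * (((Real.sin (2 * τ * θ) * (Real.cosh θ / Real.sinh θ) : ℝ) : ℂ) * sinhPow θ w)) θ := by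
    intro θ hθ
    have d1 : HasDerivAt (fun θ : ℝ => (2 * τ * θ : ℂ)) (2 * τ) θ := by
      simpa using (Complex.ofRealCLM.hasDerivAt (x := θ)).const_mul (2 * τ : ℂ)
    have d2 := (HasDerivAt.scomp θ (Complex.hasDerivAt_sin _) d1).mul (hasDerivAt_sinhPow (mem_Ioi.1 hθ) w)
    refine d2.congr_deriv ?_
    simp only [smul_eq_mul, Function.comp_apply]
    push_cast
    ring
  have hbound : ∀ θ ∈ Ioi (0 : ℝ), ‖F θ‖ ≤ |Real.sin (2 * τ * θ)| * (2 * Real.sinh θ) ^ (-2 * w.re) := by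
    intro θ hθ
    simp only [hF]
    rw [norm_mul, norm_sinhPow hθ, show (2 * τ * θ : ℂ) = ((2 * τ * θ : ℝ) : ℂ) by push_cast; ring,
      ← Complex.ofReal_sin, Complex.norm_real, Real.norm_eq_abs]
  have hneg : -2 * w.re < 0 := by linarith
  have hF0 : F 0 = 0 := by simp [hF]
  have hc0 : ContinuousWithinAt F (Ici 0) 0 := by
    have : Tendsto F (𝓝[>] 0) (𝓝 0) := by
      have hp : Tendsto (fun θ : ℝ => 2 * |τ| * θ ^ (1 + -2 * w.re)) (𝓝[>] 0) (𝓝 0) := by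
        have h3 : 0 < 1 + -2 * w.re := by linarith
        have := ((Real.continuousAt_rpow_const (0 : ℝ) _ (Or.inr h3.le)).tendsto.mono_left
          (nhdsWithin_le_nhds (s := Ioi (0 : ℝ)))).const_mul (2 * |τ|)
        rwa [Real.zero_rpow h3.ne', mul_zero] at this
      refine squeeze_zero_norm' ?_ hp
      filter_upwards [self_mem_nhdsWithin] with θ hθ
      have hθ' : 0 < θ := hθ
      have h3 : |Real.sin (2 * τ * θ)| ≤ 2 * |τ| * θ := by
        refine Real.abs_sin_le_abs.trans ?_
        rw [abs_mul, abs_mul, abs_of_pos hθ']; norm_num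
      have h4 : (2 * Real.sinh θ) ^ (-2 * w.re) ≤ θ ^ (-2 * w.re) := by
        refine Real.rpow_le_rpow_of_nonpos hθ' ?_ hneg.le
        have := Real.self_le_sinh_iff.2 hθ'.le
        linarith
      refine (hbound θ hθ).trans ?_
      rw [Real.rpow_add hθ', Real.rpow_one, ← mul_assoc]
      gcongr
    rw [← continuousWithinAt_Ioi_iff_Ici]
    simpa [ContinuousWithinAt, hF0] using this
  have hinf : Tendsto F atTop (𝓝 0) := by
    have hp : Tendsto (fun θ : ℝ => θ ^ (-2 * w.re)) atTop (𝓝 0) := by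
      simpa using tendsto_rpow_neg_atTop (y := 2 * w.re) (by linarith)
    refine squeeze_zero_norm' ?_ hp
    filter_upwards [eventually_gt_atTop 0] with θ hθ
    refine (hbound θ hθ).trans ?_
    have h4 : (2 * Real.sinh θ) ^ (-2 * w.re) ≤ θ ^ (-2 * w.re) := by
      refine Real.rpow_le_rpow_of_nonpos hθ ?_ hneg.le
      have := Real.self_le_sinh_iff.2 hθ.le
      linarith
    exact (mul_le_of_le_one_left (by positivity) (Real.abs_sin_le_one _)).trans h4
  have key := integral_Ioi_of_hasDerivAt_of_tendsto hc0 hd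
    ((hcosI.const_mul _).sub (hsinI.const_mul _)) hinf
  rw [hF0, sub_zero, integral_sub (hcosI.const_mul _) (hsinI.const_mul _), integral_const_mul,
    integral_const_mul] at key
  linear_combination -key

/-! ### The sine representation of the kernel -/

lemma Gamma_one_add_mul_Gamma_one_sub {w : ℂ} (h0 : w ≠ 0) :
    Complex.Gamma (1 + w) * Complex.Gamma (1 - w) = Real.pi * w / Complex.sin (Real.pi * w) := by
  rw [add_comm, Complex.Gamma_add_one w h0, mul_assoc, Complex.Gamma_mul_Gamma_one_sub]
  ring

/-- The Mellin transform of `weberProfile α`. -/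
noncomputable def profileMellin (α : ℝ) (w : ℂ) : ℂ :=
  Complex.Gamma (1 + w) * Complex.Gamma (1 - w) * Complex.Gamma (w + α) / Complex.Gamma (1 + α - w)

lemma differentiableAt_profileMellin {α : ℝ} {z : ℂ} (h1 : -α < z.re) (h2 : -1 < z.re)
    (h3 : z.re < 1) : DifferentiableAt ℂ (profileMellin α) z := by
  unfold profileMellin
  simp only [div_eq_mul_inv]
  exact (((differentiableAt_Gamma_comp (by fun_prop) (by simp; linarith)).mul
    (differentiableAt_Gamma_comp (by fun_prop) (by simp; linarith))).mul
    (differentiableAt_Gamma_comp (by fun_prop) (by simp; linarith))).mul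
    (differentiableAt_inv_Gamma_comp (by fun_prop))

lemma exists_norm_profileMellin_le {α a b : ℝ} (ha : -α < a) (ha' : -1 < a) (hb : b < 1) :
    ∃ C : ℝ, 0 ≤ C ∧ ∀ z : ℂ, a ≤ z.re → z.re ≤ b →
      ‖profileMellin α z‖ ≤ C * Real.exp (-(Real.pi / 2) * |z.im|) := by
  obtain ⟨C1, h1, b1⟩ := exists_norm_Gamma_le_of_pos (A := 1 + a) (B := 1 + b) (by linarith)
  obtain ⟨C2, h2, b2⟩ := exists_norm_Gamma_le_of_pos (A := 1 - b) (B := 1 - a) (by linarith)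
  obtain ⟨C3, h3, b3⟩ := exists_norm_Gamma_le_of_pos (A := a + α) (B := b + α) (by linarith)
  obtain ⟨C4, h4, b4⟩ := exists_norm_inv_Gamma_le (1 + α - b) (1 + α - a)
  refine ⟨C1 * C2 * C3 * C4, by positivity, fun z hza hzb => ?_⟩
  have r1 := b1 (1 + z) (by simpa using hza) (by simpa using hzb)
  have r2 := b2 (1 - z) (by simp; linarith) (by simp; linarith)
  have r3 := b3 (z + α) (by simpa using hza) (by simpa using hzb)
  have r4 := b4 (1 + α - z) (by simp; linarith) (by simp; linarith)
  rw [show |(1 + z).im| = |z.im| by simp] at r1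
  rw [show |(1 - z).im| = |z.im| by simp] at r2
  rw [show |(z + α).im| = |z.im| by simp] at r3
  rw [show |(1 + α - z).im| = |z.im| by simp] at r4
  rw [profileMellin, div_eq_mul_inv, norm_mul, norm_mul, norm_mul]
  calc _ ≤ (C1 * Real.exp (-gammaRate * |z.im|)) * (C2 * Real.exp (-gammaRate * |z.im|))
        * (C3 * Real.exp (-gammaRate * |z.im|))
        * (C4 * Real.exp ((Real.pi - gammaRate) * |z.im|)) := by gcongr
    _ = C1 * C2 * C3 * C4 * Real.exp (-gammaRate * |z.im| + -gammaRate * |z.im|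
        + -gammaRate * |z.im| + (Real.pi - gammaRate) * |z.im|) := by
        simp only [Real.exp_add]; ring
    _ = _ := by
        congr 2
        rw [gammaRate]; ring

lemma integrable_profileMellin {α σ : ℝ} (h1 : -α < σ) (h2 : -1 < σ) (h3 : σ < 1) :
    Integrable (fun t : ℝ => profileMellin α (σ + t * Complex.I)) := by
  obtain ⟨C, _, hC⟩ := exists_norm_profileMellin_le (α := α) h1 h2 h3
  exact integrable_vertical (C := C) (c := Real.pi / 2) (T := 0) (a := σ) (b := σ) (by positivity)
    (fun z hz => (differentiableAt_profileMellin (by linarith [hz.1]) (by linarith [hz.1])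
      (by linarith [hz.2])).continuousAt.continuousWithinAt)
    (fun z hz1 hz2 _ => hC z hz1 hz2) le_rfl le_rfl

lemma continuous_profileMellin {α σ : ℝ} (h1 : -α < σ) (h2 : -1 < σ) (h3 : σ < 1) :
    Continuous (fun t : ℝ => profileMellin α (σ + t * Complex.I)) :=
  continuous_comp_vertical (a := σ) (b := σ)
    (fun z hz => (differentiableAt_profileMellin (by linarith [hz.1]) (by linarith [hz.1])
      (by linarith [hz.2])).continuousAt.continuousWithinAt) le_rfl le_rfl

/-- The inverse Mellin transform of `profileMellin α`. The kernel is recovered from it by a sine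
transform, see `mul_weberKernel_eq`. -/
noncomputable def weberProfile (α u : ℝ) : ℂ := mellinInv 0 (profileMellin α) u

/-- The contour of the inverse Mellin transform can be moved within the strip where `profileMellin α` is
analytic. -/
lemma weberProfile_eq {α σ u : ℝ} (hα : 0 < α) (h1 : -α < σ) (h2 : -1 < σ) (h3 : σ < 1)
    (hu : 0 < u) : weberProfile α u = mellinInv σ (profileMellin α) u := by
  have hshift : ∀ p q : ℝ, -α < p → -1 < p → p ≤ q → q < 1 →
      mellinInv p (profileMellin α) u = mellinInv q (profileMellin α) u := by
    intro p q hp hp' hpq hq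
    obtain ⟨C1, c1, b1⟩ := exists_norm_profileMellin_le (α := α) (a := p) (b := q) hp hp' hq
    obtain ⟨C3, c3, b3⟩ := exists_rpow_bound hu p q
    have hd : ∀ z : ℂ, p ≤ z.re → z.re ≤ q →
        DifferentiableAt ℂ (fun z : ℂ => (u : ℂ) ^ (-z) * profileMellin α z) z := by
      intro z hz1 hz2
      refine DifferentiableAt.mul ?_
        (differentiableAt_profileMellin (by linarith) (by linarith) (by linarith))
      exact (by fun_prop : DifferentiableAt ℂ (fun z : ℂ => -z) z).const_cpow
        (Or.inl (by exact_mod_cast hu.ne'))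
    unfold mellinInv
    congr 1
    refine integral_vertical_eq (g := fun z : ℂ => (u : ℂ) ^ (-z) * profileMellin α z)
      (C := C3 * C1) (c := Real.pi / 2) (T := 0) hpq (by positivity)
      (fun z hz => (hd z hz.1 hz.2).continuousAt.continuousWithinAt) countable_empty
      (fun z hz1 hz2 _ => hd z hz1.le hz2.le) fun z hz1 hz2 _ => ?_
    rw [norm_mul, mul_assoc]
    gcongr
    · exact b3 z hz1 hz2
    · exact b1 z hz1 hz2
  rcases le_total 0 σ with h | h
  · exact hshift 0 σ (by linarith) (by norm_num) h h3
  · exact (hshift σ 0 h1 h2 h (by norm_num)).symm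

lemma exists_norm_weberProfile_le {α σ : ℝ} (hα : 0 < α) (h1 : -α < σ) (h2 : -1 < σ) (h3 : σ < 1) :
    ∃ C : ℝ, 0 ≤ C ∧ ∀ u : ℝ, 0 < u → ‖weberProfile α u‖ ≤ C * u ^ (-σ) := by
  refine ⟨(1 / (2 * Real.pi)) * ∫ t : ℝ, ‖profileMellin α (σ + t * Complex.I)‖,
    mul_nonneg (by positivity) (integral_nonneg fun _ => norm_nonneg _), fun u hu => ?_⟩
  rw [weberProfile_eq hα h1 h2 h3 hu, mellinInv, norm_smul, Real.norm_of_nonneg (by positivity),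
    mul_assoc, ← integral_mul_const]
  gcongr
  refine (norm_integral_le_integral_norm _).trans (le_of_eq ?_)
  refine integral_congr_ae (Eventually.of_forall fun t => ?_)
  simp only [smul_eq_mul, norm_mul]
  rw [Complex.norm_cpow_eq_rpow_re_of_pos hu, mul_comm]
  simp

lemma continuousOn_mellinInv {M : ℂ → ℂ} {σ : ℝ}
    (hM : Integrable (fun t : ℝ => M (σ + t * Complex.I))) :
    ContinuousOn (mellinInv σ M) (Ioi 0) := by
  intro u hu
  refine ContinuousAt.continuousWithinAt ?_
  have hu' : 0 < u := hu
  unfold mellinInv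
  refine ContinuousAt.const_smul ?_ _
  simp only [smul_eq_mul]
  have hcont : ContinuousAt (fun y : ℝ => y ^ (-σ)) u :=
    Real.continuousAt_rpow_const _ _ (Or.inl hu'.ne')
  have hev : ∀ᶠ y : ℝ in 𝓝 u, y ^ (-σ) < u ^ (-σ) + 1 :=
    hcont.eventually (gt_mem_nhds (lt_add_one _))
  have hpos : ∀ᶠ y : ℝ in 𝓝 u, 0 < y := lt_mem_nhds hu'
  refine continuousAt_of_dominated
    (bound := fun t => (u ^ (-σ) + 1) * ‖M (σ + t * Complex.I)‖) ?_ ?_ (hM.norm.const_mul _) ?_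
  · filter_upwards [hpos] with y hy
    refine AEStronglyMeasurable.mul (Continuous.aestronglyMeasurable ?_) hM.1
    exact Continuous.const_cpow (by fun_prop) (Or.inl (by exact_mod_cast hy.ne'))
  · filter_upwards [hev, hpos] with y hy hy0
    refine Eventually.of_forall fun t => ?_
    rw [norm_mul, Complex.norm_cpow_eq_rpow_re_of_pos hy0]
    gcongr
    simpa using hy.le
  · refine Eventually.of_forall fun t => ContinuousAt.mul ?_ continuousAt_const
    exact (continuousAt_cpow_const (by simpa using hu')).comp
      (Complex.continuous_ofReal.continuousAt)

lemma continuousOn_weberProfile {α : ℝ} (hα : 0 < α) : ContinuousOn (weberProfile α) (Ioi 0) := by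
  have h := integrable_profileMellin (α := α) (σ := 0) (by linarith) (by norm_num) (by norm_num)
  exact continuousOn_mellinInv h

/-- Mellin convergence, after the substitution `x = e^{-u}` that turns Mellin into Fourier
transforms. -/
lemma integrable_exp_smul_comp_exp_neg {h : ℝ → ℂ} {σ : ℝ} (hm : MellinConvergent h σ) :
    Integrable fun u : ℝ => Real.exp (-σ * u) • h (Real.exp (-u)) := by
  have himg : (fun u : ℝ => Real.exp (-u)) '' univ = Ioi 0 := by
    rw [image_univ, ← Real.range_exp]
    exact neg_surjective.range_comp Real.exp
  rw [MellinConvergent, ← himg, integrableOn_image_iff_integrableOn_abs_deriv_smul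
    (f' := fun u => -Real.exp (-u)) MeasurableSet.univ (fun u _ =>
      (((hasDerivAt_neg u).exp).congr_deriv (by simp)).hasDerivWithinAt)
    (fun a _ b _ h => neg_injective (Real.exp_injective h)), integrableOn_univ] at hm
  refine hm.congr (Eventually.of_forall fun u => ?_)
  simp only
  rw [abs_neg, abs_of_pos (Real.exp_pos _), Complex.real_smul, Complex.real_smul,
    smul_eq_mul, ← mul_assoc]
  congr 1
  rw [show ((σ : ℂ) - 1) = ((σ - 1 : ℝ) : ℂ) by push_cast; rfl,
    ← Complex.ofReal_cpow (Real.exp_pos _).le, ← Complex.ofReal_mul, ← Real.exp_mul,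
    ← Real.exp_add]
  ring_nf

open scoped FourierTransform in
/-- Mellin inversion, in the direction that starts from the transform. -/
lemma mellin_mellinInv_eq {M : ℂ → ℂ} {σ : ℝ}
    (hM : Integrable (fun t : ℝ => M (σ + t * Complex.I)))
    (hc : Continuous (fun t : ℝ => M (σ + t * Complex.I)))
    (hm : MellinConvergent (mellinInv σ M) σ) (t : ℝ) :
    mellin (mellinInv σ M) (σ + t * Complex.I) = M (σ + t * Complex.I) := by
  set G : ℝ → ℂ := fun y => M (σ + 2 * Real.pi * y * Complex.I) with hG
  have h2π : (2 * Real.pi : ℝ) ≠ 0 := by positivity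
  have hGi : Integrable G := by
    have := hM.comp_mul_left' h2π
    simpa [hG] using this
  have hGc : Continuous G := by
    have := hc.comp (continuous_const_mul (2 * Real.pi))
    simpa [hG, Function.comp_def] using this
  have hin : ∀ u : ℝ, Real.exp (-σ * u) • mellinInv σ M (Real.exp (-u)) = 𝓕⁻ G u := by
    intro u
    rw [mellinInv_eq_fourierInv σ M (Real.exp_pos _), Real.log_exp, neg_neg, Complex.real_smul,
      smul_eq_mul, ← mul_assoc]
    convert one_mul _ using 2
    rw [show (-σ : ℂ) = ((-σ : ℝ) : ℂ) by push_cast; rfl, ← Complex.ofReal_cpow (Real.exp_pos _).le,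
      ← Complex.ofReal_mul, ← Real.exp_mul, ← Real.exp_add]
    ring_nf
    simp
  have hinvI : Integrable (𝓕⁻ G) :=
    (integrable_exp_smul_comp_exp_neg hm).congr (Eventually.of_forall hin)
  have hFI : Integrable (𝓕 G) := by
    have : 𝓕 G = fun v => 𝓕⁻ G (-v) := by
      funext v
      rw [Real.fourierInv_eq_fourier_neg, neg_neg]
    rw [this]
    exact hinvI.comp_neg
  rw [mellin_eq_fourier]
  have e : (fun u : ℝ => Real.exp (-((σ : ℂ) + t * Complex.I).re * u) • mellinInv σ M (Real.exp (-u)))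
      = 𝓕⁻ G := by
    funext u
    rw [← hin u]; simp
  rw [e, hGi.fourier_fourierInv_eq hFI hGc.continuousAt]
  simp only [hG]
  congr 2
  simp
  have : (Real.pi : ℂ) ≠ 0 := by exact_mod_cast Real.pi_ne_zero
  field_simp

lemma image_mul_sinh_sq {x : ℝ} (hx : 0 < x) : (fun θ => x * Real.sinh θ ^ 2) '' Ioi 0 = Ioi 0 := by
  ext u
  constructor
  · rintro ⟨θ, hθ, rfl⟩
    have := Real.sinh_pos_iff.2 (mem_Ioi.1 hθ)
    exact mem_Ioi.2 (by positivity)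
  · intro hu
    have hu' : 0 < u := hu
    refine ⟨Real.arsinh (Real.sqrt (u / x)), Real.arsinh_pos_iff.2 (by positivity), ?_⟩
    simp only [Real.sinh_arsinh]
    rw [Real.sq_sqrt (by positivity)]
    field_simp

lemma hasDerivAt_mul_sinh_sq (x θ : ℝ) : HasDerivAt (fun θ => x * Real.sinh θ ^ 2)
    (2 * x * Real.sinh θ * Real.cosh θ) θ :=
  (((Real.hasDerivAt_sinh θ).pow 2).const_mul x).congr_deriv (by simp; ring)

lemma injOn_mul_sinh_sq {x : ℝ} (hx : 0 < x) : InjOn (fun θ => x * Real.sinh θ ^ 2) (Ioi 0) := by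
  intro a ha b hb h
  have h1 := Real.sinh_pos_iff.2 (mem_Ioi.1 ha)
  have h2 := Real.sinh_pos_iff.2 (mem_Ioi.1 hb)
  have h3 : Real.sinh a ^ 2 = Real.sinh b ^ 2 := mul_left_cancel₀ hx.ne' h
  exact Real.sinh_injective ((sq_eq_sq₀ h1.le h2.le).1 h3)

lemma abs_deriv_mul_sinh_sq_smul {x θ : ℝ} (hx : 0 < x) (hθ : 0 < θ) (k : ℝ → ℂ) :
    |2 * x * Real.sinh θ * Real.cosh θ| •
      (((x * Real.sinh θ ^ 2 : ℝ) : ℂ)⁻¹ * k (x * Real.sinh θ ^ 2))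
      = 2 * (((Real.cosh θ / Real.sinh θ : ℝ) : ℂ) * k (x * Real.sinh θ ^ 2)) := by
  have h1 := Real.sinh_pos_iff.2 hθ
  have h2 := Real.cosh_pos θ
  rw [abs_of_pos (by positivity), Complex.real_smul]
  have h1' : (Real.sinh θ : ℂ) ≠ 0 := by exact_mod_cast h1.ne'
  have hx' : (x : ℂ) ≠ 0 := by exact_mod_cast hx.ne'
  push_cast at h1' ⊢
  field_simp

lemma integrableOn_coth_mul_comp_iff {x : ℝ} (hx : 0 < x) (k : ℝ → ℂ) :
    IntegrableOn (fun θ => ((Real.cosh θ / Real.sinh θ : ℝ) : ℂ) * k (x * Real.sinh θ ^ 2)) (Ioi 0)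
      ↔ IntegrableOn (fun u : ℝ => (u : ℂ)⁻¹ * k u) (Ioi 0) := by
  conv_rhs => rw [← image_mul_sinh_sq hx, integrableOn_image_iff_integrableOn_abs_deriv_smul
    measurableSet_Ioi (fun θ _ => (hasDerivAt_mul_sinh_sq x θ).hasDerivWithinAt)
    (injOn_mul_sinh_sq hx),
    integrableOn_congr_fun (fun θ (hθ : θ ∈ Ioi (0 : ℝ)) => abs_deriv_mul_sinh_sq_smul hx hθ k)
      measurableSet_Ioi]
  exact (integrable_const_mul_iff (Ne.isUnit two_ne_zero) _).symm

/-- The substitution `u = x sinh² θ`, for which `du / u = 2 coth θ dθ`. -/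
lemma integral_coth_mul_comp {x : ℝ} (hx : 0 < x) (k : ℝ → ℂ) :
    ∫ θ in Ioi (0 : ℝ), ((Real.cosh θ / Real.sinh θ : ℝ) : ℂ) * k (x * Real.sinh θ ^ 2)
      = 1 / 2 * ∫ u in Ioi (0 : ℝ), (u : ℂ)⁻¹ * k u := by
  conv_rhs => rw [← image_mul_sinh_sq hx, integral_image_eq_integral_abs_deriv_smul
    measurableSet_Ioi (fun θ _ => (hasDerivAt_mul_sinh_sq x θ).hasDerivWithinAt)
    (injOn_mul_sinh_sq hx),
    setIntegral_congr_fun measurableSet_Ioi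
      (fun θ (hθ : θ ∈ Ioi (0 : ℝ)) => abs_deriv_mul_sinh_sq_smul hx hθ k), integral_const_mul]
  ring

lemma inv_four_cpow (w : ℂ) : ((4⁻¹ : ℝ) : ℂ) ^ w = (4 : ℂ) ^ (-w) := by
  push_cast
  rw [Complex.inv_cpow _ _ (by
    rw [show (4 : ℂ) = ((4 : ℝ) : ℂ) by norm_num, Complex.arg_ofReal_of_nonneg (by norm_num)]
    exact Real.pi_pos.ne), Complex.cpow_neg]

lemma sinhPow_eq {x θ : ℝ} (hx : 0 < x) (hθ : 0 < θ) (w : ℂ) :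
    (4 : ℂ) ^ w * (x : ℂ) ^ (-w) * sinhPow θ w = ((x * Real.sinh θ ^ 2 : ℝ) : ℂ) ^ (-w) := by
  have h1 := Real.sinh_pos_iff.2 hθ
  have e : x * Real.sinh θ ^ 2 = x * (2 * Real.sinh θ) * (2 * Real.sinh θ) * 4⁻¹ := by ring
  rw [e, Complex.ofReal_mul, Complex.mul_cpow_ofReal_nonneg (by positivity) (by norm_num),
    Complex.ofReal_mul, Complex.mul_cpow_ofReal_nonneg (by positivity) (by positivity),
    Complex.ofReal_mul x, Complex.mul_cpow_ofReal_nonneg hx.le (by positivity), sinhPow,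
    show -2 * w = -w + -w by ring, Complex.cpow_add _ _ (by
      have : 2 * Real.sinh θ ≠ 0 := by positivity
      exact_mod_cast this)]
  rw [inv_four_cpow, neg_neg]
  ring

lemma mellinConvergent_weberProfile {α : ℝ} (hα : 0 < α) {s : ℂ} (h1 : -α < s.re) (h2 : -1 < s.re)
    (h3 : s.re < 1) : MellinConvergent (weberProfile α) s := by
  obtain ⟨p, hp1, hp2⟩ := exists_between (max_lt h1 h2)
  obtain ⟨q, hq1, hq2⟩ := exists_between h3
  have hp3 := max_lt_iff.1 hp1
  obtain ⟨C1, _, b1⟩ := exists_norm_weberProfile_le (σ := p) hα hp3.1 hp3.2 (by linarith)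
  obtain ⟨C2, _, b2⟩ := exists_norm_weberProfile_le (σ := q) hα (by linarith) (by linarith) hq2
  refine mellinConvergent_of_isBigO_rpow (a := q) (b := p)
    ((continuousOn_weberProfile hα).locallyIntegrableOn measurableSet_Ioi) ?_ hq1 ?_ hp2
  · refine IsBigO.of_bound C2 ?_
    filter_upwards [eventually_gt_atTop 0] with u hu
    rw [Real.norm_of_nonneg (by positivity)]
    exact b2 u hu
  · refine IsBigO.of_bound C1 ?_
    filter_upwards [self_mem_nhdsWithin] with u hu
    rw [Real.norm_of_nonneg (Real.rpow_nonneg (mem_Ioi.1 hu).le _)]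
    exact b1 u hu

lemma mellin_weberProfile {α : ℝ} (hα : 0 < α) {σ : ℝ} (h1 : -α < σ) (h2 : -1 < σ)
    (h3 : σ < 1) (t : ℝ) :
    mellin (weberProfile α) (σ + t * Complex.I) = profileMellin α (σ + t * Complex.I) := by
  have he : ∀ u ∈ Ioi (0 : ℝ), weberProfile α u = mellinInv σ (profileMellin α) u := fun u hu =>
    weberProfile_eq hα h1 h2 h3 hu
  rw [← mellin_mellinInv_eq (integrable_profileMellin h1 h2 h3) (continuous_profileMellin h1 h2 h3)
    ?_ t]
  · refine setIntegral_congr_fun measurableSet_Ioi fun u hu => ?_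
    simp only [he u hu]
  · have := mellinConvergent_weberProfile hα (s := (σ : ℂ)) (by simpa) (by simpa) (by simpa)
    refine IntegrableOn.congr_fun this (fun u hu => ?_) measurableSet_Ioi
    simp only [he u hu]

lemma ContinuousOn.aestronglyMeasurable_prod {E : Type*} [NormedAddCommGroup E] {k : ℝ × ℝ → E}
    {s t : Set ℝ}
    (hs : MeasurableSet s) (ht : MeasurableSet t) (hk : ContinuousOn k (s ×ˢ t)) :
    AEStronglyMeasurable k ((volume.restrict s).prod (volume.restrict t)) := by
  rw [Measure.prod_restrict]
  exact hk.aestronglyMeasurable (hs.prod ht)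

/-- `sin (2 τ θ) coth θ`, which turns the profile into the kernel. -/
noncomputable def sinCoth (τ θ : ℝ) : ℝ := Real.sin (2 * τ * θ) * (Real.cosh θ / Real.sinh θ)

lemma abs_sinCoth_le {θ : ℝ} (hθ : 0 < θ) (τ : ℝ) : |sinCoth τ θ| ≤ 2 * |τ| + 1 := by
  have h1 := Real.sinh_pos_iff.2 hθ
  have h2 := Real.cosh_pos θ
  rw [sinCoth, abs_mul, abs_of_pos (show 0 < Real.cosh θ / Real.sinh θ by positivity)]
  exact abs_sin_mul_coth_le hθ τ

lemma continuousOn_sinCoth (τ : ℝ) : ContinuousOn (sinCoth τ) (Ioi 0) :=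
  ((by fun_prop : Continuous fun θ : ℝ => Real.sin (2 * τ * θ)).continuousOn.mul continuousOn_coth)

/-- The kernel is a sine transform, in `2θ`, of a function of the single variable `x sinh² θ`. -/
lemma mul_weberKernel_eq {α x τ : ℝ} (hα : 0 < α) (hx : 0 < x) (hτ : 0 < τ) :
    (τ * weberKernel α x τ : ℂ) = 2 / Real.pi ^ 2 * ∫ θ in Ioi (0 : ℝ),
      (sinCoth τ θ : ℂ) * weberProfile α (x * Real.sinh θ ^ 2) := by
  have hπ : (Real.pi : ℂ) ≠ 0 := by exact_mod_cast Real.pi_ne_zero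
  obtain ⟨σ, hσ⟩ : ∃ σ : ℝ, σ = 1 / 4 := ⟨_, rfl⟩
  set w : ℝ → ℂ := fun t => σ + t * Complex.I with hw
  have hwre : ∀ t, (w t).re = σ := fun t => by simp [hw]
  set k : ℝ × ℝ → ℂ := fun p => (profileMellin α (w p.1) * (sinCoth τ p.2 : ℂ))
      * ((x * Real.sinh p.2 ^ 2 : ℝ) : ℂ) ^ (-(w p.1)) with hk
  have hMc : Continuous fun t => profileMellin α (w t) :=
    continuous_profileMellin (by linarith) (by linarith) (by rw [hσ]; norm_num)
  have hMi : Integrable fun t => profileMellin α (w t) :=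
    integrable_profileMellin (by linarith) (by linarith) (by rw [hσ]; norm_num)
  have hnorm : ∀ t θ : ℝ, 0 < θ → ‖((x * Real.sinh θ ^ 2 : ℝ) : ℂ) ^ (-(w t))‖
      = (4 : ℝ) ^ σ * x ^ (-σ) * ‖sinhPow θ σ‖ := by
    intro t θ hθ
    rw [← sinhPow_eq hx hθ, norm_mul, norm_mul, norm_sinhPow hθ, norm_sinhPow hθ, hwre,
      Complex.norm_cpow_eq_rpow_re_of_pos hx, show (4 : ℂ) = ((4 : ℝ) : ℂ) by norm_num,
      Complex.norm_cpow_eq_rpow_re_of_pos (by norm_num), Complex.neg_re, hwre]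
    simp
  have hkm : AEStronglyMeasurable k (volume.prod (volume.restrict (Ioi (0 : ℝ)))) := by
    rw [← Measure.restrict_univ (μ := (volume : Measure ℝ)), Measure.restrict_restrict
      measurableSet_Ioi, inter_univ]
    refine ContinuousOn.aestronglyMeasurable_prod MeasurableSet.univ measurableSet_Ioi ?_
    have hmap : MapsTo (Prod.snd : ℝ × ℝ → ℝ) (univ ×ˢ Ioi 0) (Ioi 0) := fun p hp => hp.2
    refine ContinuousOn.mul (ContinuousOn.mul (hMc.comp continuous_fst).continuousOn
      (Complex.continuous_ofReal.comp_continuousOn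
        ((continuousOn_sinCoth τ).comp continuous_snd.continuousOn hmap))) ?_
    have hwc : Continuous w := by simp only [hw]; fun_prop
    refine ContinuousOn.cpow ?_ (hwc.comp continuous_fst).neg.continuousOn ?_
    · have : Continuous fun p : ℝ × ℝ => ((x * Real.sinh p.2 ^ 2 : ℝ) : ℂ) :=
        Complex.continuous_ofReal.comp
          (continuous_const.mul ((Real.continuous_sinh.comp continuous_snd).pow 2))
      exact this.continuousOn
    · intro p hp
      have := Real.sinh_pos_iff.2 (mem_Ioi.1 hp.2)
      rw [Complex.ofReal_mem_slitPlane]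
      positivity
  have hki : Integrable k (volume.prod (volume.restrict (Ioi (0 : ℝ)))) := by
    have hdom := Integrable.mul_prod (μ := volume) (ν := volume.restrict (Ioi (0 : ℝ))) hMi.norm
      ((integrableOn_sinhPow (w := σ) (by simp [hσ]) (by simp [hσ]; norm_num)).norm.const_mul
        ((2 * |τ| + 1) * ((4 : ℝ) ^ σ * x ^ (-σ))))
    refine Integrable.mono' hdom hkm ?_
    have hae : ∀ᵐ p : ℝ × ℝ ∂(volume.prod (volume.restrict (Ioi (0 : ℝ)))), 0 < p.2 :=
      Measure.quasiMeasurePreserving_snd.ae (ae_restrict_mem measurableSet_Ioi)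
    filter_upwards [hae] with p hp
    simp only [hk, norm_mul]
    rw [hnorm _ _ hp, Complex.norm_real, Real.norm_eq_abs]
    have := abs_sinCoth_le hp τ
    calc _ ≤ ‖profileMellin α (w p.1)‖ * (2 * |τ| + 1) * (4 ^ σ * x ^ (-σ) * ‖sinhPow p.2 σ‖) := by
          gcongr
      _ = _ := by ring
  have hpt : ∀ t : ℝ, τ * Complex.cosh (Real.pi * τ) * (gammaPair τ (w t) * kernelMellin α (w t)
        * (x : ℂ) ^ (-(w t))) = 2 * ∫ θ in Ioi (0 : ℝ), k (t, θ) := by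
    intro t
    have h0 : 0 < (w t).re := by rw [hwre, hσ]; norm_num
    have h1 : (w t).re < 1 / 2 := by rw [hwre, hσ]; norm_num
    have hne : w t ≠ 0 := fun h => by rw [h] at h0; simp at h0
    have hsin : Complex.sin (Real.pi * w t) ≠ 0 := sin_pi_mul_ne_zero_of_forall_ne_intCast
      (ne_intCast_of_abs_re_lt_one (by linarith) (by linarith) hne)
    have hI := integral_sin_mul_coth_mul_sinhPow h0 h1 τ
    have hG := Gamma_one_add_mul_Gamma_one_sub hne
    have e : ∫ θ in Ioi (0 : ℝ), k (t, θ) = profileMellin α (w t) * ((4 : ℂ) ^ w t * (x : ℂ) ^ (-w t))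
        * ∫ θ in Ioi (0 : ℝ), ((Real.sin (2 * τ * θ) * (Real.cosh θ / Real.sinh θ) : ℝ) : ℂ)
          * sinhPow θ (w t) := by
      rw [← integral_const_mul]
      refine setIntegral_congr_fun measurableSet_Ioi fun θ hθ => ?_
      simp only [hk, sinCoth]
      rw [← sinhPow_eq hx hθ]
      ring
    rw [e, profileMellin, kernelMellin, hG]
    set S := ∫ θ in Ioi (0 : ℝ), ((Real.sin (2 * τ * θ) * (Real.cosh θ / Real.sinh θ) : ℝ) : ℂ)
          * sinhPow θ (w t)
    have h : τ * Complex.cosh (Real.pi * τ) * gammaPair τ (w t) * Complex.Gamma (1 - 2 * w t)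
        = 2 * (Real.pi * w t / Complex.sin (Real.pi * w t)) * S := by
      clear_value S
      generalize w t = z at hI hsin
      generalize Complex.sin (Real.pi * z) = s at hI hsin
      generalize Complex.cosh (Real.pi * τ) = c at hI
      field_simp at hI ⊢
      linear_combination -hI
    linear_combination ((4 : ℂ) ^ w t * (x : ℂ) ^ (-w t) * Complex.Gamma (w t + α)
      / Complex.Gamma (1 + α - w t)) * h
  have hχ : ∀ θ ∈ Ioi (0 : ℝ), ∫ t : ℝ, k (t, θ)
      = 2 * Real.pi * ((sinCoth τ θ : ℂ) * weberProfile α (x * Real.sinh θ ^ 2)) := by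
    intro θ hθ
    have h1 := Real.sinh_pos_iff.2 (mem_Ioi.1 hθ)
    rw [weberProfile_eq (σ := σ) hα (by linarith) (by linarith) (by rw [hσ]; norm_num)
      (by positivity), mellinInv]
    have : ∀ t : ℝ, k (t, θ) = (sinCoth τ θ : ℂ) * (((x * Real.sinh θ ^ 2 : ℝ) : ℂ) ^ (-(w t))
      • profileMellin α (w t)) := fun t => by simp only [hk, smul_eq_mul]; ring
    simp_rw [this]
    rw [integral_const_mul, Complex.real_smul]
    push_cast
    field_simp
    simp only [hw]
  rw [weberKernel_eq_integral (σ := σ) hα hx hτ (by rw [hσ]; norm_num) (by rw [hσ]; norm_num)]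
  have hswap := integral_integral_swap (f := fun t θ => k (t, θ)) hki
  have hL : ∫ t : ℝ, τ * Complex.cosh (Real.pi * τ) * (gammaPair τ (w t) * kernelMellin α (w t)
        * (x : ℂ) ^ (-(w t))) = 2 * ∫ t : ℝ, ∫ θ in Ioi (0 : ℝ), k (t, θ) := by
    simp_rw [hpt]
    rw [integral_const_mul]
  rw [hswap, setIntegral_congr_fun measurableSet_Ioi hχ, integral_const_mul, integral_const_mul] at hL
  simp only [hw] at hL
  have e2 : (2 : ℂ) / Real.pi ^ 2 = 4 * Real.pi / (2 * Real.pi ^ 3) := by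
    field_simp
    norm_num
  rw [e2]
  linear_combination (1 / (2 * Real.pi ^ 3 : ℂ)) * hL

/-! ### Behaviour of the kernel at the origin -/

lemma exists_norm_besselSeries_sub_le (ν : ℂ) : ∃ C : ℝ, 0 ≤ C ∧ ∀ y : ℂ, ‖y‖ ≤ 1 →
    ‖besselSeries ν y - (Complex.Gamma (ν + 1))⁻¹‖ ≤ C * ‖y‖ := by
  set c : ℕ → ℂ := fun k => (k.factorial * Complex.Gamma (ν + k + 1))⁻¹ with hc
  have hterm : ∀ (y : ℂ) (k : ℕ),
      ‖(-1) ^ k * y ^ k / (k.factorial * Complex.Gamma (ν + k + 1))‖ = ‖y‖ ^ k * ‖c k‖ := by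
    intro y k
    rw [div_eq_mul_inv, norm_mul, norm_mul, norm_pow, norm_pow]; simp [hc]
  have h1 : Summable fun k => ‖c k‖ := by
    have := summable_norm_besselSeries ν 1
    simp only [hterm] at this
    simpa using this
  have h1' : Summable fun k => ‖c (k + 1)‖ := (summable_nat_add_iff 1).2 h1
  refine ⟨∑' k, ‖c (k + 1)‖, tsum_nonneg fun _ => norm_nonneg _, fun y hy => ?_⟩
  have hs := (summable_norm_besselSeries ν y).of_norm
  rw [besselSeries, hs.tsum_eq_zero_add]
  simp only [pow_zero, Nat.factorial_zero, Nat.cast_one, Nat.cast_zero, add_zero, one_mul, mul_one,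
    one_div, add_sub_cancel_left]
  rw [mul_comm, ← tsum_mul_left]
  refine tsum_of_norm_bounded (h1'.mul_left ‖y‖).hasSum fun k => ?_
  rw [hterm y (k + 1), pow_succ]
  have : ‖y‖ ^ k ≤ 1 := pow_le_one₀ (norm_nonneg _) hy
  calc ‖y‖ ^ k * ‖y‖ * ‖c (k + 1)‖ ≤ 1 * ‖y‖ * ‖c (k + 1)‖ := by gcongr
    _ = _ := by ring

lemma exists_norm_besselJ_mul_sub_le (ν l : ℂ) : ∃ C : ℝ, 0 ≤ C ∧ ∀ x : ℝ, 0 < x → x ≤ 1 →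
    ‖besselJ ν (Real.sqrt x) * besselJ l (Real.sqrt x) - ((x / 4 : ℝ) : ℂ) ^ ((ν + l) / 2)
      * ((Complex.Gamma (ν + 1))⁻¹ * (Complex.Gamma (l + 1))⁻¹)‖
      ≤ C * (x * (x / 4) ^ ((ν.re + l.re) / 2)) := by
  obtain ⟨C1, h1, b1⟩ := exists_norm_besselSeries_sub_le ν
  obtain ⟨C2, h2, b2⟩ := exists_norm_besselSeries_sub_le l
  set g1 := (Complex.Gamma (ν + 1))⁻¹
  set g2 := (Complex.Gamma (l + 1))⁻¹
  refine ⟨C1 * (C2 + ‖g2‖) + ‖g1‖ * C2, by positivity, fun x hx hx1 => ?_⟩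
  have hy : ‖((x / 4 : ℝ) : ℂ)‖ = x / 4 := by
    rw [Complex.norm_real, Real.norm_of_nonneg (by positivity)]
  have r1 := b1 (x / 4 : ℝ) (by rw [hy]; linarith)
  have r2 := b2 (x / 4 : ℝ) (by rw [hy]; linarith)
  rw [hy] at r1 r2
  have hS2 : ‖besselSeries l (x / 4 : ℝ)‖ ≤ C2 + ‖g2‖ := by
    have := norm_add_le (besselSeries l (x / 4 : ℝ) - g2) g2
    rw [sub_add_cancel] at this
    nlinarith
  rw [besselJ_sqrt_mul_eq ν l hx, ← mul_sub, norm_mul,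
    Complex.norm_cpow_eq_rpow_re_of_pos (by positivity)]
  have e : besselSeries ν (x / 4 : ℝ) * besselSeries l (x / 4 : ℝ) - g1 * g2
      = (besselSeries ν (x / 4 : ℝ) - g1) * besselSeries l (x / 4 : ℝ)
        + g1 * (besselSeries l (x / 4 : ℝ) - g2) := by ring
  have hre : ((ν + l) / 2).re = (ν.re + l.re) / 2 := by simp
  rw [e, hre]
  have hb : ‖(besselSeries ν (x / 4 : ℝ) - g1) * besselSeries l (x / 4 : ℝ)
        + g1 * (besselSeries l (x / 4 : ℝ) - g2)‖ ≤ (C1 * (C2 + ‖g2‖) + ‖g1‖ * C2) * x := by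
    refine (norm_add_le _ _).trans ?_
    rw [norm_mul, norm_mul]
    calc _ ≤ C1 * (x / 4) * (C2 + ‖g2‖) + ‖g1‖ * (C2 * (x / 4)) := by gcongr
      _ = (C1 * (C2 + ‖g2‖) + ‖g1‖ * C2) * (x / 4) := by ring
      _ ≤ _ := by gcongr; linarith
  calc _ ≤ (x / 4) ^ ((ν.re + l.re) / 2) * ((C1 * (C2 + ‖g2‖) + ‖g1‖ * C2) * x) := by gcongr
    _ = _ := by ring

/-- The coefficient of the oscillation of the kernel at the origin:
`𝒲_α(x, τ) = -2 Re (oscCoeff α τ · x^{iτ}) + o(1)` as `x → 0`. -/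
noncomputable def oscCoeff (α τ : ℝ) : ℂ :=
  (4 : ℂ) ^ (-(τ * Complex.I)) * ((Complex.Gamma (α + τ * Complex.I + 1))⁻¹
    * (Complex.Gamma (-α + τ * Complex.I + 1))⁻¹)
    / (Complex.sin (Real.pi * (α - τ * Complex.I)) * (2 * Complex.I * Complex.sinh (Real.pi * τ)))

lemma sin_pi_mul_ne_zero_of_im_ne_zero {z : ℂ} (hz : z.im ≠ 0) : Complex.sin (Real.pi * z) ≠ 0 :=
  sin_pi_mul_ne_zero_of_forall_ne_intCast fun k h => hz (by rw [h]; simp)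

lemma sinh_pi_mul_ne_zero {τ : ℝ} (hτ : 0 < τ) : Complex.sinh (Real.pi * τ) ≠ 0 := by
  have : Real.sinh (Real.pi * τ) ≠ 0 := (Real.sinh_pos_iff.2 (by positivity)).ne'
  exact_mod_cast this

lemma oscCoeff_ne_zero {α τ : ℝ} (hτ : 0 < τ) : oscCoeff α τ ≠ 0 := by
  have hG : ∀ β : ℂ, (β + τ * Complex.I + 1).im ≠ 0 → Complex.Gamma (β + τ * Complex.I + 1) ≠ 0 :=
    fun β h => Complex.Gamma_ne_zero fun m hm => h (by rw [hm]; simp)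
  have h1 := hG α (by simpa using hτ.ne')
  have h2 := hG (-α) (by simpa using hτ.ne')
  have h3 : Complex.sin (Real.pi * (α - τ * Complex.I)) ≠ 0 :=
    sin_pi_mul_ne_zero_of_im_ne_zero (by simpa using hτ.ne')
  have h4 := sinh_pi_mul_ne_zero hτ
  have h5 : (4 : ℂ) ^ (-(τ * Complex.I)) ≠ 0 := by simp [Complex.cpow_eq_zero_iff]
  unfold oscCoeff
  simp [h1, h2, h3, h4, h5]

lemma continuousOn_oscCoeff (α : ℝ) : ContinuousOn (oscCoeff α) (Ioi 0) := by
  unfold oscCoeff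
  have hG : Continuous fun s : ℂ => (Complex.Gamma s)⁻¹ := Complex.differentiable_one_div_Gamma.continuous
  refine ContinuousOn.div (Continuous.continuousOn ?_) (by fun_prop) fun τ hτ => ?_
  · refine Continuous.mul (Continuous.const_cpow (by fun_prop) (Or.inl (by norm_num))) ?_
    exact (hG.comp (by fun_prop)).mul (hG.comp (by fun_prop))
  · have := sin_pi_mul_ne_zero_of_im_ne_zero (z := α - τ * Complex.I)
      (by simpa using (mem_Ioi.1 hτ).ne')
    have h4 := sinh_pi_mul_ne_zero hτ
    simp [this, h4]

/-- As `x → 0` the kernel oscillates like `x^{±iτ}` without decaying. -/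
lemma exists_abs_weberKernel_add_le {α τ : ℝ} (hα : 0 < α) (hτ : 0 < τ) :
    ∃ C : ℝ, 0 ≤ C ∧ ∀ x : ℝ, 0 < x → x ≤ 1 →
      |weberKernel α x τ + 2 * (oscCoeff α τ * (x : ℂ) ^ (τ * Complex.I)).re| ≤ C * (x ^ α + x) := by
  obtain ⟨C1, h1, b1⟩ := exists_norm_besselJ_mul_sub_le (α + τ * Complex.I) (α - τ * Complex.I)
  obtain ⟨C2, h2, b2⟩ := exists_norm_besselJ_mul_sub_le (α + τ * Complex.I) (-α + τ * Complex.I)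
  set g := (Complex.Gamma (α + τ * Complex.I + 1))⁻¹ * (Complex.Gamma (α - τ * Complex.I + 1))⁻¹
  set s1 := Complex.sin (Real.pi * (α + τ * Complex.I)) with hs1
  set s2 := Complex.sin (Real.pi * (α - τ * Complex.I)) with hs2
  set sh := Complex.sinh (Real.pi * τ) with hsh
  set p := Complex.cosh (Real.pi * τ) / (s1 * s2) with hp
  set q := (s2 * (2 * Complex.I * sh))⁻¹ with hq
  refine ⟨‖p‖ * (C1 + ‖g‖) + 2 * (‖q‖ * C2), by positivity, fun x hx hx1 => ?_⟩
  have r1 := b1 x hx hx1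
  have r2 := b2 x hx hx1
  set P := besselJ (α + τ * Complex.I) (Real.sqrt x) * besselJ (α - τ * Complex.I) (Real.sqrt x) with hP
  set U := besselJ (α + τ * Complex.I) (Real.sqrt x) * besselJ (-α + τ * Complex.I) (Real.sqrt x) with hU
  have hsq : 0 < Real.sqrt x := Real.sqrt_pos.2 hx
  have hV : besselJ (α - τ * Complex.I) (Real.sqrt x) * besselJ (-α - τ * Complex.I) (Real.sqrt x)
      = (starRingEnd ℂ) U := by
    rw [hU, map_mul, conj_besselJ _ hsq, conj_besselJ _ hsq]
    simp [sub_eq_add_neg]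
  have hs1c : s1 = (starRingEnd ℂ) s2 := by
    rw [hs1, hs2, ← Complex.sin_conj]; simp
  have hshc : (starRingEnd ℂ) sh = sh := by
    rw [hsh, ← Complex.sinh_conj]; simp
  have hW : (weberKernel α x τ : ℂ) = p * P - (q * U + (starRingEnd ℂ) (q * U)) := by
    have hqc : (starRingEnd ℂ) q = -(s1 * (2 * Complex.I * sh))⁻¹ := by
      rw [hq, map_inv₀, map_mul, map_mul, map_mul, hshc, ← hs1c, Complex.conj_I, map_ofNat, ← inv_neg]
      congr 1; ring
    rw [weberKernel_eq hx hτ, hV, ← hP, ← hU, map_mul _ q U, hqc, hq, ← hs1, ← hs2, ← hsh, hp, mul_inv,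
      mul_inv]
    ring
  have hWre : weberKernel α x τ = (p * P).re - 2 * (q * U).re := by
    have := congrArg Complex.re hW
    simp only [Complex.ofReal_re, Complex.sub_re, Complex.add_re, Complex.conj_re] at this
    linarith
  have hx4 : (x / 4 : ℝ) ^ (0 : ℝ) = 1 := Real.rpow_zero _
  have hP' : ‖P‖ ≤ (C1 + ‖g‖) * x ^ α := by
    have hxa : (x / 4) ^ α ≤ x ^ α := Real.rpow_le_rpow (by positivity) (by linarith) hα.le
    have e1 : (((α : ℂ) + τ * Complex.I).re + ((α : ℂ) - τ * Complex.I).re) / 2 = α := by simp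
    have e2 : ‖((x / 4 : ℝ) : ℂ) ^ (((α : ℂ) + τ * Complex.I + (α - τ * Complex.I)) / 2)‖
        = (x / 4) ^ α := by
      rw [Complex.norm_cpow_eq_rpow_re_of_pos (by positivity)]
      congr 1; simp
    rw [e1] at r1
    have := norm_le_norm_sub_add P (((x / 4 : ℝ) : ℂ) ^ (((α : ℂ) + τ * Complex.I
      + (α - τ * Complex.I)) / 2) * g)
    rw [norm_mul _ g, e2] at this
    have hxx : x * (x / 4) ^ α ≤ 1 * x ^ α := by gcongr
    calc ‖P‖ ≤ C1 * (x * (x / 4) ^ α) + (x / 4) ^ α * ‖g‖ := this.trans (by gcongr)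
      _ ≤ C1 * (1 * x ^ α) + x ^ α * ‖g‖ := by gcongr
      _ = _ := by ring
  have hU' : ‖q * U - oscCoeff α τ * (x : ℂ) ^ (τ * Complex.I)‖ ≤ ‖q‖ * (C2 * x) := by
    have e1 : (((α : ℂ) + τ * Complex.I).re + (-(α : ℂ) + τ * Complex.I).re) / 2 = 0 := by simp
    rw [e1, hx4, mul_one] at r2
    have e2 : ((x / 4 : ℝ) : ℂ) ^ (((α : ℂ) + τ * Complex.I + (-α + τ * Complex.I)) / 2)
        = (x : ℂ) ^ (τ * Complex.I) * (4 : ℂ) ^ (-(τ * Complex.I)) := by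
      rw [show ((α : ℂ) + τ * Complex.I + (-α + τ * Complex.I)) / 2 = τ * Complex.I by ring,
        div_eq_mul_inv, Complex.ofReal_mul, Complex.mul_cpow_ofReal_nonneg hx.le (by norm_num),
        inv_four_cpow]
    rw [e2] at r2
    have e3 : q * U - oscCoeff α τ * (x : ℂ) ^ (τ * Complex.I)
        = q * (U - (x : ℂ) ^ (τ * Complex.I) * (4 : ℂ) ^ (-(τ * Complex.I))
          * ((Complex.Gamma (α + τ * Complex.I + 1))⁻¹ * (Complex.Gamma (-α + τ * Complex.I + 1))⁻¹)) := by
      rw [oscCoeff, ← hs2, ← hsh, hq]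
      ring
    rw [e3, norm_mul]
    gcongr
  have hfin : weberKernel α x τ + 2 * (oscCoeff α τ * (x : ℂ) ^ (τ * Complex.I)).re
      = (p * P).re - 2 * (q * U - oscCoeff α τ * (x : ℂ) ^ (τ * Complex.I)).re := by
    rw [hWre, Complex.sub_re]; ring
  rw [hfin]
  have t1 := Complex.abs_re_le_norm (p * P)
  have t2 := Complex.abs_re_le_norm (q * U - oscCoeff α τ * (x : ℂ) ^ (τ * Complex.I))
  have t3 := abs_sub ((p * P).re) (2 * (q * U - oscCoeff α τ * (x : ℂ) ^ (τ * Complex.I)).re)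
  rw [abs_mul, abs_two] at t3
  rw [norm_mul] at t1
  have hxa : 0 ≤ x ^ α := by positivity
  calc _ ≤ ‖p‖ * ((C1 + ‖g‖) * x ^ α) + 2 * (‖q‖ * (C2 * x)) := by
        refine t3.trans ?_
        gcongr
        · exact t1.trans (by gcongr)
        · exact t2.trans hU'
    _ ≤ _ := by
        have := mul_nonneg (mul_nonneg (norm_nonneg p) (add_nonneg h1 (norm_nonneg g))) hx.le
        have := mul_nonneg (mul_nonneg (norm_nonneg q) h2) hxa
        nlinarith

lemma cpow_mul_I_eq_exp {x : ℝ} (hx : 0 < x) (τ : ℝ) :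
    (x : ℂ) ^ (τ * Complex.I) = Complex.exp (τ * Real.log x * Complex.I) := by
  rw [Complex.cpow_def_of_ne_zero (by exact_mod_cast hx.ne'), ← Complex.ofReal_log hx.le]
  congr 1; ring

lemma norm_cpow_mul_I {x : ℝ} (hx : 0 < x) (τ : ℝ) : ‖(x : ℂ) ^ (τ * Complex.I)‖ = 1 := by
  rw [Complex.norm_cpow_eq_rpow_re_of_pos hx]; simp

/-- If `f` is integrable near `0` against the oscillating functions `Re (A(τ) x^{iτ})` for every `τ`
in an interval, then `f` is itself integrable near `0`: averaging over `τ`, with a weight that makes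
the average finite, the Riemann–Lebesgue lemma keeps the average of `|Re (A(τ) x^{iτ})|` away
from `0`. -/
lemma integrableOn_Ioc_of_forall_integrableOn_re {f A : ℝ → ℂ}
    (hf : LocallyIntegrableOn f (Ioi (0 : ℝ))) (hA : ContinuousOn A (Icc 1 2))
    (hA0 : ∀ τ ∈ Icc (1 : ℝ) 2, A τ ≠ 0)
    (h : ∀ τ ∈ Icc (1 : ℝ) 2, IntegrableOn
      (fun x : ℝ => ((A τ * (x : ℂ) ^ (τ * Complex.I)).re : ℂ) * f x) (Ioc 0 1)) :
    IntegrableOn f (Ioc 0 1) := by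
  have hfm : AEStronglyMeasurable f (volume.restrict (Ioc (0 : ℝ) 1)) :=
    hf.aestronglyMeasurable.mono_measure (Measure.restrict_mono Ioc_subset_Ioi_self le_rfl)
  set r : ℝ × ℝ → ℝ := fun q => |(A q.1 * (q.2 : ℂ) ^ (q.1 * Complex.I)).re| with hr
  have hrc : ContinuousOn r (Icc 1 2 ×ˢ Ioc 0 1) := by
    refine (Complex.continuous_re.comp_continuousOn (ContinuousOn.mul
      (hA.comp continuous_fst.continuousOn fun q hq => hq.1) ?_)).abs
    refine ContinuousOn.cpow (by fun_prop) (by fun_prop) fun q hq => ?_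
    rw [Complex.ofReal_mem_slitPlane]
    exact hq.2.1
  have hrm := hrc.aestronglyMeasurable_prod measurableSet_Icc measurableSet_Ioc
  have hKm : AEStronglyMeasurable (fun q : ℝ × ℝ => r q * ‖f q.2‖)
      ((volume.restrict (Icc (1 : ℝ) 2)).prod (volume.restrict (Ioc (0 : ℝ) 1))) :=
    hrm.mul hfm.norm.comp_snd
  set G : ℝ → ℝ := fun τ => ∫ x in Ioc (0 : ℝ) 1, r (τ, x) * ‖f x‖ with hG
  have hG0 : ∀ τ, 0 ≤ G τ := fun τ => integral_nonneg fun x => by positivity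
  have hGm : AEStronglyMeasurable G (volume.restrict (Icc (1 : ℝ) 2)) := hKm.integral_prod_right'
  set p : ℝ → ℝ := fun τ => (1 + G τ)⁻¹ with hp
  have hp0 : ∀ τ, 0 < p τ := fun τ => by have := hG0 τ; simp only [hp]; positivity
  have hp1 : ∀ τ, p τ ≤ 1 := fun τ => inv_le_one_of_one_le₀ (by linarith [hG0 τ])
  have hpG : ∀ τ, p τ * G τ ≤ 1 := fun τ => by
    have := hG0 τ
    simp only [hp]
    rw [inv_mul_le_iff₀ (by linarith)]; linarith
  have hpm : AEStronglyMeasurable p (volume.restrict (Icc (1 : ℝ) 2)) :=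
    (hGm.aemeasurable.const_add 1).inv.aestronglyMeasurable
  have hint : Integrable (fun q : ℝ × ℝ => p q.1 * (r q * ‖f q.2‖))
      ((volume.restrict (Icc (1 : ℝ) 2)).prod (volume.restrict (Ioc (0 : ℝ) 1))) := by
    have hm : AEStronglyMeasurable (fun q : ℝ × ℝ => p q.1 * (r q * ‖f q.2‖))
        ((volume.restrict (Icc (1 : ℝ) 2)).prod (volume.restrict (Ioc (0 : ℝ) 1))) :=
      hpm.comp_fst.mul hKm
    rw [integrable_prod_iff hm]
    constructor
    · filter_upwards [ae_restrict_mem measurableSet_Icc] with τ hτ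
      refine Integrable.const_mul ?_ _
      refine (h τ hτ).norm.congr (Eventually.of_forall fun x => ?_)
      simp only [hr, norm_mul, Complex.norm_real, Real.norm_eq_abs]
    · refine Integrable.mono' (integrable_const (1 : ℝ)) hm.norm.integral_prod_right' ?_
      refine Eventually.of_forall fun τ => ?_
      rw [Real.norm_of_nonneg (integral_nonneg fun _ => norm_nonneg _)]
      have : ∀ x, ‖p τ * (r (τ, x) * ‖f x‖)‖ = p τ * (r (τ, x) * ‖f x‖) := fun x =>
        Real.norm_of_nonneg (mul_nonneg (hp0 τ).le (mul_nonneg (abs_nonneg _) (norm_nonneg _)))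
      simp only [this]
      rw [integral_const_mul]
      exact hpG τ
  set H : ℝ → ℝ := fun x => ∫ τ in Icc (1 : ℝ) 2, p τ * r (τ, x) with hH
  have hHf : IntegrableOn (fun x => H x * ‖f x‖) (Ioc 0 1) := by
    refine (Integrable.integral_prod_right hint).congr (Eventually.of_forall fun x => ?_)
    simp only [hH]
    rw [← integral_mul_const]
    exact integral_congr_ae (Eventually.of_forall fun τ => by simp only; ring)
  have hAm : AEStronglyMeasurable A (volume.restrict (Icc (1 : ℝ) 2)) :=
    hA.aestronglyMeasurable measurableSet_Icc
  have hAi : IntegrableOn A (Icc 1 2) := hA.integrableOn_compact isCompact_Icc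
  have hpA : IntegrableOn (fun τ => p τ * ‖A τ‖) (Icc 1 2) := by
    refine Integrable.mono' hAi.norm (hpm.mul hAm.norm) (Eventually.of_forall fun τ => ?_)
    rw [Real.norm_of_nonneg (mul_nonneg (hp0 τ).le (norm_nonneg _))]
    exact mul_le_of_le_one_left (norm_nonneg _) (hp1 τ)
  set c := ∫ τ in Icc (1 : ℝ) 2, p τ * ‖A τ‖ with hc
  have hc0 : 0 < c := by
    rw [hc, setIntegral_pos_iff_support_of_nonneg_ae
      (Eventually.of_forall fun τ => mul_nonneg (hp0 τ).le (norm_nonneg _)) hpA]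
    have : Function.support (fun τ => p τ * ‖A τ‖) ∩ Icc 1 2 = Icc (1 : ℝ) 2 := by
      refine inter_eq_right.2 fun τ hτ => ?_
      simp [(hp0 τ).ne', hA0 τ hτ]
    rw [this, Real.volume_Icc]
    norm_num
  set D : ℝ → ℂ := fun τ => p τ * (A τ ^ 2 / ‖A τ‖) with hD
  have hDn : ∀ τ, ‖D τ‖ = p τ * ‖A τ‖ := by
    intro τ
    simp only [hD, norm_mul, norm_div, norm_pow, Complex.norm_real, norm_norm]
    rw [Real.norm_of_nonneg (hp0 τ).le]
    by_cases hz : ‖A τ‖ = 0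
    · simp [hz]
    · field_simp
  have hDm : AEStronglyMeasurable D (volume.restrict (Icc (1 : ℝ) 2)) := by
    refine AEMeasurable.aestronglyMeasurable ?_
    exact (Complex.measurable_ofReal.comp_aemeasurable hpm.aemeasurable).mul
      ((hAm.aemeasurable.pow_const 2).div
        (Complex.measurable_ofReal.comp_aemeasurable hAm.norm.aemeasurable))
  have hlow : ∀ x : ℝ, 0 < x → c / 2 + (∫ τ in Icc (1 : ℝ) 2,
      Complex.exp (2 * τ * Real.log x * Complex.I) * D τ).re / 2 ≤ H x := by
    intro x hx
    have hDi : IntegrableOn (fun τ : ℝ => Complex.exp (2 * τ * Real.log x * Complex.I) * D τ)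
        (Icc 1 2) := by
      refine Integrable.mono' hpA ?_ (Eventually.of_forall fun τ => ?_)
      · exact (by fun_prop : Continuous fun τ : ℝ =>
          Complex.exp (2 * τ * Real.log x * Complex.I)).aestronglyMeasurable.mul hDm
      · rw [norm_mul, hDn, show (2 * τ * Real.log x * Complex.I : ℂ)
          = ((2 * τ * Real.log x : ℝ) : ℂ) * Complex.I by push_cast; ring, Complex.norm_exp_ofReal_mul_I,
          one_mul]
    have hre := integral_re hDi
    simp only [RCLike.re_eq_complex_re] at hre
    have hDr : IntegrableOn (fun τ : ℝ => (Complex.exp (2 * τ * Real.log x * Complex.I) * D τ).re)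
      (Icc 1 2) := hDi.re
    have hrx : ContinuousOn (fun τ => r (τ, x)) (Icc 1 2) := by
      refine (Complex.continuous_re.comp_continuousOn (hA.mul ?_)).abs
      have : Continuous fun τ : ℝ => (x : ℂ) ^ (τ * Complex.I) :=
        Continuous.const_cpow (by fun_prop) (Or.inl (by exact_mod_cast hx.ne'))
      exact this.continuousOn
    have hri : IntegrableOn (fun τ => p τ * r (τ, x)) (Icc 1 2) := by
      refine Integrable.mono' hpA (hpm.mul (hrx.aestronglyMeasurable measurableSet_Icc))
        (Eventually.of_forall fun τ => ?_)
      rw [Real.norm_of_nonneg (mul_nonneg (hp0 τ).le (abs_nonneg _))]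
      refine mul_le_mul_of_nonneg_left ((Complex.abs_re_le_norm _).trans ?_) (hp0 τ).le
      rw [norm_mul, norm_cpow_mul_I hx, mul_one]
    rw [← hre, hc, ← integral_div, ← integral_div, ← integral_add (hpA.div_const 2) (hDr.div_const 2)]
    refine setIntegral_mono_on ((hpA.div_const 2).add (hDr.div_const 2)) hri measurableSet_Icc
      fun τ hτ => ?_
    -- `(Re z)² / |z| ≤ |Re z|`, and `2 (Re z)² = |z|² + Re z²`
    set z := A τ * (x : ℂ) ^ (τ * Complex.I) with hz
    have hn : ‖z‖ = ‖A τ‖ := by rw [hz, norm_mul, norm_cpow_mul_I hx, mul_one]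
    have hn0 : 0 < ‖A τ‖ := norm_pos_iff.2 (hA0 τ hτ)
    have e1 : Complex.exp (2 * τ * Real.log x * Complex.I) * D τ = ((p τ / ‖A τ‖ : ℝ) : ℂ) * z ^ 2 := by
      rw [hz, cpow_mul_I_eq_exp hx, mul_pow, ← Complex.exp_nat_mul]
      simp only [hD]
      push_cast
      rw [show 2 * (τ * Real.log x * Complex.I) = 2 * τ * Real.log x * Complex.I by ring]
      ring
    have e2 : (z ^ 2).re = 2 * z.re ^ 2 - ‖A τ‖ ^ 2 := by
      rw [← hn, ← Complex.normSq_eq_norm_sq, Complex.normSq_apply, sq, Complex.mul_re]; ring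
    rw [e1, Complex.re_ofReal_mul, e2]
    have e3 : p τ * ‖A τ‖ / 2 + p τ / ‖A τ‖ * (2 * z.re ^ 2 - ‖A τ‖ ^ 2) / 2
        = p τ * (z.re ^ 2 / ‖A τ‖) := by field_simp; ring
    rw [e3]
    refine mul_le_mul_of_nonneg_left ?_ (hp0 τ).le
    rw [div_le_iff₀ hn0]
    have h1 : |z.re| ≤ ‖A τ‖ := hn ▸ Complex.abs_re_le_norm z
    calc z.re ^ 2 = |z.re| * |z.re| := by rw [← sq, sq_abs]
      _ ≤ |z.re| * ‖A τ‖ := by gcongr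
  have hRL : Tendsto (fun x : ℝ => ∫ τ in Icc (1 : ℝ) 2,
      Complex.exp (2 * τ * Real.log x * Complex.I) * D τ) (𝓝[>] 0) (𝓝 0) := by
    have h1 := Real.tendsto_integral_exp_smul_cocompact ((Icc (1 : ℝ) 2).indicator D)
    have h2 : Tendsto (fun x : ℝ => -Real.log x / Real.pi) (𝓝[>] 0) (cocompact ℝ) :=
      ((tendsto_neg_atBot_atTop.comp Real.tendsto_log_nhdsGT_zero).atTop_div_const
        Real.pi_pos).mono_right atTop_le_cocompact
    refine (h1.comp h2).congr fun x => ?_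
    simp only [Function.comp_apply]
    rw [← integral_indicator measurableSet_Icc]
    refine integral_congr_ae (Eventually.of_forall fun τ => ?_)
    simp only [indicator]
    split_ifs
    · rw [Circle.smul_def, Real.fourierChar_apply, smul_eq_mul]
      congr 2
      push_cast
      have : (Real.pi : ℂ) ≠ 0 := by exact_mod_cast Real.pi_ne_zero
      field_simp
    · simp
  have hev : ∀ᶠ x : ℝ in 𝓝[>] 0, c / 4 ≤ H x := by
    have h1 := hRL.eventually (Metric.ball_mem_nhds (0 : ℂ) (show 0 < c / 2 by positivity))
    filter_upwards [h1, self_mem_nhdsWithin] with x hx hx0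
    have h2 := hlow x hx0
    rw [dist_zero_right] at hx
    have h3 := (abs_le.1 (Complex.abs_re_le_norm (∫ τ in Icc (1 : ℝ) 2,
      Complex.exp (2 * τ * Real.log x * Complex.I) * D τ))).1
    linarith
  obtain ⟨δ, hδ, hδs⟩ := mem_nhdsGT_iff_exists_Ioo_subset.1 hev
  have hδ0 : 0 < δ := hδ
  set δ' := min (δ / 2) 1 with hδ'
  have hd0 : 0 < δ' := by rw [hδ']; positivity
  have hd1 : δ' ≤ 1 := min_le_right _ _
  rw [← Ioc_union_Icc_eq_Ioc hd0 hd1]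
  refine IntegrableOn.union ?_ (hf.integrableOn_compact_subset
    (fun x hx => lt_of_lt_of_le hd0 hx.1) isCompact_Icc)
  have hsub : Ioc 0 δ' ⊆ Ioc (0 : ℝ) 1 := Ioc_subset_Ioc_right hd1
  refine Integrable.mono' ((hHf.mono_set hsub).const_mul (4 / c))
    (hfm.mono_measure (Measure.restrict_mono hsub le_rfl)) ?_
  filter_upwards [ae_restrict_mem measurableSet_Ioc] with x hx
  have h1 : c / 4 ≤ H x := hδs ⟨hx.1, lt_of_le_of_lt hx.2 (by
    have := min_le_left (δ / 2) 1
    rw [← hδ'] at this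
    linarith)⟩
  calc ‖f x‖ = 4 / c * (c / 4 * ‖f x‖) := by field_simp
    _ ≤ 4 / c * (H x * ‖f x‖) := by gcongr

/-- The transform can only converge absolutely for all `τ` if `f` is integrable. -/
lemma integrableOn_of_integrableOn_weberKernel_mul {α ν : ℝ} {f : ℝ → ℂ} (hα : 0 < α)
    (hf : LocallyIntegrableOn f (Ioi (0 : ℝ))) (hν : ν ≤ α) (hν1 : ν ≤ 1)
    (hfν : IntegrableOn (fun x : ℝ => ((x ^ ν : ℝ) : ℂ) * f x) (Ioc 0 1))
    (h : ∀ τ : ℝ, 0 < τ → IntegrableOn (fun x : ℝ => (weberKernel α x τ : ℂ) * f x) (Ioi (0 : ℝ))) :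
    IntegrableOn f (Ioc 0 1) := by
  refine integrableOn_Ioc_of_forall_integrableOn_re hf (A := oscCoeff α)
    ((continuousOn_oscCoeff α).mono fun τ hτ => lt_of_lt_of_le one_pos hτ.1)
    (fun τ hτ => oscCoeff_ne_zero (lt_of_lt_of_le one_pos hτ.1)) fun τ hτ => ?_
  have hτ0 : 0 < τ := lt_of_lt_of_le one_pos hτ.1
  obtain ⟨C, hC, hb⟩ := exists_abs_weberKernel_add_le hα hτ0
  have hfm : AEStronglyMeasurable f (volume.restrict (Ioc (0 : ℝ) 1)) :=
    hf.aestronglyMeasurable.mono_measure (Measure.restrict_mono Ioc_subset_Ioi_self le_rfl)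
  have hW := (h τ hτ0).mono_set (show Ioc (0 : ℝ) 1 ⊆ Ioi 0 from Ioc_subset_Ioi_self)
  have hosc : ContinuousOn (fun x : ℝ => ((oscCoeff α τ * (x : ℂ) ^ (τ * Complex.I)).re : ℂ))
      (Ioc 0 1) := by
    refine Complex.continuous_ofReal.comp_continuousOn
      (Complex.continuous_re.comp_continuousOn (continuousOn_const.mul ?_))
    refine ContinuousOn.cpow (by fun_prop) (by fun_prop) fun x hx => ?_
    rw [Complex.ofReal_mem_slitPlane]
    exact hx.1
  have hdiff : IntegrableOn (fun x : ℝ => (weberKernel α x τ : ℂ) * f x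
      + 2 * (((oscCoeff α τ * (x : ℂ) ^ (τ * Complex.I)).re : ℂ) * f x)) (Ioc 0 1) := by
    refine Integrable.mono' (hfν.norm.const_mul (2 * C)) (hW.1.add
      (((hosc.aestronglyMeasurable measurableSet_Ioc).mul hfm).const_mul 2)) ?_
    filter_upwards [ae_restrict_mem measurableSet_Ioc] with x hx
    have h1 := hb x hx.1 hx.2
    have h2 : x ^ α ≤ x ^ ν := Real.rpow_le_rpow_of_exponent_ge hx.1 hx.2 hν
    have h3 : x ≤ x ^ ν := by
      simpa using Real.rpow_le_rpow_of_exponent_ge hx.1 hx.2 hν1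
    have e : (weberKernel α x τ : ℂ) * f x
        + 2 * (((oscCoeff α τ * (x : ℂ) ^ (τ * Complex.I)).re : ℂ) * f x)
        = ((weberKernel α x τ + 2 * (oscCoeff α τ * (x : ℂ) ^ (τ * Complex.I)).re : ℝ) : ℂ) * f x := by
      push_cast; ring
    rw [e, norm_mul, norm_mul, Complex.norm_real, Complex.norm_real,
      Real.norm_of_nonneg (Real.rpow_nonneg hx.1.le ν), Real.norm_eq_abs]
    calc _ ≤ C * (x ^ ν + x ^ ν) * ‖f x‖ := by gcongr; exact h1.trans (by gcongr)
      _ = _ := by ring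
  refine ((hdiff.sub hW).const_mul (1 / 2)).congr (Eventually.of_forall fun x => ?_)
  simp only [Pi.sub_apply]
  ring

/-! ### Inversion of sine transforms -/

lemma integrable_of_odd {h : ℝ → ℂ} (hodd : ∀ y, h (-y) = -h y) (hi : IntegrableOn h (Ioi 0)) :
    Integrable h := by
  rw [← integrableOn_univ, ← Iic_union_Ioi (a := (0 : ℝ))]
  refine IntegrableOn.union ?_ hi
  rw [integrableOn_Iic_iff_integrableOn_Iio]
  have h1 : IntegrableOn (fun y => h (-y)) (Iio 0) := by
    have := hi.comp_neg
    simpa using this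
  exact h1.neg.congr_fun (fun y _ => by simp [hodd]) measurableSet_Iio

lemma integral_eq_integral_Ioi_add_comp_neg {h : ℝ → ℂ} (hi : Integrable h) :
    ∫ y, h y = ∫ y in Ioi (0 : ℝ), (h y + h (-y)) := by
  rw [integral_add hi.integrableOn hi.comp_neg.integrableOn, integral_comp_neg_Ioi, neg_zero,
    add_comm, intervalIntegral.integral_Iic_add_Ioi hi.integrableOn hi.integrableOn]

open scoped FourierTransform in
/-- Fourier inversion for sine transforms. -/
lemma eq_integral_sin_of_integrableOn {c : ℝ → ℂ} (hc : ContinuousOn c (Ioi 0))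
    (hi : IntegrableOn c (Ioi 0))
    (hS : IntegrableOn (fun τ : ℝ => ∫ y in Ioi (0 : ℝ), (Real.sin (2 * τ * y) : ℂ) * c y) (Ioi 0))
    {θ : ℝ} (hθ : 0 < θ) :
    c θ = 4 / Real.pi * ∫ τ in Ioi (0 : ℝ), (Real.sin (2 * τ * θ) : ℂ)
      * ∫ y in Ioi (0 : ℝ), (Real.sin (2 * τ * y) : ℂ) * c y := by
  set S : ℝ → ℂ := fun τ => ∫ y in Ioi (0 : ℝ), (Real.sin (2 * τ * y) : ℂ) * c y with hSdef
  set g : ℝ → ℂ := fun y => ((SignType.sign y : ℝ) : ℂ) * c |y| with hg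
  have hgpos : ∀ y, 0 < y → g y = c y := fun y hy => by simp [hg, sign_pos hy, abs_of_pos hy]
  have hgodd : ∀ y, g (-y) = -g y := fun y => by simp [hg, Left.sign_neg]
  have hgi : Integrable g := integrable_of_odd hgodd
    (hi.congr_fun (fun y hy => (hgpos y hy).symm) measurableSet_Ioi)
  have hSodd : ∀ τ, S (-τ) = -S τ := fun τ => by
    simp only [hSdef]
    rw [← integral_neg]
    refine integral_congr_ae (Eventually.of_forall fun y => ?_)
    simp only
    rw [show 2 * -τ * y = -(2 * τ * y) by ring, Real.sin_neg]
    push_cast; ring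
  have hSi : Integrable S := integrable_of_odd hSodd hS
  have hphase : ∀ v w : ℝ, (Real.fourierChar (v * w) : ℂ) - (Real.fourierChar (-(v * w)) : ℂ)
      = 2 * Complex.I * (Real.sin (2 * Real.pi * v * w) : ℂ) := by
    intro v w
    rw [Real.fourierChar_apply, Real.fourierChar_apply]
    push_cast
    rw [Complex.sin]
    have h2 : ∀ a b : ℂ, a - b = 2 * Complex.I * ((b - a) * Complex.I / 2) := fun a b => by
      linear_combination (a - b) * Complex.I_mul_I
    rw [h2]
    ring_nf
  have hF : 𝓕 g = fun ξ => -2 * Complex.I * S (Real.pi * ξ) := by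
    funext ξ
    rw [Real.fourier_real_eq]
    have hint : Integrable fun v => Real.fourierChar (-(v * ξ)) • g v := by
      refine hgi.norm.mono' ?_ (Eventually.of_forall fun v => by rw [Circle.norm_smul])
      exact (by fun_prop : Continuous fun v => Real.fourierChar (-(v * ξ))).aestronglyMeasurable.smul
        hgi.1
    rw [integral_eq_integral_Ioi_add_comp_neg hint, hSdef, ← integral_const_mul]
    refine setIntegral_congr_fun measurableSet_Ioi fun y hy => ?_
    rw [hgodd, hgpos y hy, Circle.smul_def, Circle.smul_def, smul_eq_mul, smul_eq_mul, neg_mul,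
      neg_neg]
    have := hphase y ξ
    rw [show 2 * (Real.pi * ξ) * y = 2 * Real.pi * y * ξ by ring]
    linear_combination (-c y) * this
  have hπ := Real.pi_pos
  have hFi : Integrable (𝓕 g) := by
    rw [hF]
    exact (hSi.comp_mul_left' hπ.ne').const_mul _
  have hgc : ContinuousAt g θ := by
    have h1 : ContinuousAt c θ := hc.continuousAt (Ioi_mem_nhds hθ)
    refine h1.congr ?_
    filter_upwards [lt_mem_nhds hθ] with y hy using (hgpos y hy).symm
  have hinv := hgi.fourierInv_fourier_eq hFi hgc
  rw [hgpos θ hθ, hF, Real.fourierInv_eq'] at hinv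
  have hint : Integrable fun v : ℝ => Complex.exp (((2 * Real.pi * inner ℝ v θ : ℝ) : ℂ) * Complex.I)
      • (-2 * Complex.I * S (Real.pi * v)) := by
    refine ((hSi.comp_mul_left' hπ.ne').const_mul (-2 * Complex.I)).norm.mono' ?_
      (Eventually.of_forall fun v => ?_)
    · have hexp : Continuous fun v : ℝ =>
          Complex.exp (((2 * Real.pi * inner ℝ v θ : ℝ) : ℂ) * Complex.I) := by fun_prop
      exact hexp.aestronglyMeasurable.smul
        ((hSi.comp_mul_left' hπ.ne').const_mul (-2 * Complex.I)).1
    · rw [norm_smul, Complex.norm_exp_ofReal_mul_I, one_mul]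
  rw [integral_eq_integral_Ioi_add_comp_neg hint] at hinv
  rw [← hinv]
  have hsub := integral_comp_mul_left_Ioi
    (fun τ : ℝ => (Real.sin (2 * τ * θ) : ℂ) * S τ) 0 hπ
  rw [mul_zero, Complex.real_smul] at hsub
  have e : (4 : ℂ) / Real.pi * ∫ τ in Ioi (0 : ℝ), (Real.sin (2 * τ * θ) : ℂ) * S τ
      = 4 * ∫ v in Ioi (0 : ℝ), (Real.sin (2 * (Real.pi * v) * θ) : ℂ) * S (Real.pi * v) := by
    rw [hsub]; push_cast; ring
  rw [e, ← integral_const_mul]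
  refine setIntegral_congr_fun measurableSet_Ioi fun v _ => ?_
  have h1 := hphase v θ
  rw [Real.fourierChar_apply, Real.fourierChar_apply] at h1
  rw [mul_neg, hSodd, smul_eq_mul, smul_eq_mul]
  simp only [RCLike.inner_apply, conj_trivial]
  rw [show θ * -v = -(v * θ) by ring, mul_comm θ v,
    show 2 * (Real.pi * v) * θ = 2 * Real.pi * v * θ by ring]
  linear_combination (-2 * Complex.I * S (Real.pi * v)) * h1
    - (4 * (Real.sin (2 * Real.pi * v * θ) : ℂ) * S (Real.pi * v)) * Complex.I_mul_I

/-! ### The weighted space -/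

/-- A lower bound for `sinh y` that captures both its linear behaviour at `0` and its growth. -/
lemma mul_exp_le_sinh_mul (y : ℝ) : y * Real.exp y ≤ Real.sinh y * (1 + 2 * y) := by
  have h1 : Real.exp y = Real.exp (-y) * Real.exp (2 * y) := by rw [← Real.exp_add]; ring_nf
  have h2 : 1 + 2 * y ≤ Real.exp (2 * y) := by linarith [Real.add_one_le_exp (2 * y)]
  have h3 := Real.exp_pos (-y)
  rw [Real.sinh_eq]
  have h4 : Real.exp (-y) * (1 + 2 * y) ≤ Real.exp y := by rw [h1]; gcongr
  nlinarith

/-- By the Cauchy–Schwarz inequality, the weighted space embeds into `L¹(τ e^{πτ/4} dτ)`. -/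
lemma integrableOn_of_memLp_weightMeasure {F : ℝ → ℂ} (hF : MemLp F 2 weightMeasure) :
    AEStronglyMeasurable F (volume.restrict (Ioi (0 : ℝ))) ∧
      IntegrableOn (fun τ => τ * Real.exp (Real.pi / 4 * τ) * ‖F τ‖) (Ioi 0) := by
  set W : ℝ → ℝ := fun τ => τ * (1 + τ) ^ 2 * Real.sinh (Real.pi * τ) with hW
  have hWm : Measurable fun τ => ENNReal.ofReal (W τ) := by
    refine ENNReal.measurable_ofReal.comp ?_
    exact (by fun_prop : Continuous W).measurable
  have hWpos : ∀ τ, 0 < τ → 0 < W τ := fun τ hτ => by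
    have : 0 < Real.sinh (Real.pi * τ) := Real.sinh_pos_iff.2 (by positivity)
    simp only [hW]; positivity
  have hac : volume.restrict (Ioi (0 : ℝ)) ≪ weightMeasure := by
    refine withDensity_absolutelyContinuous' hWm.aemeasurable ?_
    filter_upwards [ae_restrict_mem measurableSet_Ioi] with τ hτ
    exact (ENNReal.ofReal_pos.2 (hWpos τ hτ)).ne'
  have hm : AEStronglyMeasurable F (volume.restrict (Ioi (0 : ℝ))) := hF.1.mono_ac hac
  refine ⟨hm, ?_⟩
  have hsq := (memLp_two_iff_integrable_sq_norm hF.1).1 hF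
  rw [weightMeasure, integrable_withDensity_iff_integrable_smul' hWm
    (Eventually.of_forall fun _ => ENNReal.ofReal_lt_top)] at hsq
  have hexp : IntegrableOn (fun τ : ℝ => 7 / Real.pi * Real.exp (-(Real.pi / 2) * τ)) (Ioi 0) :=
    (integrableOn_exp_mul_Ioi (by linarith [Real.pi_pos]) 0).const_mul _
  refine Integrable.mono' (hsq.add hexp) (AEStronglyMeasurable.mul ?_ hm.norm) ?_
  · exact (by fun_prop : Continuous fun τ : ℝ => τ * Real.exp (Real.pi / 4 * τ)).aestronglyMeasurable
  filter_upwards [ae_restrict_mem measurableSet_Ioi] with τ hτ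
  have hτ0 : 0 < τ := hτ
  have hπ := Real.pi_pos
  have hw := hWpos τ hτ0
  have hw' : (ENNReal.ofReal (W τ)).toReal = W τ := ENNReal.toReal_ofReal hw.le
  simp only [Pi.add_apply, smul_eq_mul]
  rw [Real.norm_of_nonneg (by positivity)]
  change _ ≤ (ENNReal.ofReal (W τ)).toReal * ‖F τ‖ ^ 2 + _
  rw [hw']
  set E := Real.exp (Real.pi / 4 * τ) with hE
  have hE2 : E ^ 2 * Real.exp (Real.pi / 2 * τ) = Real.exp (Real.pi * τ) := by
    rw [hE, ← Real.exp_nat_mul, ← Real.exp_add]; push_cast; ring_nf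
  have hEi : Real.exp (-(Real.pi / 2) * τ) * Real.exp (Real.pi / 2 * τ) = 1 := by
    rw [← Real.exp_add]; simp
  have hsinh := mul_exp_le_sinh_mul (Real.pi * τ)
  have hkey : (τ * E) ^ 2 ≤ W τ * (7 / Real.pi * Real.exp (-(Real.pi / 2) * τ)) := by
    have h7 : 1 + 2 * (Real.pi * τ) ≤ 7 * (1 + τ) ^ 2 := by nlinarith [Real.pi_lt_d2]
    have hs0 : 0 < Real.sinh (Real.pi * τ) := Real.sinh_pos_iff.2 (by positivity)
    have hX := Real.exp_pos (Real.pi / 2 * τ)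
    have h8 : Real.pi * τ * Real.exp (Real.pi * τ)
        ≤ Real.sinh (Real.pi * τ) * (7 * (1 + τ) ^ 2) := hsinh.trans (by gcongr)
    refine le_of_mul_le_mul_right (a := Real.exp (Real.pi / 2 * τ)) ?_ hX
    calc (τ * E) ^ 2 * Real.exp (Real.pi / 2 * τ) = τ ^ 2 * Real.exp (Real.pi * τ) := by
          rw [← hE2]; ring
      _ = τ / Real.pi * (Real.pi * τ * Real.exp (Real.pi * τ)) := by field_simp
      _ ≤ τ / Real.pi * (Real.sinh (Real.pi * τ) * (7 * (1 + τ) ^ 2)) := by gcongr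
      _ = W τ * (7 / Real.pi) * 1 := by simp only [hW]; ring
      _ = _ := by rw [← hEi]; ring
  set B := 7 / Real.pi * Real.exp (-(Real.pi / 2) * τ) with hB
  have hB0 : 0 < B := by positivity
  have hn := norm_nonneg (F τ)
  have h9 : (τ * E * ‖F τ‖) ^ 2 ≤ (W τ * ‖F τ‖ ^ 2 + B) ^ 2 := by
    calc (τ * E * ‖F τ‖) ^ 2 = (τ * E) ^ 2 * ‖F τ‖ ^ 2 := by ring
      _ ≤ W τ * B * ‖F τ‖ ^ 2 := by gcongr
      _ ≤ _ := by nlinarith [sq_nonneg (W τ * ‖F τ‖ ^ 2), mul_pos hw hB0, sq_nonneg B,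
        mul_nonneg (mul_pos hw hB0).le (sq_nonneg ‖F τ‖)]
  exact le_of_sq_le_sq h9 (by positivity)

/-! ### The transform as a sine transform -/

lemma coth_mul_comp_mul_sinhPow_eq {x θ : ℝ} (hx : 0 < x) (hθ : 0 < θ) (k : ℝ → ℂ) (w : ℂ) :
    ((Real.cosh θ / Real.sinh θ : ℝ) : ℂ) * k (x * Real.sinh θ ^ 2) * sinhPow θ w
      = (4 : ℂ) ^ (-w) * (x : ℂ) ^ w * (((Real.cosh θ / Real.sinh θ : ℝ) : ℂ)
        * (fun u : ℝ => k u * (u : ℂ) ^ (-w)) (x * Real.sinh θ ^ 2)) := by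
  have hx' : (x : ℂ) ^ w ≠ 0 := by
    rw [Complex.cpow_def_of_ne_zero (by exact_mod_cast hx.ne')]; exact Complex.exp_ne_zero _
  have h4 : (4 : ℂ) ^ w ≠ 0 := by
    rw [Complex.cpow_def_of_ne_zero (by norm_num)]; exact Complex.exp_ne_zero _
  simp only [← sinhPow_eq hx hθ w, Complex.cpow_neg]
  field_simp

lemma inv_mul_mul_cpow_eq {u : ℝ} (hu : 0 < u) (k : ℝ → ℂ) (w : ℂ) :
    (u : ℂ)⁻¹ * (k u * (u : ℂ) ^ (-w)) = (u : ℂ) ^ (-w - 1) • k u := by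
  have hu' : (u : ℂ) ≠ 0 := by exact_mod_cast hu.ne'
  rw [Complex.cpow_sub _ _ hu', Complex.cpow_one, smul_eq_mul]
  ring

lemma integrableOn_coth_mul_comp_mul_sinhPow {x : ℝ} (hx : 0 < x) {k : ℝ → ℂ} {w : ℂ}
    (hk : MellinConvergent k (-w)) :
    IntegrableOn (fun θ => ((Real.cosh θ / Real.sinh θ : ℝ) : ℂ) * k (x * Real.sinh θ ^ 2)
      * sinhPow θ w) (Ioi 0) := by
  have h1 : IntegrableOn (fun u : ℝ => (u : ℂ)⁻¹ * (k u * (u : ℂ) ^ (-w))) (Ioi 0) :=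
    IntegrableOn.congr_fun hk (fun u hu => (inv_mul_mul_cpow_eq hu k w).symm) measurableSet_Ioi
  have h2 := ((integrableOn_coth_mul_comp_iff hx (fun u : ℝ => k u * (u : ℂ) ^ (-w))).2 h1).const_mul
    ((4 : ℂ) ^ (-w) * (x : ℂ) ^ w)
  exact IntegrableOn.congr_fun h2 (fun θ hθ => (coth_mul_comp_mul_sinhPow_eq hx hθ k w).symm)
    measurableSet_Ioi

lemma integral_coth_mul_comp_mul_sinhPow {x : ℝ} (hx : 0 < x) (k : ℝ → ℂ) (w : ℂ) :
    ∫ θ in Ioi (0 : ℝ), ((Real.cosh θ / Real.sinh θ : ℝ) : ℂ) * k (x * Real.sinh θ ^ 2)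
      * sinhPow θ w = 1 / 2 * (4 : ℂ) ^ (-w) * (x : ℂ) ^ w * mellin k (-w) := by
  rw [setIntegral_congr_fun measurableSet_Ioi
    (fun θ (hθ : θ ∈ Ioi (0 : ℝ)) => coth_mul_comp_mul_sinhPow_eq hx hθ k w), integral_const_mul,
    integral_coth_mul_comp hx (fun u : ℝ => k u * (u : ℂ) ^ (-w)), mellin, setIntegral_congr_fun measurableSet_Ioi
    (fun u (hu : u ∈ Ioi (0 : ℝ)) => inv_mul_mul_cpow_eq hu k w)]
  ring

lemma continuousOn_coth_mul_weberProfile_mul_sinhPow {α : ℝ} (hα : 0 < α) (w : ℂ) :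
    ContinuousOn (fun q : ℝ × ℝ => ((Real.cosh q.2 / Real.sinh q.2 : ℝ) : ℂ)
      * weberProfile α (q.1 * Real.sinh q.2 ^ 2) * sinhPow q.2 w) (Ioi 0 ×ˢ Ioi 0) := by
  have hmap : MapsTo (Prod.snd : ℝ × ℝ → ℝ) (Ioi 0 ×ˢ Ioi 0) (Ioi 0) := fun q hq => hq.2
  refine ContinuousOn.mul (ContinuousOn.mul ?_ ?_)
    ((continuousOn_sinhPow w).comp continuous_snd.continuousOn hmap)
  · exact Complex.continuous_ofReal.comp_continuousOn
      (continuousOn_coth.comp continuous_snd.continuousOn hmap)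
  · refine (continuousOn_weberProfile hα).comp ?_ fun q hq => ?_
    · exact (continuous_fst.mul ((Real.continuous_sinh.comp continuous_snd).pow 2)).continuousOn
    · have h1 := Real.sinh_pos_iff.2 (mem_Ioi.1 hq.2)
      have h2 := mem_Ioi.1 hq.1
      exact mem_Ioi.2 (by positivity)

lemma integrable_coth_mul_weberProfile_mul_sinhPow_mul {α : ℝ} (hα : 0 < α) {f : ℝ → ℂ}
    (hfm : AEStronglyMeasurable f (volume.restrict (Ioi (0 : ℝ)))) {w : ℂ} (h0 : 0 ≤ w.re)
    (h1 : w.re < α) (h2 : w.re < 1) (hf : MellinConvergent f (1 + w)) :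
    Integrable (fun q : ℝ × ℝ => ((Real.cosh q.2 / Real.sinh q.2 : ℝ) : ℂ)
      * weberProfile α (q.1 * Real.sinh q.2 ^ 2) * sinhPow q.2 w * f q.1)
      ((volume.restrict (Ioi (0 : ℝ))).prod (volume.restrict (Ioi (0 : ℝ)))) := by
  have hm : AEStronglyMeasurable (fun q : ℝ × ℝ => ((Real.cosh q.2 / Real.sinh q.2 : ℝ) : ℂ)
      * weberProfile α (q.1 * Real.sinh q.2 ^ 2) * sinhPow q.2 w * f q.1)
      ((volume.restrict (Ioi (0 : ℝ))).prod (volume.restrict (Ioi (0 : ℝ)))) :=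
    ((continuousOn_coth_mul_weberProfile_mul_sinhPow hα w).aestronglyMeasurable_prod
      measurableSet_Ioi measurableSet_Ioi).mul hfm.comp_fst
  have hχ : MellinConvergent (weberProfile α) (-w) :=
    mellinConvergent_weberProfile hα (by simpa using h1) (by simpa using h2) (by simp; linarith)
  rw [integrable_prod_iff hm]
  constructor
  · filter_upwards [ae_restrict_mem measurableSet_Ioi] with x hx
    exact (integrableOn_coth_mul_comp_mul_sinhPow hx hχ).mul_const _
  · set B : ℝ := ‖1 / 2 * (4 : ℂ) ^ (-(w.re : ℂ))
      * mellin (fun u => ((‖weberProfile α u‖ : ℝ) : ℂ)) (-(w.re : ℂ))‖ with hB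
    refine (hf.norm.const_mul B).congr ?_
    filter_upwards [ae_restrict_mem measurableSet_Ioi] with x hx
    have hx0 : 0 < x := hx
    have e1 : ∫ θ in Ioi (0 : ℝ), ‖((Real.cosh θ / Real.sinh θ : ℝ) : ℂ)
        * weberProfile α (x * Real.sinh θ ^ 2) * sinhPow θ w * f x‖
        = (∫ θ in Ioi (0 : ℝ), ‖((Real.cosh θ / Real.sinh θ : ℝ) : ℂ)
        * weberProfile α (x * Real.sinh θ ^ 2) * sinhPow θ w‖) * ‖f x‖ := by
      rw [← integral_mul_const]
      exact integral_congr_ae (Eventually.of_forall fun θ => norm_mul _ _)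
    have e2 : ((∫ θ in Ioi (0 : ℝ), ‖((Real.cosh θ / Real.sinh θ : ℝ) : ℂ)
        * weberProfile α (x * Real.sinh θ ^ 2) * sinhPow θ w‖ : ℝ) : ℂ)
        = 1 / 2 * (4 : ℂ) ^ (-(w.re : ℂ)) * (x : ℂ) ^ (w.re : ℂ)
          * mellin (fun u => ((‖weberProfile α u‖ : ℝ) : ℂ)) (-(w.re : ℂ)) := by
      rw [← integral_coth_mul_comp_mul_sinhPow hx0, ← integral_complex_ofReal]
      refine setIntegral_congr_fun measurableSet_Ioi fun θ hθ => ?_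
      have h3 := Real.sinh_pos_iff.2 (mem_Ioi.1 hθ)
      have h4 := Real.cosh_pos θ
      simp only [norm_mul, Complex.norm_real]
      rw [norm_sinhPow hθ, Real.norm_of_nonneg (by positivity), sinhPow, Complex.ofReal_mul,
        Complex.ofReal_mul, Complex.ofReal_cpow (by positivity)]
      push_cast
      rfl
    have e3 : ∫ θ in Ioi (0 : ℝ), ‖((Real.cosh θ / Real.sinh θ : ℝ) : ℂ)
        * weberProfile α (x * Real.sinh θ ^ 2) * sinhPow θ w‖ = B * x ^ w.re := by
      have := congrArg norm e2
      rw [Complex.norm_real, Real.norm_of_nonneg (integral_nonneg fun _ => norm_nonneg _)] at this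
      rw [this, hB, mul_right_comm, norm_mul, ← Complex.ofReal_cpow hx0.le, Complex.norm_real,
        Real.norm_of_nonneg (Real.rpow_nonneg hx0.le _)]
    rw [e1, e3, norm_smul, Complex.norm_cpow_eq_rpow_re_of_pos hx0]
    simp
    ring

/-- The function of which `τ F_α f(τ)` is, up to a constant, the sine transform. -/
noncomputable def profileTransform (α : ℝ) (f : ℝ → ℂ) (θ : ℝ) : ℂ :=
  ∫ x in Ioi (0 : ℝ), ((Real.cosh θ / Real.sinh θ : ℝ) : ℂ) * weberProfile α (x * Real.sinh θ ^ 2)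
    * f x

lemma sinhPow_zero (θ : ℝ) : sinhPow θ 0 = 1 := by simp [sinhPow]

lemma integrable_coth_mul_weberProfile_mul {α : ℝ} (hα : 0 < α) {f : ℝ → ℂ}
    (hf : IntegrableOn f (Ioi (0 : ℝ))) :
    Integrable (fun q : ℝ × ℝ => ((Real.cosh q.2 / Real.sinh q.2 : ℝ) : ℂ)
      * weberProfile α (q.1 * Real.sinh q.2 ^ 2) * f q.1)
      ((volume.restrict (Ioi (0 : ℝ))).prod (volume.restrict (Ioi (0 : ℝ)))) := by
  have h := integrable_coth_mul_weberProfile_mul_sinhPow_mul hα hf.1 (w := 0) (by simp)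
    (by simpa) (by simp) (by simpa [MellinConvergent] using hf)
  simpa only [sinhPow_zero, mul_one] using h

lemma integrableOn_profileTransform {α : ℝ} (hα : 0 < α) {f : ℝ → ℂ}
    (hf : IntegrableOn f (Ioi (0 : ℝ))) : IntegrableOn (profileTransform α f) (Ioi 0) :=
  (integrable_coth_mul_weberProfile_mul hα hf).integral_prod_right

lemma continuousOn_profileTransform {α : ℝ} (hα : 0 < α) {f : ℝ → ℂ}
    (hf : IntegrableOn f (Ioi (0 : ℝ))) : ContinuousOn (profileTransform α f) (Ioi 0) := by
  obtain ⟨C, hC, hb⟩ := exists_norm_weberProfile_le (σ := 0) hα (by linarith) (by norm_num)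
    (by norm_num)
  have hcoth : ContinuousOn (fun θ : ℝ => ((Real.cosh θ / Real.sinh θ : ℝ) : ℂ)) (Ioi 0) :=
    Complex.continuous_ofReal.comp_continuousOn continuousOn_coth
  have e : profileTransform α f = fun θ => ((Real.cosh θ / Real.sinh θ : ℝ) : ℂ)
      * ∫ x in Ioi (0 : ℝ), weberProfile α (x * Real.sinh θ ^ 2) * f x := by
    funext θ
    rw [profileTransform, ← integral_const_mul]
    simp_rw [mul_assoc]
  rw [e]
  refine hcoth.mul (continuousOn_of_dominated (bound := fun x => C * ‖f x‖) ?_ ?_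
    (hf.norm.const_mul C) ?_)
  · intro θ hθ
    have h1 := Real.sinh_pos_iff.2 (mem_Ioi.1 hθ)
    refine AEStronglyMeasurable.mul (ContinuousOn.aestronglyMeasurable ?_ measurableSet_Ioi) hf.1
    refine (continuousOn_weberProfile hα).comp (by fun_prop) fun x hx => ?_
    have := mem_Ioi.1 hx
    exact mem_Ioi.2 (by positivity)
  · intro θ hθ
    have h1 := Real.sinh_pos_iff.2 (mem_Ioi.1 hθ)
    filter_upwards [ae_restrict_mem measurableSet_Ioi] with x hx
    have hx0 : 0 < x := hx
    rw [norm_mul]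
    gcongr
    simpa using hb (x * Real.sinh θ ^ 2) (by positivity)
  · filter_upwards [ae_restrict_mem measurableSet_Ioi] with x hx
    refine ContinuousOn.mul ?_ continuousOn_const
    refine (continuousOn_weberProfile hα).comp (by fun_prop) fun θ hθ => ?_
    have h1 := Real.sinh_pos_iff.2 (mem_Ioi.1 hθ)
    have := mem_Ioi.1 hx
    exact mem_Ioi.2 (by positivity)

/-- The sine representation of the kernel, integrated against `f`. -/
lemma integral_sin_mul_profileTransform {α τ : ℝ} (hα : 0 < α) (hτ : 0 < τ) {f : ℝ → ℂ}
    (hf : IntegrableOn f (Ioi (0 : ℝ))) :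
    ∫ θ in Ioi (0 : ℝ), (Real.sin (2 * τ * θ) : ℂ) * profileTransform α f θ
      = Real.pi ^ 2 / 2 * (τ * indexTransform α f τ) := by
  have hπ : (Real.pi : ℂ) ≠ 0 := by exact_mod_cast Real.pi_ne_zero
  have hK := integrable_coth_mul_weberProfile_mul hα hf
  have hK' : Integrable (fun q : ℝ × ℝ => (Real.sin (2 * τ * q.2) : ℂ)
      * (((Real.cosh q.2 / Real.sinh q.2 : ℝ) : ℂ)
      * weberProfile α (q.1 * Real.sinh q.2 ^ 2) * f q.1))
      ((volume.restrict (Ioi (0 : ℝ))).prod (volume.restrict (Ioi (0 : ℝ)))) := by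
    refine hK.norm.mono' (AEStronglyMeasurable.mul (Continuous.aestronglyMeasurable ?_) hK.1)
      (Eventually.of_forall fun q => ?_)
    · fun_prop
    · rw [norm_mul, Complex.norm_real]
      exact mul_le_of_le_one_left (norm_nonneg _) (Real.abs_sin_le_one _)
  have hswap := integral_integral_swap (f := fun x θ => (Real.sin (2 * τ * θ) : ℂ)
      * (((Real.cosh θ / Real.sinh θ : ℝ) : ℂ) * weberProfile α (x * Real.sinh θ ^ 2) * f x)) hK'
  simp only [profileTransform, ← integral_const_mul]
  rw [← hswap, indexTransform, ← integral_const_mul, ← integral_const_mul]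
  refine setIntegral_congr_fun measurableSet_Ioi fun x hx => ?_
  have hW := mul_weberKernel_eq hα (mem_Ioi.1 hx) hτ
  have e : ∫ θ in Ioi (0 : ℝ), (Real.sin (2 * τ * θ) : ℂ)
      * (((Real.cosh θ / Real.sinh θ : ℝ) : ℂ) * weberProfile α (x * Real.sinh θ ^ 2) * f x)
      = (∫ θ in Ioi (0 : ℝ), (sinCoth τ θ : ℂ) * weberProfile α (x * Real.sinh θ ^ 2)) * f x := by
    rw [← integral_mul_const]
    refine integral_congr_ae (Eventually.of_forall fun θ => ?_)
    simp only [sinCoth]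
    push_cast
    ring
  simp only [e]
  set J := ∫ θ in Ioi (0 : ℝ), (sinCoth τ θ : ℂ) * weberProfile α (x * Real.sinh θ ^ 2)
  have hJ : J = Real.pi ^ 2 / 2 * (τ * weberKernel α x τ) := by
    rw [hW]; field_simp
  rw [hJ]; ring

/-- Pairing with a power of `sinh` is, after the substitution `u = x sinh² θ`, a Mellin transform of a
Mellin convolution, and so factors. -/
lemma integral_profileTransform_mul_sinhPow {α ν : ℝ} (hα : 0 < α) (h0 : 0 ≤ ν) (h1 : ν < α)
    (h2 : ν < 1) {f : ℝ → ℂ} (hfm : AEStronglyMeasurable f (volume.restrict (Ioi (0 : ℝ)))) (t : ℝ)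
    (hf : MellinConvergent f (1 + (ν + t * Complex.I))) :
    ∫ θ in Ioi (0 : ℝ), profileTransform α f θ * sinhPow θ (ν + t * Complex.I)
      = 1 / 2 * (4 : ℂ) ^ (-(ν + t * Complex.I)) * profileMellin α (-(ν + t * Complex.I))
        * mellin f (1 + (ν + t * Complex.I)) := by
  set w : ℂ := ν + t * Complex.I with hw
  have hre : w.re = ν := by simp [hw]
  have hK := integrable_coth_mul_weberProfile_mul_sinhPow_mul hα hfm (w := w) (by rwa [hre])
    (by rwa [hre]) (by rwa [hre]) hf
  have hswap := integral_integral_swap (f := fun x θ => ((Real.cosh θ / Real.sinh θ : ℝ) : ℂ)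
      * weberProfile α (x * Real.sinh θ ^ 2) * sinhPow θ w * f x) hK
  have e1 : ∀ θ, profileTransform α f θ * sinhPow θ w = ∫ x in Ioi (0 : ℝ),
      ((Real.cosh θ / Real.sinh θ : ℝ) : ℂ) * weberProfile α (x * Real.sinh θ ^ 2) * sinhPow θ w
        * f x := by
    intro θ
    rw [profileTransform, ← integral_mul_const]
    refine integral_congr_ae (Eventually.of_forall fun x => ?_)
    simp only; ring
  simp only [e1]
  rw [← hswap, mellin, ← integral_const_mul]
  refine setIntegral_congr_fun measurableSet_Ioi fun x hx => ?_
  rw [integral_mul_const, integral_coth_mul_comp_mul_sinhPow (mem_Ioi.1 hx)]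
  have hM := mellin_weberProfile hα (σ := -ν) (by linarith) (by linarith) (by linarith) (-t)
  rw [show (((-ν : ℝ) : ℂ) + ((-t : ℝ) : ℂ) * Complex.I) = -w by rw [hw]; push_cast; ring] at hM
  rw [hM, show 1 + w - 1 = w by ring, smul_eq_mul]
  ring

/-- The pairing of the transform with `Γ(s + iτ) Γ(s - iτ)` is a multiple of the Mellin transform:
pair the sine representation of `τ F_α f(τ)` with powers of `sinh`. -/
lemma integral_mul_indexTransform_mul_gammaPair {α ν : ℝ} (h0 : 0 < ν) (h1 : ν < α)
    (h2 : ν < 1 / 2) {f : ℝ → ℂ} (hf : IntegrableOn f (Ioi (0 : ℝ))) (t : ℝ)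
    (hfν : MellinConvergent f (1 + (ν + t * Complex.I)))
    (hF : IntegrableOn (fun τ : ℝ => (τ : ℂ) * indexTransform α f τ) (Ioi 0)) :
    ∫ τ in Ioi (0 : ℝ), ((τ * Real.sinh (Real.pi * τ) : ℝ) : ℂ) * indexTransform α f τ
        * gammaPair τ (ν + t * Complex.I)
      = 1 / 2 * kernelMellin α (-(ν + t * Complex.I)) * mellin f (1 + (ν + t * Complex.I)) := by
  have hα : 0 < α := h0.trans h1
  have hπ : (Real.pi : ℂ) ≠ 0 := by exact_mod_cast Real.pi_ne_zero
  have hD := integral_profileTransform_mul_sinhPow hα h0.le h1 (by linarith) hf.1 t hfν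
  set w : ℂ := ν + t * Complex.I with hw
  have hre : w.re = ν := by simp [hw]
  have hS : ∀ τ ∈ Ioi (0 : ℝ), ∫ θ in Ioi (0 : ℝ), (Real.sin (2 * τ * θ) : ℂ)
      * profileTransform α f θ = Real.pi ^ 2 / 2 * (τ * indexTransform α f τ) := fun τ hτ =>
    integral_sin_mul_profileTransform hα hτ hf
  have hinv : ∀ θ ∈ Ioi (0 : ℝ), profileTransform α f θ
      = ∫ τ in Ioi (0 : ℝ), (Real.sin (2 * τ * θ) : ℂ) * (2 * Real.pi * (τ * indexTransform α f τ)) := by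
    intro θ hθ
    rw [eq_integral_sin_of_integrableOn (continuousOn_profileTransform hα hf)
      (integrableOn_profileTransform hα hf)
      (IntegrableOn.congr_fun (hF.const_mul (Real.pi ^ 2 / 2 : ℂ)) (fun τ hτ => (hS τ hτ).symm)
        measurableSet_Ioi) (mem_Ioi.1 hθ), ← integral_const_mul]
    refine setIntegral_congr_fun measurableSet_Ioi fun τ hτ => ?_
    simp only [hS τ hτ]
    field_simp
    ring
  have hpow := integrableOn_sinhPow (w := w) (by rwa [hre]) (by rwa [hre])
  have hint : Integrable (fun q : ℝ × ℝ => (Real.sin (2 * q.2 * q.1) : ℂ)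
      * (sinhPow q.1 w * (2 * Real.pi * (q.2 * indexTransform α f q.2))))
      ((volume.restrict (Ioi (0 : ℝ))).prod (volume.restrict (Ioi (0 : ℝ)))) := by
    have h3 := Integrable.mul_prod hpow (hF.const_mul (2 * Real.pi : ℂ))
    refine h3.norm.mono' (AEStronglyMeasurable.mul (Continuous.aestronglyMeasurable ?_) h3.1)
      (Eventually.of_forall fun q => ?_)
    · fun_prop
    · rw [norm_mul, Complex.norm_real]
      exact mul_le_of_le_one_left (norm_nonneg _) (Real.abs_sin_le_one _)
  have hswap := integral_integral_swap (f := fun θ τ => (Real.sin (2 * τ * θ) : ℂ)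
      * (sinhPow θ w * (2 * Real.pi * (τ * indexTransform α f τ)))) hint
  have hL : ∫ θ in Ioi (0 : ℝ), profileTransform α f θ * sinhPow θ w
      = ∫ θ in Ioi (0 : ℝ), ∫ τ in Ioi (0 : ℝ), (Real.sin (2 * τ * θ) : ℂ)
      * (sinhPow θ w * (2 * Real.pi * (τ * indexTransform α f τ))) := by
    refine setIntegral_congr_fun measurableSet_Ioi fun θ hθ => ?_
    rw [hinv θ hθ, ← integral_mul_const]
    refine integral_congr_ae (Eventually.of_forall fun τ => ?_)
    simp only; ring
  have hR : ∀ τ : ℝ, ∫ θ in Ioi (0 : ℝ), (Real.sin (2 * τ * θ) : ℂ)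
      * (sinhPow θ w * (2 * Real.pi * (τ * indexTransform α f τ)))
      = Complex.Gamma (1 - 2 * w) * Complex.cos (Real.pi * w)
        * (((τ * Real.sinh (Real.pi * τ) : ℝ) : ℂ) * indexTransform α f τ * gammaPair τ w) := by
    intro τ
    have h3 := integral_sin_mul_sinhPow (w := w) (by rwa [hre]) (by rwa [hre]) τ
    have e : ∀ θ : ℝ, (Real.sin (2 * τ * θ) : ℂ)
      * (sinhPow θ w * (2 * Real.pi * (τ * indexTransform α f τ)))
      = Complex.sin (2 * τ * θ) * sinhPow θ w * (2 * Real.pi * (τ * indexTransform α f τ)) := by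
      intro θ; push_cast; ring
    simp only [e]
    rw [integral_mul_const, h3]
    push_cast
    field_simp
  rw [hL, hswap] at hD
  simp only [hR] at hD
  rw [integral_const_mul] at hD
  have hG : Complex.Gamma (1 - 2 * w) ≠ 0 :=
    Complex.Gamma_ne_zero_of_re_pos (by simp [hre]; linarith)
  have hne : w ≠ 0 := fun h => by rw [h] at hre; simp at hre; linarith
  have hs2 : Complex.sin (Real.pi * (2 * w)) ≠ 0 := sin_pi_mul_ne_zero_of_forall_ne_intCast
    (ne_intCast_of_abs_re_lt_one (by simp [hre]; linarith) (by simp [hre]; linarith)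
      (by simpa using hne))
  have hdbl : Complex.sin (Real.pi * (2 * w))
      = 2 * Complex.sin (Real.pi * w) * Complex.cos (Real.pi * w) := by
    rw [show (Real.pi * (2 * w) : ℂ) = 2 * (Real.pi * w) by ring, Complex.sin_two_mul]
  rw [hdbl] at hs2
  have hs : Complex.sin (Real.pi * w) ≠ 0 := fun h => hs2 (by rw [h]; ring)
  have hc : Complex.cos (Real.pi * w) ≠ 0 := fun h => hs2 (by rw [h]; ring)
  refine mul_left_cancel₀ (mul_ne_zero hG hc) (hD.trans ?_)
  -- `Γ(1+w) Γ(1-w) = Γ(1+2w) Γ(1-2w) cos πw`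
  have g1 := Gamma_one_add_mul_Gamma_one_sub hne
  have g2 := Gamma_one_add_mul_Gamma_one_sub (w := 2 * w) (by simpa using hne)
  rw [hdbl] at g2
  have g3 : Complex.Gamma (1 + w) * Complex.Gamma (1 - w)
      = Complex.Gamma (1 + 2 * w) * Complex.Gamma (1 - 2 * w) * Complex.cos (Real.pi * w) := by
    rw [g1, g2]; field_simp
  rw [profileMellin, kernelMellin, sub_neg_eq_add, show (1 : ℂ) + -w = 1 - w by ring,
    show (1 : ℂ) - 2 * -w = 1 + 2 * w by ring, show (1 : ℂ) + α - -w = 1 + α + w by ring]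
  linear_combination (1 / 2 * (4 : ℂ) ^ (-w) * Complex.Gamma (-w + α) / Complex.Gamma (1 + α + w)
    * mellin f (1 + w)) * g3

/-! ### The Euler product for the sine -/

/-- The partial products `∏_{n ≤ N} (1 - 4 s² / n²)` of the product for `sin (2πs) / (2πs)`. -/
noncomputable def sinProd (N : ℕ) (s : ℂ) : ℂ :=
  ∏ n ∈ Finset.range N, (1 - (2 * s) ^ 2 / ((n : ℂ) + 1) ^ 2)

lemma tendsto_sinProd {s : ℂ} (hs : s ≠ 0) :
    Tendsto (fun N => sinProd N s) atTop
      (𝓝 (Complex.sin (Real.pi * (2 * s)) / (Real.pi * (2 * s)))) := by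
  have hπ : (Real.pi : ℂ) ≠ 0 := by exact_mod_cast Real.pi_ne_zero
  refine ((Complex.tendsto_euler_sin_prod (2 * s)).div_const (Real.pi * (2 * s))).congr fun N => ?_
  rw [mul_div_cancel_left₀]
  · rfl
  · simp [hs, hπ]

lemma norm_one_sub_sq_ge {w : ℂ} (h : |w.re| ≤ 1) : 1 - w.re ^ 2 ≤ ‖1 - w ^ 2‖ := by
  have h1 := abs_le.1 h
  have e : 1 - w ^ 2 = (1 - w) * (1 + w) := by ring
  have h2 : 1 - w.re ≤ ‖1 - w‖ := by simpa using Complex.re_le_norm (1 - w)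
  have h3 : 1 + w.re ≤ ‖1 + w‖ := by simpa using Complex.re_le_norm (1 + w)
  rw [e, norm_mul]
  calc 1 - w.re ^ 2 = (1 - w.re) * (1 + w.re) := by ring
    _ ≤ _ := mul_le_mul h2 h3 (by linarith) (norm_nonneg _)

/-- Each factor of the product is, in norm, at least its value at the real part of `s`. -/
lemma norm_sinProd_mul_le {s : ℂ} (h : |2 * s.re| ≤ 1) {N M : ℕ} (hNM : N ≤ M) :
    ‖sinProd N s‖ * ∏ n ∈ Finset.range M, (1 - (2 * s.re) ^ 2 / ((n : ℝ) + 1) ^ 2)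
      ≤ ‖sinProd M s‖ := by
  have hsq : (2 * s.re) ^ 2 ≤ 1 := by rw [← sq_abs]; exact pow_le_one₀ (abs_nonneg _) h
  have hf : ∀ n : ℕ, (2 * s.re) ^ 2 / ((n : ℝ) + 1) ^ 2 ≤ 1 := fun n => by
    rw [div_le_one (by positivity)]
    have : (0 : ℝ) ≤ n := n.cast_nonneg
    nlinarith
  have hf0 : ∀ n : ℕ, 0 ≤ 1 - (2 * s.re) ^ 2 / ((n : ℝ) + 1) ^ 2 := fun n => by linarith [hf n]
  induction M, hNM using Nat.le_induction with
  | base =>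
    refine mul_le_of_le_one_right (norm_nonneg _) (Finset.prod_le_one (fun n _ => hf0 n) fun n _ => ?_)
    have : 0 ≤ (2 * s.re) ^ 2 / ((n : ℝ) + 1) ^ 2 := by positivity
    linarith
  | succ M _ ih =>
    have e : sinProd (M + 1) s = sinProd M s * (1 - (2 * s / ((M : ℝ) + 1 : ℝ)) ^ 2) := by
      rw [sinProd, sinProd, Finset.prod_range_succ]
      push_cast
      rw [div_pow]
    have hre : (2 * s / ((M : ℝ) + 1 : ℝ)).re = 2 * s.re / ((M : ℝ) + 1) := by
      rw [Complex.div_ofReal_re]; simp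
    have hM1 : (0 : ℝ) < (M : ℝ) + 1 := by positivity
    have h1 := norm_one_sub_sq_ge (w := 2 * s / ((M : ℝ) + 1 : ℝ)) (by
      rw [hre, abs_div, abs_of_pos hM1, div_le_one hM1]
      have : (0 : ℝ) ≤ M := M.cast_nonneg
      linarith)
    rw [hre, div_pow] at h1
    rw [Finset.prod_range_succ, e, norm_mul, ← mul_assoc]
    exact mul_le_mul ih h1 (hf0 M) (norm_nonneg _)

/-- The partial products stay below a fixed multiple of the limit, on a vertical line. The condition
`re s < 1/2` keeps the comparison product, with factors `1 - 4 (re s)² / n²`, away from `0`. -/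
lemma norm_sinProd_mul_div_sin_le {s : ℂ} (h0 : 0 < s.re) (h1 : s.re < 1 / 2) (N : ℕ) :
    ‖sinProd N s * (Real.pi * (2 * s) / Complex.sin (Real.pi * (2 * s)))‖
      ≤ Real.pi * (2 * s.re) / Real.sin (Real.pi * (2 * s.re)) := by
  have hπ := Real.pi_pos
  have hs : s ≠ 0 := fun h => by rw [h] at h0; simp at h0
  have hsin : Complex.sin (Real.pi * (2 * s)) ≠ 0 := sin_pi_mul_ne_zero_of_forall_ne_intCast
    (ne_intCast_of_abs_re_lt_one (by simp; linarith) (by simp; linarith) (by simpa using hs))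
  have hsr : 0 < Real.sin (Real.pi * (2 * s.re)) :=
    Real.sin_pos_of_pos_of_lt_pi (by positivity) (by nlinarith)
  have hr : Tendsto (fun M => ∏ n ∈ Finset.range M, (1 - (2 * s.re) ^ 2 / ((n : ℝ) + 1) ^ 2)) atTop
      (𝓝 (Real.sin (Real.pi * (2 * s.re)) / (Real.pi * (2 * s.re)))) := by
    refine ((Real.tendsto_euler_sin_prod (2 * s.re)).div_const (Real.pi * (2 * s.re))).congr
      fun M => ?_
    rw [mul_div_cancel_left₀]
    positivity
  have hle := le_of_tendsto_of_tendsto (hr.const_mul ‖sinProd N s‖) (tendsto_sinProd hs).norm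
    (eventually_atTop.2 ⟨N, fun M hM => norm_sinProd_mul_le (by
      rw [abs_of_pos (by linarith)]; linarith) hM⟩)
  have hz : 0 < ‖(Real.pi * (2 * s) : ℂ)‖ := norm_pos_iff.2 (by simp [hs, hπ.ne'])
  have hsn : 0 < ‖Complex.sin (Real.pi * (2 * s))‖ := norm_pos_iff.2 hsin
  rw [norm_div] at hle
  rw [norm_mul, norm_div, le_div_iff₀ hsr]
  rw [mul_div_assoc', div_le_div_iff₀ (by positivity) hz] at hle
  rw [mul_div_assoc', div_mul_eq_mul_div, div_le_iff₀ hsn]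
  linarith

/-! ### Fourier and Mellin inversion almost everywhere -/

open scoped FourierTransform in
/-- Fourier inversion almost everywhere: both sides have the same integral against test functions,
because the Fourier transform is self-adjoint. -/
lemma fourierInv_fourier_ae_eq {g : ℝ → ℂ} (hg : Integrable g) (hF : Integrable (𝓕 g)) :
    g =ᵐ[volume] 𝓕⁻ (𝓕 g) := by
  have hself : ∀ (η : SchwartzMap ℝ ℂ) (k : ℝ → ℂ), Integrable k →
      ∫ ξ, 𝓕 (η : ℝ → ℂ) ξ • k ξ = ∫ x, η x • 𝓕 k x := fun η k hk => by
    simpa using! VectorFourier.integral_fourierIntegral_smul_eq_flip (L := innerₗ ℝ)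
      Real.continuous_fourierChar continuous_inner η.integrable hk
  have hcont : Continuous (𝓕⁻ (𝓕 g)) := by
    have h1 : Continuous (𝓕 (𝓕 g)) := VectorFourier.fourierIntegral_continuous
      Real.continuous_fourierChar continuous_inner hF
    have h2 : 𝓕⁻ (𝓕 g) = fun x => 𝓕 (𝓕 g) (-x) := by
      funext x; exact Real.fourierInv_eq_fourier_neg _ _
    rw [h2]
    exact h1.comp continuous_neg
  refine ae_eq_of_integral_contDiff_smul_eq hg.locallyIntegrable hcont.locallyIntegrable
    fun φ hφ hφc => ?_
  have hcs : HasCompactSupport fun x => (φ x : ℂ) := hφc.comp_left (g := fun r : ℝ => (r : ℂ)) rfl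
  set ψ : SchwartzMap ℝ ℂ := hcs.toSchwartzMap (Complex.ofRealCLM.contDiff.comp hφ) with hψ
  have hψx : ∀ x, ψ x = φ x := fun x => rfl
  set η : SchwartzMap ℝ ℂ := 𝓕⁻ ψ with hη
  have hηc : (η : ℝ → ℂ) = 𝓕⁻ (ψ : ℝ → ℂ) := SchwartzMap.fourierInv_coe ψ
  have hFη : 𝓕 (η : ℝ → ℂ) = ψ := by
    rw [← SchwartzMap.fourier_coe, hη, FourierTransform.fourier_fourierInv_eq]
  have h1 := hself η g hg
  set ψ' : SchwartzMap ℝ ℂ := 𝓕 (𝓕 ψ) with hψ'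
  have hψ'x : ∀ x, ψ' x = ψ (-x) := fun x => by
    rw [hψ', SchwartzMap.fourier_coe]
    have := Real.fourierInv_eq_fourier_neg (𝓕 ψ : SchwartzMap ℝ ℂ) (-x)
    rw [neg_neg] at this
    rw [← this, ← SchwartzMap.fourierInv_coe, FourierTransform.fourierInv_fourier_eq]
  have hFψ : 𝓕 (ψ' : ℝ → ℂ) = η := by
    rw [funext hψ'x, hηc, Real.fourierInv_eq_fourier_comp_neg]
  have h2 := hself ψ' (𝓕 g) hF
  rw [hFη] at h1
  rw [hFψ] at h2
  have e1 : ∫ x, φ x • g x = ∫ x, ψ x • g x := by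
    simp only [hψx, Complex.real_smul, smul_eq_mul]
  have e2 : ∫ x, φ x • 𝓕⁻ (𝓕 g) x = ∫ x, ψ' x • 𝓕 (𝓕 g) x := by
    rw [← integral_neg_eq_self]
    refine integral_congr_ae (Eventually.of_forall fun x => ?_)
    simp only
    rw [hψ'x, hψx, Real.fourierInv_eq_fourier_neg, neg_neg, Complex.real_smul, smul_eq_mul]
  rw [e1, e2, h1, ← h2]

open scoped FourierTransform in
/-- Mellin inversion almost everywhere. -/
lemma mellinInv_mellin_ae_eq {h : ℝ → ℂ} {σ : ℝ} (hm : MellinConvergent h σ)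
    (hF : Integrable fun t : ℝ => mellin h (σ + t * Complex.I)) :
    h =ᵐ[volume.restrict (Ioi (0 : ℝ))] mellinInv σ (mellin h) := by
  set g : ℝ → ℂ := fun u => Real.exp (-σ * u) • h (Real.exp (-u)) with hg
  have hgi : Integrable g := integrable_exp_smul_comp_exp_neg hm
  have hM : ∀ t : ℝ, mellin h (σ + t * Complex.I) = 𝓕 g (t / (2 * Real.pi)) := fun t => by
    rw [mellin_eq_fourier]; simp [hg]
  have h2π : (2 * Real.pi : ℝ) ≠ 0 := by positivity
  have hFi : Integrable (𝓕 g) := by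
    have := hF.comp_mul_left' h2π
    simp only [hM] at this
    simpa [mul_div_cancel_left₀ _ h2π] using this
  have hae := fourierInv_fourier_ae_eq hgi hFi
  -- the exceptional null set is transported by the smooth map `u ↦ exp (-u)`
  have hnull : volume ((fun u : ℝ => Real.exp (-u)) '' {u | ¬ g u = 𝓕⁻ (𝓕 g) u}) = 0 :=
    addHaar_image_eq_zero_of_differentiableOn_of_addHaar_eq_zero volume
      (by fun_prop : Differentiable ℝ fun u : ℝ => Real.exp (-u)).differentiableOn hae
  have hout := measure_eq_zero_iff_ae_notMem.1 hnull
  filter_upwards [ae_restrict_of_ae hout, ae_restrict_mem measurableSet_Ioi] with x hx hx0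
  have hx0' : 0 < x := hx0
  have hgx : g (-Real.log x) = 𝓕⁻ (𝓕 g) (-Real.log x) := by
    by_contra hne
    exact hx ⟨-Real.log x, hne, by simp [Real.exp_log hx0']⟩
  have hinner : (fun y : ℝ => mellin h (σ + 2 * Real.pi * y * Complex.I)) = 𝓕 g := by
    funext y
    have := hM (2 * Real.pi * y)
    rw [mul_div_cancel_left₀ _ h2π] at this
    rw [← this]; push_cast; rfl
  rw [mellinInv_eq_fourierInv σ _ hx0', hinner, ← hgx]
  simp only [hg]
  rw [neg_neg, Real.exp_log hx0', Complex.real_smul, smul_eq_mul, ← mul_assoc,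
    show (-(σ : ℂ)) = ((-σ : ℝ) : ℂ) by push_cast; rfl, ← Complex.ofReal_cpow hx0'.le,
    ← Complex.ofReal_mul, show -σ * -Real.log x = Real.log x * σ by ring,
    ← Real.rpow_def_of_pos hx0', ← Real.rpow_add hx0']
  simp

/-! ### Differentiation under the Mellin–Barnes integral -/

/-- `φ` is continuous and decays exponentially. -/
def ExpDecay (φ : ℝ → ℂ) : Prop :=
  Continuous φ ∧ ∃ C c : ℝ, 0 < c ∧ ∀ t, ‖φ t‖ ≤ C * Real.exp (-c * |t|)

lemma ExpDecay.integrable {φ : ℝ → ℂ} (h : ExpDecay φ) : Integrable φ := by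
  obtain ⟨hc, C, c, hc0, hb⟩ := h
  exact integrable_of_exp_bound hc hc0 (T := 0) fun t _ => hb t

lemma ExpDecay.const_mul {φ : ℝ → ℂ} (h : ExpDecay φ) (k : ℂ) : ExpDecay fun t => k * φ t := by
  obtain ⟨hc, C, c, hc0, hb⟩ := h
  refine ⟨by fun_prop, ‖k‖ * C, c, hc0, fun t => ?_⟩
  rw [norm_mul, mul_assoc]
  gcongr
  exact hb t

lemma ExpDecay.add {φ ψ : ℝ → ℂ} (h : ExpDecay φ) (h' : ExpDecay ψ) :
    ExpDecay fun t => φ t + ψ t := by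
  obtain ⟨hc, C, c, hc0, hb⟩ := h
  obtain ⟨hc', C', c', hc0', hb'⟩ := h'
  have hC : 0 ≤ C := by have := (norm_nonneg _).trans (hb 0); simpa using this
  have hC' : 0 ≤ C' := by have := (norm_nonneg _).trans (hb' 0); simpa using this
  refine ⟨by fun_prop, C + C', min c c', lt_min hc0 hc0', fun t => (norm_add_le _ _).trans ?_⟩
  rw [add_mul]
  refine add_le_add ((hb t).trans ?_) ((hb' t).trans ?_)
  · gcongr; exact min_le_left _ _
  · gcongr; exact min_le_right _ _

lemma ExpDecay.mul_vertical {φ : ℝ → ℂ} (h : ExpDecay φ) (σ : ℝ) :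
    ExpDecay fun t => (σ + t * Complex.I) * φ t := by
  obtain ⟨hc, C, c, hc0, hb⟩ := h
  have hC : 0 ≤ C := by have := (norm_nonneg _).trans (hb 0); simpa using this
  refine ⟨by fun_prop, (|σ| + 2 / c) * C, c / 2, by positivity, fun t => ?_⟩
  have h1 : ‖(σ + t * Complex.I : ℂ)‖ ≤ |σ| + |t| := by
    refine (norm_add_le _ _).trans ?_
    simp
  have h2 : |σ| + |t| ≤ (|σ| + 2 / c) * Real.exp (c / 2 * |t|) := by
    have := Real.add_one_le_exp (c / 2 * |t|)
    have h3 : 1 ≤ Real.exp (c / 2 * |t|) := Real.one_le_exp (by positivity)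
    have h4 : |t| = 2 / c * (c / 2 * |t|) := by field_simp
    have h5 : |t| ≤ 2 / c * Real.exp (c / 2 * |t|) := by
      conv_lhs => rw [h4]
      gcongr
      linarith
    nlinarith [abs_nonneg σ]
  rw [norm_mul]
  calc _ ≤ (|σ| + 2 / c) * Real.exp (c / 2 * |t|) * (C * Real.exp (-c * |t|)) := by
        gcongr
        · exact h1.trans h2
        · exact hb t
    _ = (|σ| + 2 / c) * C * Real.exp (c / 2 * |t| + -c * |t|) := by rw [Real.exp_add]; ring
    _ = _ := by ring_nf

/-- `∫ φ(t) y^{-(σ + it)} dt`. -/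
noncomputable def verticalTransform (σ : ℝ) (φ : ℝ → ℂ) (y : ℝ) : ℂ :=
  ∫ t : ℝ, φ t * (y : ℂ) ^ (-(σ + t * Complex.I))

lemma integrable_mul_cpow_vertical {φ : ℝ → ℂ} (h : Integrable φ) (σ : ℝ) {y : ℝ} (hy : 0 < y) :
    Integrable fun t : ℝ => φ t * (y : ℂ) ^ (-(σ + t * Complex.I)) := by
  have hc : Continuous fun t : ℝ => (y : ℂ) ^ (-(σ + t * Complex.I)) :=
    Continuous.const_cpow (by fun_prop) (Or.inl (by exact_mod_cast hy.ne'))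
  refine (h.norm.mul_const (y ^ (-σ))).mono' (h.1.mul hc.aestronglyMeasurable)
    (Eventually.of_forall fun t => ?_)
  rw [norm_mul, Complex.norm_cpow_eq_rpow_re_of_pos hy]
  simp

/-- Differentiation under the integral sign. -/
lemma hasDerivAt_verticalTransform {φ : ℝ → ℂ} (h : ExpDecay φ) (σ : ℝ) {y : ℝ} (hy : 0 < y) :
    HasDerivAt (verticalTransform σ φ)
      ((y : ℂ)⁻¹ * verticalTransform σ (fun t => -((σ + t * Complex.I) * φ t)) y) y := by
  have hφ := h.integrable
  have hsφ := (h.mul_vertical σ).integrable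
  have hy2 : 0 < y / 2 := by positivity
  have hball : ∀ z ∈ Metric.ball y (y / 2), y / 2 < z := fun z hz => by
    have := abs_lt.1 (Metric.mem_ball.1 hz); linarith
  obtain ⟨C, hC, hbd⟩ : ∃ C : ℝ, 0 ≤ C ∧ ∀ z ∈ Metric.ball y (y / 2), z ^ (-σ - 1) ≤ C := by
    refine ⟨(y / 2) ^ (-σ - 1) + (3 * y / 2) ^ (-σ - 1), by positivity, fun z hz => ?_⟩
    have h1 := hball z hz
    have h2 : z < 3 * y / 2 := by have := abs_lt.1 (Metric.mem_ball.1 hz); linarith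
    rcases le_total 0 (-σ - 1) with h3 | h3
    · have := Real.rpow_le_rpow (by linarith) h2.le h3
      have : 0 ≤ (y / 2) ^ (-σ - 1) := by positivity
      linarith
    · have := Real.rpow_le_rpow_of_nonpos hy2 h1.le h3
      have : 0 ≤ (3 * y / 2) ^ (-σ - 1) := by positivity
      linarith
  have key := (hasDerivAt_integral_of_dominated_loc_of_deriv_le (μ := volume)
    (F := fun (z : ℝ) (t : ℝ) => φ t * (z : ℂ) ^ (-(σ + t * Complex.I)))
    (F' := fun (z : ℝ) (t : ℝ) => φ t * (-(σ + t * Complex.I) * (z : ℂ) ^ (-(σ + t * Complex.I) - 1)))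
    (x₀ := y) (s := Metric.ball y (y / 2))
    (bound := fun t => C * ‖(σ + t * Complex.I) * φ t‖) (Metric.ball_mem_nhds y hy2) ?_
    (integrable_mul_cpow_vertical hφ σ hy) ?_ ?_ (hsφ.norm.const_mul C) ?_).2
  · refine key.congr_deriv ?_
    rw [verticalTransform, ← integral_const_mul]
    refine integral_congr_ae (Eventually.of_forall fun t => ?_)
    have hy' : (y : ℂ) ≠ 0 := by exact_mod_cast hy.ne'
    simp only
    rw [Complex.cpow_sub _ _ hy', Complex.cpow_one]
    field_simp
  · filter_upwards [lt_mem_nhds hy] with z hz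
    exact (integrable_mul_cpow_vertical hφ σ hz).1
  · refine hφ.1.mul (Continuous.aestronglyMeasurable ?_)
    exact Continuous.mul (by fun_prop)
      (Continuous.const_cpow (by fun_prop) (Or.inl (by exact_mod_cast hy.ne')))
  · refine Eventually.of_forall fun t z hz => ?_
    have hz0 : 0 < z := by have := hball z hz; linarith
    rw [norm_mul, norm_mul, norm_neg, Complex.norm_cpow_eq_rpow_re_of_pos hz0, norm_mul]
    have e : (-(σ + t * Complex.I : ℂ) - 1).re = -σ - 1 := by simp
    rw [e]
    have := hbd z hz
    calc _ = z ^ (-σ - 1) * (‖(σ + t * Complex.I : ℂ)‖ * ‖φ t‖) := by ring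
      _ ≤ _ := by gcongr
  · refine Eventually.of_forall fun t z hz => HasDerivAt.const_mul _ ?_
    have hz0 : 0 < z := by have := hball z hz; linarith
    have h1 := (hasDerivAt_id (z : ℂ)).cpow_const (c := -(σ + t * Complex.I))
      (Complex.ofReal_mem_slitPlane.2 hz0)
    have h2 := h1.comp_ofReal
    simpa using h2

/-- The operator `y d/dy` multiplies the density by `-(σ + it)`. -/
lemma eulerOp_eq_verticalTransform {u : ℝ → ℝ} {φ : ℝ → ℂ} (h : ExpDecay φ) {σ : ℝ}
    (hu : ∀ y : ℝ, 0 < y → (u y : ℂ) = verticalTransform σ φ y) {y : ℝ} (hy : 0 < y) :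
    (eulerOp u y : ℂ) = verticalTransform σ (fun t => -((σ + t * Complex.I) * φ t)) y := by
  have h1 : HasDerivAt (fun z => (u z : ℂ)) _ y :=
    (hasDerivAt_verticalTransform h σ hy).congr_of_eventuallyEq (by
      filter_upwards [lt_mem_nhds hy] with z hz using hu z hz)
  have h2 : DifferentiableAt ℝ u y := by
    have := (Complex.reCLM.hasFDerivAt.comp_hasDerivAt y h1).differentiableAt
    simpa [Function.comp_def] using this
  have h3 := h1.unique h2.hasDerivAt.ofReal_comp
  rw [eulerOp, Complex.ofReal_mul, ← h3, mul_inv_cancel_left₀ (by exact_mod_cast hy.ne')]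

lemma ExpDecay.sinProd_mul {φ : ℝ → ℂ} (h : ExpDecay φ) (σ : ℝ) (N : ℕ) :
    ExpDecay fun t => sinProd N (σ + t * Complex.I) * φ t := by
  induction N with
  | zero => simpa [sinProd] using h
  | succ N ih =>
    have h2 := ih.add (((ih.mul_vertical σ).mul_vertical σ).const_mul (-4 / ((N : ℂ) + 1) ^ 2))
    convert h2 using 2 with t
    rw [sinProd, Finset.prod_range_succ, ← sinProd]
    ring

lemma verticalTransform_sub_mul_sq {φ : ℝ → ℂ} (h : ExpDecay φ) (σ : ℝ) (a k : ℂ) {y : ℝ}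
    (hy : 0 < y) :
    a * verticalTransform σ φ y - k * verticalTransform σ
      (fun t => -((σ + t * Complex.I) * -((σ + t * Complex.I) * φ t))) y
      = verticalTransform σ (fun t => (a - k * (σ + t * Complex.I) ^ 2) * φ t) y := by
  have h1 := integrable_mul_cpow_vertical h.integrable σ hy
  have h2 := integrable_mul_cpow_vertical ((h.mul_vertical σ).mul_vertical σ).integrable σ hy
  have e : (fun t : ℝ => -((σ + t * Complex.I) * -((σ + t * Complex.I) * φ t)))
      = fun t : ℝ => (σ + t * Complex.I) * ((σ + t * Complex.I) * φ t) := by funext t; ring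
  rw [e, verticalTransform, verticalTransform, verticalTransform, ← integral_const_mul,
    ← integral_const_mul, ← integral_sub (h1.const_mul a) (h2.const_mul k)]
  refine integral_congr_ae (Eventually.of_forall fun t => ?_)
  simp only
  ring

lemma ExpDecay.neg {φ : ℝ → ℂ} (h : ExpDecay φ) : ExpDecay fun t => -φ t := by
  simpa using h.const_mul (-1)

lemma prodOp_eq_verticalTransform {u : ℝ → ℝ} {φ : ℝ → ℂ} (h : ExpDecay φ) {σ : ℝ}
    (hu : ∀ y : ℝ, 0 < y → (u y : ℂ) = verticalTransform σ φ y) (N : ℕ) :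
    ∀ y : ℝ, 0 < y → (prodOp N u y : ℂ)
      = verticalTransform σ (fun t => sinProd N (σ + t * Complex.I) * φ t) y := by
  induction N with
  | zero => intro y hy; simpa [prodOp, sinProd] using hu y hy
  | succ N ih =>
    intro y hy
    have hd := h.sinProd_mul σ N
    have h1 := eulerOp_eq_verticalTransform (hd.mul_vertical σ).neg
      (fun z hz => eulerOp_eq_verticalTransform hd ih hz) hy
    have h2 := verticalTransform_sub_mul_sq hd σ 1 (4 / ((N : ℂ) + 1) ^ 2) hy
    rw [one_mul] at h2
    rw [prodOp]
    push_cast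
    rw [ih y hy, h1, h2]
    congr 1
    funext t
    rw [sinProd, sinProd, Finset.prod_range_succ]
    ring

lemma inversionOp_eq_verticalTransform {α : ℝ} {u : ℝ → ℝ} {φ : ℝ → ℂ} (h : ExpDecay φ) {σ : ℝ}
    (hu : ∀ y : ℝ, 0 < y → (u y : ℂ) = verticalTransform σ φ y) (N : ℕ) {y : ℝ} (hy : 0 < y) :
    (inversionOp α N u y : ℂ) = verticalTransform σ (fun t => sinProd N (σ + t * Complex.I)
      * ((α ^ 2 - (σ + t * Complex.I) ^ 2) * φ t)) y := by
  have hd : ExpDecay fun t => ((α : ℂ) ^ 2 - (σ + t * Complex.I) ^ 2) * φ t := by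
    have := (h.const_mul ((α : ℂ) ^ 2)).add ((h.mul_vertical σ).mul_vertical σ).neg
    convert this using 2 with t
    ring
  refine prodOp_eq_verticalTransform hd (fun z hz => ?_) N y hy
  have h1 := eulerOp_eq_verticalTransform (h.mul_vertical σ).neg
    (fun z hz => eulerOp_eq_verticalTransform h hu hz) hz
  have h2 := verticalTransform_sub_mul_sq h σ ((α : ℂ) ^ 2) 1 hz
  simp only [one_mul] at h2
  push_cast
  rw [hu z hz, h1, h2]

/-! ### The inversion formula -/

/-- The powers of `4` and the Gamma factors in `α` cancel, and the reflection formula remains for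
`Γ(1 - 2s) Γ(1 + 2s)`. -/
lemma sq_sub_sq_mul_kernelMellin_mul {α : ℝ} {s : ℂ} (h0 : 0 < s.re) (h1 : s.re < α) :
    ((α : ℂ) ^ 2 - s ^ 2) * kernelMellin α s * kernelMellin α (-s)
      = Real.pi * (2 * s) / Complex.sin (Real.pi * (2 * s)) := by
  have hs : s ≠ 0 := fun h => by rw [h] at h0; simp at h0
  have n1 : (α : ℂ) + s ≠ 0 := fun h => by
    have := congrArg Complex.re h; simp at this; linarith
  have n2 : (α : ℂ) - s ≠ 0 := fun h => by
    have := congrArg Complex.re h; simp at this; linarith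
  have g1 : Complex.Gamma (1 + α - s) = (α - s) * Complex.Gamma (α - s) := by
    rw [← Complex.Gamma_add_one _ n2]; congr 1; ring
  have g2 : Complex.Gamma (1 + α + s) = (α + s) * Complex.Gamma (α + s) := by
    rw [← Complex.Gamma_add_one _ n1]; congr 1; ring
  have z1 : Complex.Gamma (α - s) ≠ 0 := Complex.Gamma_ne_zero_of_re_pos (by simp; linarith)
  have z2 : Complex.Gamma (α + s) ≠ 0 := Complex.Gamma_ne_zero_of_re_pos (by simp; linarith)
  have g3 := Gamma_one_add_mul_Gamma_one_sub (w := 2 * s) (by simpa using hs)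
  have h4 : (4 : ℂ) ^ s * (4 : ℂ) ^ (-s) = 1 := by
    rw [← Complex.cpow_add _ _ (by norm_num)]; simp
  rw [← g3, kernelMellin, kernelMellin, sub_neg_eq_add, show (1 : ℂ) - 2 * -s = 1 + 2 * s by ring,
    g1, g2, show s + (α : ℂ) = α + s by ring, show -s + (α : ℂ) = α - s by ring]
  have e : ((α : ℂ) ^ 2 - s ^ 2) = (α - s) * (α + s) := by ring
  rw [e]
  generalize Complex.Gamma (1 + 2 * s) = p
  generalize Complex.Gamma (1 - 2 * s) = q
  field_simp
  linear_combination (p * q) * h4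

lemma expDecay_kernelMellin {α ν : ℝ} (h0 : -α < ν) (h1 : ν < 1 / 2) :
    ExpDecay fun t => kernelMellin α (ν + t * Complex.I) := by
  obtain ⟨C, _, hb⟩ := exists_norm_kernelMellin_le (α := α) h0 h1
  refine ⟨?_, C, Real.pi / 2, by positivity, fun t => ?_⟩
  · exact continuous_comp_vertical (a := ν) (b := ν) (fun z hz =>
      (differentiableAt_kernelMellin (by linarith [hz.1])
        (by linarith [hz.2])).continuousAt.continuousWithinAt) le_rfl le_rfl
  · simpa using hb (ν + t * Complex.I) (by simp) (by simp)

lemma continuous_gammaPair_vertical {ν : ℝ} (h0 : 0 < ν) :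
    Continuous fun q : ℝ × ℝ => gammaPair q.1 (ν + q.2 * Complex.I) := by
  unfold gammaPair
  refine Continuous.mul ?_ ?_
  all_goals
    refine continuous_iff_continuousAt.2 fun q => ?_
    refine ContinuousAt.comp (g := Complex.Gamma)
      (differentiableAt_Gamma_of_re_pos (by simpa using h0)).continuousAt ?_
    fun_prop

lemma ExpDecay.gammaPair_mul {φ : ℝ → ℂ} (h : ExpDecay φ) {ν : ℝ} (h0 : 0 < ν) (τ : ℝ) :
    ExpDecay fun t => gammaPair τ (ν + t * Complex.I) * φ t := by
  obtain ⟨hc, C, c, hc0, hb⟩ := h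
  obtain ⟨C', hC', hb'⟩ := exists_norm_gammaPair_le (a := ν) (b := ν) h0
  refine ⟨((continuous_gammaPair_vertical h0).comp (Continuous.prodMk_right τ)).mul hc,
    C' * C, c, hc0, fun t => ?_⟩
  have h1 := hb' τ (ν + t * Complex.I) (by simp) (by simp)
  have h2 : Real.exp (-(3 * Real.pi / 4) * |τ|) ≤ 1 :=
    Real.exp_le_one_iff.2 (by nlinarith [Real.pi_pos, abs_nonneg τ])
  rw [norm_mul, mul_assoc]
  gcongr
  · exact h1.trans (mul_le_of_le_one_right hC' h2)
  · exact hb t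

/-- The Mellin–Barnes density of the differentiated kernel, without its `τ`-dependent factors. -/
noncomputable def inversionDensity (α ν : ℝ) (N : ℕ) (t : ℝ) : ℂ :=
  sinProd N (ν + t * Complex.I)
    * (((α : ℂ) ^ 2 - (ν + t * Complex.I) ^ 2) * kernelMellin α (ν + t * Complex.I))

lemma expDecay_inversionDensity {α ν : ℝ} (h0 : -α < ν) (h1 : ν < 1 / 2) (N : ℕ) :
    ExpDecay (inversionDensity α ν N) := by
  have h := expDecay_kernelMellin h0 h1
  refine ExpDecay.sinProd_mul ?_ ν N
  have := (h.const_mul ((α : ℂ) ^ 2)).add ((h.mul_vertical ν).mul_vertical ν).neg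
  convert this using 2 with t
  ring

/-- The integrand of the approximation in the inversion formula, with the Mellin–Barnes integral for
the differentiated kernel written out. -/
noncomputable def inversionDoubleIntegrand (α ν : ℝ) (f : ℝ → ℂ) (N : ℕ) (x : ℝ) (q : ℝ × ℝ) : ℂ :=
  1 / (2 * Real.pi ^ 3) * (((q.1 * Real.sinh (Real.pi * q.1) : ℝ) : ℂ) * indexTransform α f q.1
    * gammaPair q.1 (ν + q.2 * Complex.I))
    * (inversionDensity α ν N q.2 * (x : ℂ) ^ (-(ν + q.2 * Complex.I)))

lemma inversionIntegrand_eq_integral {α ν x τ : ℝ} (hα : 0 < α) (h0 : 0 < ν) (h1 : ν < 1 / 2)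
    (hx : 0 < x) (hτ : 0 < τ) (f : ℝ → ℂ) (N : ℕ) :
    inversionIntegrand α f N x τ = ∫ t : ℝ, inversionDoubleIntegrand α ν f N x (τ, t) := by
  have hπ : (Real.pi : ℂ) ≠ 0 := by exact_mod_cast Real.pi_ne_zero
  set κ : ℂ := Complex.cosh (Real.pi * τ) / (2 * Real.pi ^ 3) with hκ
  have hd : ExpDecay fun t => κ * (gammaPair τ (ν + t * Complex.I)
      * kernelMellin α (ν + t * Complex.I)) :=
    ((expDecay_kernelMellin (by linarith) h1).gammaPair_mul h0 τ).const_mul κ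
  have hrep := inversionOp_eq_verticalTransform (α := α) (u := fun y => weberKernel α y τ) hd
    (σ := ν) (fun y hy => by
      rw [weberKernel_eq_integral hα hy hτ h0 h1, verticalTransform, ← integral_const_mul]
      refine integral_congr_ae (Eventually.of_forall fun t => ?_)
      simp only [hκ]
      ring) N hx
  have htanh : Complex.tanh (Real.pi * τ) * Complex.cosh (Real.pi * τ)
      = Complex.sinh (Real.pi * τ) := by
    have : Complex.cosh (Real.pi * τ) ≠ 0 := by
      have := (Real.cosh_pos (Real.pi * τ)).ne'
      exact_mod_cast this
    rw [Complex.tanh_eq_sinh_div_cosh, div_mul_cancel₀ _ this]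
  rw [inversionIntegrand, Complex.ofReal_mul, hrep, verticalTransform, ← integral_const_mul,
    ← integral_mul_const]
  refine integral_congr_ae (Eventually.of_forall fun t => ?_)
  simp only [inversionDoubleIntegrand, inversionDensity, hκ]
  push_cast
  rw [← htanh]
  ring

/-- The Gamma factors decay like `e^{-3πτ/4}` uniformly in `t`, against the growth of `sinh (πτ)`; what is
left is the `L¹` norm of `integrableOn_of_memLp_weightMeasure`. -/
lemma integrable_inversionDoubleIntegrand {α ν x : ℝ} (hα : 0 < α) (h0 : 0 < ν) (h1 : ν < 1 / 2)
    (hx : 0 < x) {f : ℝ → ℂ} (N : ℕ)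
    (hFm : AEStronglyMeasurable (indexTransform α f) (volume.restrict (Ioi (0 : ℝ))))
    (hF : IntegrableOn (fun τ => τ * Real.exp (Real.pi / 4 * τ) * ‖indexTransform α f τ‖) (Ioi 0)) :
    Integrable (inversionDoubleIntegrand α ν f N x)
      ((volume.restrict (Ioi (0 : ℝ))).prod volume) := by
  obtain ⟨C, hC, hb⟩ := exists_norm_gammaPair_le (a := ν) (b := ν) h0
  have hd := integrable_mul_cpow_vertical
    (expDecay_inversionDensity (α := α) (by linarith) h1 N).integrable ν hx
  have hdom := Integrable.mul_prod (hF.const_mul (‖(1 / (2 * Real.pi ^ 3) : ℂ)‖ * C)) hd.norm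
  refine hdom.mono' ?_ ?_
  · refine AEStronglyMeasurable.mul (AEStronglyMeasurable.const_mul (AEStronglyMeasurable.mul
      (AEStronglyMeasurable.mul (Continuous.aestronglyMeasurable ?_) hFm.comp_fst)
      (continuous_gammaPair_vertical h0).aestronglyMeasurable) _) hd.1.comp_snd
    exact Complex.continuous_ofReal.comp (continuous_fst.mul
      (Real.continuous_sinh.comp (continuous_const.mul continuous_fst)))
  · have hae : ∀ᵐ q : ℝ × ℝ ∂((volume.restrict (Ioi (0 : ℝ))).prod volume), 0 < q.1 :=
      Measure.quasiMeasurePreserving_fst.ae (ae_restrict_mem measurableSet_Ioi)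
    filter_upwards [hae] with q hq
    have h2 := hb q.1 (ν + q.2 * Complex.I) (by simp) (by simp)
    rw [abs_of_pos hq] at h2
    have hsinh0 : 0 < Real.sinh (Real.pi * q.1) := Real.sinh_pos_iff.2 (by positivity)
    have hsinh : Real.sinh (Real.pi * q.1) ≤ Real.exp (Real.pi * q.1) := by
      rw [Real.sinh_eq]
      have := Real.exp_pos (Real.pi * q.1)
      have := Real.exp_pos (-(Real.pi * q.1))
      linarith
    have hexp : Real.exp (Real.pi * q.1) * Real.exp (-(3 * Real.pi / 4) * q.1)
        = Real.exp (Real.pi / 4 * q.1) := by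
      rw [← Real.exp_add]; ring_nf
    rw [inversionDoubleIntegrand, norm_mul, norm_mul, norm_mul, norm_mul, Complex.norm_real,
      Real.norm_of_nonneg (by positivity)]
    refine mul_le_mul_of_nonneg_right ?_ (norm_nonneg _)
    calc _ ≤ ‖(1 / (2 * Real.pi ^ 3) : ℂ)‖ * (q.1 * Real.exp (Real.pi * q.1)
          * ‖indexTransform α f q.1‖ * (C * Real.exp (-(3 * Real.pi / 4) * q.1))) := by gcongr
      _ = ‖(1 / (2 * Real.pi ^ 3) : ℂ)‖ * C * (q.1 * (Real.exp (Real.pi * q.1)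
          * Real.exp (-(3 * Real.pi / 4) * q.1)) * ‖indexTransform α f q.1‖) := by ring
      _ = _ := by rw [hexp]

/-- After the pairing with `F_α f` is evaluated, all Gamma factors collapse into the ratio of the
partial products to the infinite product of the sine. -/
lemma integral_inversionIntegrand_eq {α ν x : ℝ} (h0 : 0 < ν) (h1 : ν < α) (h2 : ν < 1 / 2)
    (hx : 0 < x) {f : ℝ → ℂ} (hf : IntegrableOn f (Ioi (0 : ℝ)))
    (hfν : ∀ t : ℝ, MellinConvergent f (1 + (ν + t * Complex.I)))
    (hF : MemLp (indexTransform α f) 2 weightMeasure) (N : ℕ) :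
    IntegrableOn (inversionIntegrand α f N x) (Ioi (0 : ℝ)) ∧
    2 * (Real.pi : ℂ) ^ 2 * ∫ τ in Ioi (0 : ℝ), inversionIntegrand α f N x τ
      = (1 / (2 * Real.pi) : ℝ) • ∫ t : ℝ, (x : ℂ) ^ (-(ν + t * Complex.I)) •
        (sinProd N (ν + t * Complex.I) * (Real.pi * (2 * (ν + t * Complex.I))
          / Complex.sin (Real.pi * (2 * (ν + t * Complex.I))))
          * mellin f (1 + (ν + t * Complex.I))) := by
  have hα : 0 < α := h0.trans h1
  have hπ : (Real.pi : ℂ) ≠ 0 := by exact_mod_cast Real.pi_ne_zero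
  obtain ⟨hFm, hFi⟩ := integrableOn_of_memLp_weightMeasure hF
  have hτF : IntegrableOn (fun τ : ℝ => (τ : ℂ) * indexTransform α f τ) (Ioi 0) := by
    refine hFi.mono' (Complex.continuous_ofReal.aestronglyMeasurable.mul hFm) ?_
    filter_upwards [ae_restrict_mem measurableSet_Ioi] with τ hτ
    have hτ0 : 0 < τ := hτ
    rw [norm_mul, Complex.norm_real, Real.norm_of_nonneg hτ0.le]
    have := Real.one_le_exp (show 0 ≤ Real.pi / 4 * τ by positivity)
    gcongr
    exact le_mul_of_one_le_right hτ0.le this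
  have hint := integrable_inversionDoubleIntegrand (ν := ν) hα h0 h2 hx N hFm hFi
  have heq : ∀ τ ∈ Ioi (0 : ℝ), inversionIntegrand α f N x τ
      = ∫ t : ℝ, inversionDoubleIntegrand α ν f N x (τ, t) := fun τ hτ =>
    inversionIntegrand_eq_integral hα h0 h2 hx hτ f N
  refine ⟨IntegrableOn.congr_fun hint.integral_prod_left (fun τ hτ => (heq τ hτ).symm)
    measurableSet_Ioi, ?_⟩
  rw [setIntegral_congr_fun measurableSet_Ioi heq,
    integral_integral_swap (f := fun τ t => inversionDoubleIntegrand α ν f N x (τ, t)) hint,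
    ← integral_const_mul, Complex.real_smul, ← integral_const_mul]
  refine integral_congr_ae (Eventually.of_forall fun t => ?_)
  simp only [inversionDoubleIntegrand]
  rw [integral_mul_const, integral_const_mul,
    integral_mul_indexTransform_mul_gammaPair h0 h1 h2 hf t (hfν t) hτF,
    ← sq_sub_sq_mul_kernelMellin_mul (α := α) (s := ν + t * Complex.I) (by simpa) (by simpa),
    inversionDensity, smul_eq_mul]
  push_cast
  field_simp

/-- Dominated convergence, with the bound `norm_sinProd_mul_div_sin_le`. -/
lemma tendsto_integral_inversion {ν x : ℝ} (h0 : 0 < ν) (h1 : ν < 1 / 2) (hx : 0 < x)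
    {m : ℝ → ℂ} (hm : Integrable m) :
    Tendsto (fun N : ℕ => ∫ t : ℝ, (x : ℂ) ^ (-(ν + t * Complex.I)) •
        (sinProd N (ν + t * Complex.I) * (Real.pi * (2 * (ν + t * Complex.I))
          / Complex.sin (Real.pi * (2 * (ν + t * Complex.I)))) * m t))
      atTop (𝓝 (∫ t : ℝ, (x : ℂ) ^ (-(ν + t * Complex.I)) • m t)) := by
  have hre : ∀ t : ℝ, ((ν : ℂ) + t * Complex.I).re = ν := fun t => by simp
  have hne : ∀ t : ℝ, (ν : ℂ) + t * Complex.I ≠ 0 := fun t h => by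
    have := hre t; rw [h] at this; simp at this; linarith
  have hsin : ∀ t : ℝ, Complex.sin (Real.pi * (2 * (ν + t * Complex.I))) ≠ 0 := fun t =>
    sin_pi_mul_ne_zero_of_forall_ne_intCast (ne_intCast_of_abs_re_lt_one (by simp; linarith)
      (by simp; linarith) (by simpa using hne t))
  refine tendsto_integral_of_dominated_convergence
    (fun t => x ^ (-ν) * (Real.pi * (2 * ν) / Real.sin (Real.pi * (2 * ν)) * ‖m t‖)) ?_
    ((hm.norm.const_mul _).const_mul _) ?_ ?_
  · intro N
    refine AEStronglyMeasurable.smul (Continuous.aestronglyMeasurable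
      (Continuous.const_cpow (by fun_prop) (Or.inl (by exact_mod_cast hx.ne'))))
      (AEStronglyMeasurable.mul (Continuous.aestronglyMeasurable ?_) hm.1)
    refine Continuous.mul ?_ (Continuous.div (by fun_prop) (by fun_prop) hsin)
    unfold sinProd
    fun_prop
  · intro N
    refine Eventually.of_forall fun t => ?_
    have hb := norm_sinProd_mul_div_sin_le (s := ν + t * Complex.I) (by rwa [hre]) (by rwa [hre]) N
    rw [hre] at hb
    rw [norm_smul, norm_mul _ (m t), Complex.norm_cpow_eq_rpow_re_of_pos hx, Complex.neg_re, hre]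
    gcongr
  · refine Eventually.of_forall fun t => Tendsto.const_smul ?_ _
    have hz : (Real.pi * (2 * (ν + t * Complex.I)) : ℂ) ≠ 0 := by
      have : (Real.pi : ℂ) ≠ 0 := by exact_mod_cast Real.pi_ne_zero
      exact mul_ne_zero this (mul_ne_zero two_ne_zero (hne t))
    have h3 := ((tendsto_sinProd (hne t)).mul_const (Real.pi * (2 * (ν + t * Complex.I))
      / Complex.sin (Real.pi * (2 * (ν + t * Complex.I))))).mul_const (m t)
    rwa [div_mul_div_cancel₀ hz, div_self (hsin t), one_mul] at h3

theorem theorem3 (α : ℝ) (hα : 0 < α) (f : ℝ → ℂ)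
    (hf : LocallyIntegrableOn f (Ioi (0 : ℝ)))
    (a b : ℝ)
    (hf0 : f =O[𝓝[>] (0 : ℝ)] (fun x : ℝ => x ^ (-a)))
    (hfinf : f =O[atTop] (fun x : ℝ => x ^ (-b)))
    (hab : a < b) (hb : 1 < b) (haα : a < 1 + α)
    (ν : ℝ) (hν_lower : max (a - 1) 0 < ν) (hν_upper : ν < min (1 / 4) (min α (b - 1)))
    (hmellin : Integrable (fun t : ℝ => mellin f (1 + (ν + t * Complex.I))))
    (hF_exists : ∀ τ : ℝ, 0 < τ →
      IntegrableOn (fun x : ℝ => (weberKernel α x τ : ℂ) * f x) (Ioi (0 : ℝ)))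
    (hF : MemLp (indexTransform α f) 2 weightMeasure) :
    ∃ g : ℝ → ℂ, ContinuousOn g (Ioi (0 : ℝ)) ∧
      f =ᵐ[volume.restrict (Ioi (0 : ℝ))] g ∧
      ∀ x : ℝ, 0 < x →
        (∀ N : ℕ, IntegrableOn (inversionIntegrand α f N x) (Ioi (0 : ℝ))) ∧
        Tendsto
          (fun N : ℕ => 2 * (Real.pi : ℂ) ^ 2 *
            ∫ τ in Ioi (0 : ℝ), inversionIntegrand α f N x τ)
          atTop (𝓝 ((x : ℂ) * g x)) := by
  obtain ⟨hν1, hν0⟩ := max_lt_iff.1 hν_lower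
  obtain ⟨hν4, hν'⟩ := lt_min_iff.1 hν_upper
  obtain ⟨hνα, hνb⟩ := lt_min_iff.1 hν'
  have hfν : ∀ t : ℝ, MellinConvergent f (1 + (ν + t * Complex.I)) := fun t =>
    mellinConvergent_of_isBigO_rpow hf hfinf (by simp; linarith) hf0 (by simp; linarith)
  have hfν0 : IntegrableOn (fun x : ℝ => ((x ^ ν : ℝ) : ℂ) * f x) (Ioi 0) := by
    refine IntegrableOn.congr_fun (hfν 0) (fun x hx => ?_) measurableSet_Ioi
    simp [Complex.ofReal_cpow (mem_Ioi.1 hx).le]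
  have hfm := hf.aestronglyMeasurable
  have hf1 : IntegrableOn f (Ioi 0) := by
    rw [← Ioc_union_Ioi_eq_Ioi zero_le_one]
    refine IntegrableOn.union (integrableOn_of_integrableOn_weberKernel_mul hα hf hνα.le
      (by linarith) (hfν0.mono_set Ioc_subset_Ioi_self) hF_exists) ?_
    have hsub : Ioi (1 : ℝ) ⊆ Ioi 0 := Ioi_subset_Ioi zero_le_one
    refine (hfν0.mono_set hsub).norm.mono' (hfm.mono_measure (Measure.restrict_mono hsub le_rfl)) ?_
    filter_upwards [ae_restrict_mem measurableSet_Ioi] with x hx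
    have hx1 : 1 < x := hx
    rw [norm_mul, Complex.norm_real, Real.norm_of_nonneg (by positivity)]
    exact le_mul_of_one_le_left (norm_nonneg _) (Real.one_le_rpow hx1.le hν0.le)
  set M : ℂ → ℂ := fun s => mellin f (1 + s) with hM
  have hMh : mellin (fun x : ℝ => (x : ℂ) ^ (1 : ℂ) • f x) = M := by
    funext s
    rw [mellin_cpow_smul, hM, add_comm]
  refine ⟨fun x => (x : ℂ)⁻¹ * mellinInv ν M x, ?_, ?_, fun x hx => ⟨fun N =>
    (integral_inversionIntegrand_eq hν0 hνα (by linarith) hx hf1 hfν hF N).1, ?_⟩⟩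
  · refine ContinuousOn.mul ?_ (continuousOn_mellinInv hmellin)
    exact Complex.continuous_ofReal.continuousOn.inv₀ fun x hx => by
      exact_mod_cast (mem_Ioi.1 hx).ne'
  · have hconv : MellinConvergent (fun x : ℝ => (x : ℂ) ^ (1 : ℂ) • f x) ν := by
      rw [MellinConvergent.cpow_smul]
      simpa [add_comm] using hfν 0
    have hae := mellinInv_mellin_ae_eq hconv (by rw [hMh]; exact hmellin)
    filter_upwards [hae, ae_restrict_mem measurableSet_Ioi] with x hx hx0
    have hx' : (x : ℂ) ≠ 0 := by exact_mod_cast (mem_Ioi.1 hx0).ne'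
    rw [hMh, Complex.cpow_one, smul_eq_mul] at hx
    rw [← hx, inv_mul_cancel_left₀ hx']
  · have hx' : (x : ℂ) ≠ 0 := by exact_mod_cast hx.ne'
    rw [mul_inv_cancel_left₀ hx']
    have hlim := (tendsto_integral_inversion hν0 (by linarith) hx hmellin).const_smul (1 / (2 * Real.pi) : ℝ)
    refine hlim.congr fun N => ?_
    exact (integral_inversionIntegrand_eq hν0 hνα (by linarith) hx hf1 hfν hF N).2.symm
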